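/- Let $\lambda,\mu\in\mathbb R$ with $\mu>0$, $3\lambda+2\mu>0$, let $\omega>0$, and set $k_p=\omega/\sqrt{\lambda+2\mu}$, $k_s=\omega/\sqrt{\mu}$. Let $d,d^\perp\in\mathbb S^2\subset\mathbb R^3$ with $d\cdot d^\perp=0$. Let $D\subset\mathbb R^3$ be a bounded open set with Lipschitz boundary such that $\mathbb R^3\setminus\overline D$ is connected, let $\mathbf a\in\mathbb R^3$, and write $D_{\mathbf a}=\mathbf a+D$. For $\alpha,\beta\in\mathbb C$ let $u^{in}(x)=\alpha\,d\,e^{ik_px\cdot d}+\beta\,d^\perp e^{ik_sx\cdot d}$. The scattered field $u^{sc}$ of a rigid scatterer $D$ is the field in $\mathbb R^3\setminus\overline D$ such that the total field $u=u^{in}+u^{sc}$ lies in $H^1_{loc}$ up to the boundary, satisfies the Navier equation $\mu\Delta u+(\lambda+\mu)\,\mathrm{grad}\,\mathrm{div}\,u+\omega^2u=0$ in $\mathbb R^3\setminus\overline D$ and $u=0$ on $\partial D$ (in the sense of traces), and such that $u^{sc}_p=-k_p^{-2}\,\mathrm{grad}\,\mathrm{div}\,u^{sc}$ and $u^{sc}_s=k_s^{-2}\,\mathrm{curl}\,\mathrm{curl}\,u^{sc}$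 satisfy Kupradze's radiation condition: with $r=|x|$, $$\lim_{r\to\infty}r\Big(\frac{\partial u^{sc}_p}{\partial r}-ik_pu^{sc}_p\Big)=0,\qquad \lim_{r\to\infty}r\Big(\frac{\partial u^{sc}_s}{\partial r}-ik_su^{sc}_s\Big)=0$$ uniformly in all directions. Its P- and S-far-field patterns $u_p^\infty(\cdot;D),u_s^\infty(\cdot;D):\mathbb S^2\to\mathbb C^3$ are defined by $$u^{sc}(x)=\frac{e^{ik_p|x|}}{4\pi(\lambda+\mu)|x|}\,u_p^\infty(\hat x;D)+\frac{e^{ik_s|x|}}{4\pi\mu|x|}\,u_s^\infty(\hat x;D)+O\Big(\frac1{|x|^2}\Big),\qquad |x|\to\infty,\quad \hat x=\frac{x}{|x|},$$ uniformly in $\hat x\in\mathbb S^2$. Then for all $\hat x\in\mathbb S^2$ the following holds. If $\alpha=1$, $\beta=0$ (incident P-wave), then $$u^\infty_p(\hat x;D_{\mathbf a})=u^\infty_p(\hat x;D)\,e^{ik_p(d-\hat x)\cdot\mathbf a},\qquad u^\infty_s(\hat x;D_{\mathbf a})=u^\infty_s(\hat x;D)\,e^{i(k_pd-k_s\hat x)\cdot\mathbf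 a}.$$ If $\alpha=0$, $\beta=1$ (incident S-wave), then $$u^\infty_p(\hat x;D_{\mathbf a})=u^\infty_p(\hat x;D)\,e^{i(k_sd-k_p\hat x)\cdot\mathbf a},\qquad u^\infty_s(\hat x;D_{\mathbf a})=u^\infty_s(\hat x;D)\,e^{ik_s(d-\hat x)\cdot\mathbf a}.$$ -/

import Mathlib

open scoped ContDiff

noncomputable section

namespace ElasticScattering

/-- Physical space `ℝ³`, with the Euclidean norm. -/
abbrev R3 : Type := EuclideanSpace ℝ (Fin 3)

/-- Complex vectors `ℂ³`, the values of displacement fields. -/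
abbrev C3 : Type := EuclideanSpace ℂ (Fin 3)

/-- The unit sphere of `ℝ³`. -/
abbrev S2 : Type := Metric.sphere (0 : R3) 1

/-! ### Vector calculus -/

/-- The `j`-th standard basis vector of `ℝ³`. -/
def basisVec (j : Fin 3) : R3 := EuclideanSpace.single j (1 : ℝ)

/-- The classical partial derivative `∂u_i / ∂x_j` at `x`. -/
def partialD (u : R3 → C3) (i j : Fin 3) (x : R3) : ℂ :=
  (fderiv ℝ u x (basisVec j)) i

/-- Gradient of a complex-valued function. -/
def grad (f : R3 → ℂ) (x : R3) : C3 :=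
  WithLp.toLp 2 (fun j => fderiv ℝ f x (basisVec j))

/-- Divergence of a vector field. -/
def div (u : R3 → C3) (x : R3) : ℂ := ∑ j : Fin 3, partialD u j j x

/-- Curl of a vector field. -/
def curl (u : R3 → C3) (x : R3) : C3 :=
  WithLp.toLp 2 ![partialD u 2 1 x - partialD u 1 2 x,
    partialD u 0 2 x - partialD u 2 0 x,
    partialD u 1 0 x - partialD u 0 1 x]

/-- The radial derivative `∂u/∂r` at `x ≠ 0`. -/
def radialD (u : R3 → C3) (x : R3) : C3 := fderiv ℝ u x (‖x‖⁻¹ • x)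

/-- The Lamé operator `Δ* u = μ Δu + (λ + μ) grad div u`. -/
def lameOp (lam mu : ℝ) (u : R3 → C3) (x : R3) : C3 :=
  mu • Laplacian.laplacian u x + (lam + mu) • grad (div u) x

/-! ### Wave numbers, incident waves, pressure and shear parts -/

/-- Compressional wave number `k_p = ω / √(λ + 2μ)`. -/
def kP (lam mu omega : ℝ) : ℝ := omega / Real.sqrt (lam + 2 * mu)

/-- Shear wave number `k_s = ω / √μ`. -/
def kS (mu omega : ℝ) : ℝ := omega / Real.sqrt mu

/-- A real vector regarded as a complex vector. -/
def toC3 (v : R3) : C3 := WithLp.toLp 2 (fun j => (v j : ℂ))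

/-- The incident plane wave `α d e^{i k_p x·d} + β d^⊥ e^{i k_s x·d}`. -/
def incident (lam mu omega : ℝ) (d dperp : R3) (alpha beta : ℂ) (x : R3) : C3 :=
  (alpha * Complex.exp (Complex.I * ((kP lam mu omega * inner ℝ x d : ℝ) : ℂ))) • toC3 d
    + (beta * Complex.exp (Complex.I * ((kS mu omega * inner ℝ x d : ℝ) : ℂ))) • toC3 dperp

/-- Pressure part `u_p = - k_p⁻² grad div u`. -/
def pPart (lam mu omega : ℝ) (u : R3 → C3) (x : R3) : C3 :=
  (-(1 / kP lam mu omega ^ 2)) • grad (div u) x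

/-- Shear part `u_s = k_s⁻² curl curl u`. -/
def sPart (mu omega : ℝ) (u : R3 → C3) (x : R3) : C3 :=
  (1 / kS mu omega ^ 2) • curl (curl u) x

/-! ### Rigid scatterers -/

/-- The boundary of the open set `D` is Lipschitz: near each boundary point, in suitable Cartesian
coordinates (with vertical direction `n`), `D` is the set of points lying strictly below the graph
of a Lipschitz function `g` of the horizontal coordinates. -/
def HasLipschitzBoundary (D : Set R3) : Prop :=
  ∀ p ∈ frontier D, ∃ (n : R3) (g : R3 → ℝ) (K : NNReal) (r : ℝ),
    ‖n‖ = 1 ∧ LipschitzWith K g ∧ 0 < r ∧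
      ∀ x ∈ Metric.ball p r, x ∈ D ↔ inner ℝ x n < g (x - inner ℝ x n • n)

/-- The exterior `ℝ³ \ closure D`. -/
def exterior (D : Set R3) : Set R3 := (closure D)ᶜ

/-- A rigid scatterer: a bounded open set (possibly with several components) with Lipschitz boundary
and connected exterior. -/
structure IsScatterer (D : Set R3) : Prop where
  isOpen : IsOpen D
  isBounded : Bornology.IsBounded D
  exterior_connected : IsConnected (exterior D)
  lipschitz : HasLipschitzBoundary D

/-! ### The direct scattering problem -/

/-- The field `v`, continuously differentiable on the open set `W`, belongs to `H¹₀(W)`: it is the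
limit in `H¹(W)` of smooth fields with compact support in `W`. -/
def MemH10 (W : Set R3) (v : R3 → C3) : Prop :=
  ∃ φ : ℕ → R3 → C3,
    (∀ n, ContDiff ℝ ∞ (φ n) ∧ HasCompactSupport (φ n) ∧ tsupport (φ n) ⊆ W) ∧
    Filter.Tendsto (fun n => MeasureTheory.eLpNorm (fun x => φ n x - v x) 2
      (MeasureTheory.volume.restrict W)) Filter.atTop (nhds 0) ∧
    Filter.Tendsto (fun n => MeasureTheory.eLpNorm (fun x => fderiv ℝ (φ n) x - fderiv ℝ v x) 2
      (MeasureTheory.volume.restrict W)) Filter.atTop (nhds 0)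

/-- `u` is in `H¹(W ∩ B_R)` for every ball `B_R` about the origin (for `u` differentiable on `W`). -/
def MemH1loc (W : Set R3) (u : R3 → C3) : Prop :=
  ∀ R : ℝ, MeasureTheory.MemLp u 2
      (MeasureTheory.volume.restrict (W ∩ Metric.ball 0 R)) ∧
    MeasureTheory.MemLp (fderiv ℝ u) 2
      (MeasureTheory.volume.restrict (W ∩ Metric.ball 0 R))

/-- Kupradze's radiation condition: `r (∂u_p/∂r - i k_p u_p) → 0` and `r (∂u_s/∂r - i k_s u_s) → 0`
as `r = |x| → ∞`, uniformly in all directions. -/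
def IsRadiating (lam mu omega : ℝ) (u : R3 → C3) : Prop :=
  Filter.Tendsto (fun x : R3 => ‖x‖ • (radialD (pPart lam mu omega u) x
      - (Complex.I * (kP lam mu omega : ℂ)) • pPart lam mu omega u x))
    (Bornology.cobounded R3) (nhds 0) ∧
  Filter.Tendsto (fun x : R3 => ‖x‖ • (radialD (sPart mu omega u) x
      - (Complex.I * (kS mu omega : ℂ)) • sPart mu omega u x))
    (Bornology.cobounded R3) (nhds 0)

/-- `usc` is the scattered field of the direct scattering problem for the rigid scatterer `D` and the
incident field `uin`. The total field `u = uin + usc` solves the Navier equation in the exterior of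
`D` (where it is smooth, by interior regularity), is in `H¹` up to the boundary on bounded parts of
the exterior, and has vanishing trace on `∂D`: every cutoff of it is in `H¹₀` of the exterior. The
scattered field is radiating. The values of `usc` on `closure D` play no role. -/
structure IsScatteredField (lam mu omega : ℝ) (D : Set R3) (uin usc : R3 → C3) : Prop where
  smooth : ContDiffOn ℝ ∞ (uin + usc) (exterior D)
  navier : ∀ x ∈ exterior D,
    lameOp lam mu (uin + usc) x + (omega ^ 2) • (uin + usc) x = 0
  memH1loc : MemH1loc (exterior D) (uin + usc)
  dirichlet : ∀ χ : R3 → ℝ, ContDiff ℝ ∞ χ → HasCompactSupport χ →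
    MemH10 (exterior D) (fun x => χ x • (uin + usc) x)
  radiating : IsRadiating lam mu omega usc

/-- The P-part `Up` and the S-part `Us` of the far-field pattern of the field `usc`: at `x = r θ`,
`usc(x) = e^{i k_p r} / (4π(λ+μ) r) Up(θ) + e^{i k_s r} / (4πμ r) Us(θ) + O(1/r²)` as `r → ∞`,
uniformly in `θ` on the unit sphere. -/
def HasFarField (lam mu omega : ℝ) (usc : R3 → C3) (Up Us : S2 → C3) : Prop :=
  ∃ C R : ℝ, ∀ r : ℝ, 0 < r → R ≤ r → ∀ θ : S2,
    ‖usc (r • (θ : R3))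
      - ((Complex.exp (Complex.I * ((kP lam mu omega * r : ℝ) : ℂ))
            / ((4 * Real.pi * (lam + mu) * r : ℝ) : ℂ)) • Up θ
        + (Complex.exp (Complex.I * ((kS mu omega * r : ℝ) : ℂ))
            / ((4 * Real.pi * mu * r : ℝ) : ℂ)) • Us θ)‖ ≤ C / r ^ 2

/-- `Up` and `Us` are the P-part and the S-part of the far-field pattern produced by the rigid
scatterer `D` under the incident plane wave with parameters `d, d^⊥, α, β, ω`. -/
def IsFarFieldPattern (lam mu omega : ℝ) (d dperp : R3) (alpha beta : ℂ) (D : Set R3)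
    (Up Us : S2 → C3) : Prop :=
  ∃ usc : R3 → C3,
    IsScatteredField lam mu omega D (incident lam mu omega d dperp alpha beta) usc ∧
      HasFarField lam mu omega usc Up Us

/-- The translate `a + D`. -/
def translate (a : R3) (D : Set R3) : Set R3 := (fun x => a + x) '' D

/-- The phase factor `e^{i t}` for real `t`. -/
def phase (t : ℝ) : ℂ := Complex.exp (Complex.I * (t : ℂ))

end ElasticScattering

end

/-!
The total field `u'` for the translated scatterer, pulled back by `x ↦ x + a`, and the total field
`u` for the original scatterer see the same domain. Since the incident plane wave only picks up a
constant unimodular factor `z` under this translation, the difference `w(x) = u'(x + a) - z u(x)`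
contains no incident field: it solves the Lamé system in the exterior domain, has vanishing
Dirichlet data, and is a sum of outgoing spherical waves with the two wave numbers up to `o(1/|x|)`.
As `|x + a| = |x| + x̂·a + o(1)`, its amplitudes are the differences `e^{i k x̂·a} V(x̂) - z U(x̂)`
of the far-field patterns (`Outgoing.comp_add`), so the translation law says exactly that such a
solution has no far field. This is `IsDirichletSolution.amplitude_eq_zero`; `farField_translate`
puts the pieces together.

The vanishing of the far field is conservation of energy. Testing the equation with the cut off
conjugate of the solution shows that the flux through a large shell, smeared by the gradient of a
cutoff, has no imaginary part (`energy_identity`, `scaled_flux_eq_zero`). Asymptotically, the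
imaginary part of this flux is, up to sign, bounded below by positive multiples of `|P|²` and
`|S|²`, where `P` and `S` are the two amplitudes: each wave contributes separately because the mixed
terms oscillate with the phase `(k₁ - k₂)|x|` and disappear in the limit (`tendsto_flux_twoWave`),
and the sign is that of the quadratic form of the system (`Coercive.flux_density`). For the Lamé
system, the coefficients can be chosen so that this form controls the full gradient
(`coercive_lameCoeff`).

Two points need care, since the asymptotics are those of the field itself, not of its derivatives,
and hold for amplitudes that are not known to be regular.
* The amplitudes are uniform limits of continuously differentiable functions, obtained by combining
  the field at two large radii so that one of the two waves drops out
  (`Outgoing.exists_smooth_approx`).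
* If the field is uniformly `ε`-close to a wave with such amplitudes, the flux changes by `O(ε)`
  only (`flux_compare`): the derivative of the error is moved to the wave by an integration by
  parts, and Caccioppoli's estimate (`caccioppoli`) bounds the gradient of the field on large
  shells.

Neither Rellich's lemma nor unique continuation is needed, because only the far fields are compared.
-/

noncomputable section

namespace ElasticScattering

open MeasureTheory Filter Topology ComplexConjugate

variable {c : Fin 3 → Fin 3 → Fin 3 → Fin 3 → ℝ} {omega lam mu k₁ k₂ : ℝ} {W : Set R3}
  {u : Fin 3 → R3 → ℂ}

/-! ### Partial derivatives and integration by parts -/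

/-- The partial derivative `∂f/∂x_j` of a scalar function. -/
def pd {F : Type*} [NormedAddCommGroup F] [NormedSpace ℝ F] (f : R3 → F) (j : Fin 3) (x : R3) : F :=
  fderiv ℝ f x (basisVec j)

lemma norm_basisVec (j : Fin 3) : ‖basisVec j‖ = 1 := by
  simp [basisVec]

lemma inner_basisVec (x : R3) (j : Fin 3) : inner ℝ x (basisVec j) = x j := by
  simp [basisVec, EuclideanSpace.inner_single_right]

lemma pd_congr {F : Type*} [NormedAddCommGroup F] [NormedSpace ℝ F] {f g : R3 → F} {j : Fin 3}
    {x : R3} (h : f =ᶠ[𝓝 x] g) : pd f j x = pd g j x := by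
  unfold pd; rw [h.fderiv_eq]

lemma pd_mul {f g : R3 → ℂ} {j : Fin 3} {x : R3} (hf : DifferentiableAt ℝ f x)
    (hg : DifferentiableAt ℝ g x) :
    pd (fun y => f y * g y) j x = f x * pd g j x + pd f j x * g x := by
  unfold pd; rw [fderiv_fun_mul hf hg]; simp [mul_comm]

lemma pd_add {f g : R3 → ℂ} {j : Fin 3} {x : R3} (hf : DifferentiableAt ℝ f x)
    (hg : DifferentiableAt ℝ g x) :
    pd (fun y => f y + g y) j x = pd f j x + pd g j x := by
  unfold pd; rw [fderiv_fun_add hf hg]; simp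

lemma pd_sub {f g : R3 → ℂ} {j : Fin 3} {x : R3} (hf : DifferentiableAt ℝ f x)
    (hg : DifferentiableAt ℝ g x) :
    pd (fun y => f y - g y) j x = pd f j x - pd g j x := by
  unfold pd; rw [fderiv_fun_sub hf hg]; simp

lemma pd_const_mul {f : R3 → ℂ} {j : Fin 3} {x : R3} (hf : DifferentiableAt ℝ f x) (c : ℂ) :
    pd (fun y => c * f y) j x = c * pd f j x := by
  unfold pd; rw [fderiv_const_mul hf]; simp

lemma pd_conj (f : R3 → ℂ) (j : Fin 3) (x : R3) :
    pd (fun y => conj (f y)) j x = conj (pd f j x) := by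
  unfold pd
  have := (Complex.conjCLE.comp_fderiv (f := f) (x := x))
  have h2 : (Complex.conjCLE ∘ f) = fun y => conj (f y) := by ext y; simp
  rw [h2] at this
  rw [this]; simp

lemma pd_ofReal {f : R3 → ℝ} {j : Fin 3} {x : R3} (hf : DifferentiableAt ℝ f x) :
    pd (fun y => (f y : ℂ)) j x = ((pd f j x : ℝ) : ℂ) := by
  unfold pd
  have := (Complex.ofRealCLM.hasFDerivAt.comp x hf.hasFDerivAt).fderiv
  have h2 : (Complex.ofRealCLM ∘ f) = fun y => (f y : ℂ) := by ext y; simp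
  rw [h2] at this
  rw [this]; simp

lemma pd_comp_add (f : R3 → ℂ) (a : R3) (j : Fin 3) (x : R3) :
    pd (fun y => f (y + a)) j x = pd f j (x + a) := by
  unfold pd; rw [fderiv_comp_add_right]

lemma pd_comp_smul {F : Type*} [NormedAddCommGroup F] [NormedSpace ℝ F] (f : R3 → F) (r : ℝ)
    (j : Fin 3) (x : R3) : pd (fun y => f (r • y)) j x = r • pd f j (r • x) := by
  unfold pd; rw [fderiv_comp_smul]; simp

lemma contDiffOn_pd {F : Type*} [NormedAddCommGroup F] [NormedSpace ℝ F] {f : R3 → F} {W : Set R3}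
    {m n : WithTop ℕ∞} (hW : IsOpen W) (hf : ContDiffOn ℝ n f W) (hmn : m + 1 ≤ n) (j : Fin 3) :
    ContDiffOn ℝ m (pd f j) W :=
  (hf.fderiv_of_isOpen hW hmn).clm_apply contDiffOn_const

lemma contDiff_pd {F : Type*} [NormedAddCommGroup F] [NormedSpace ℝ F] {f : R3 → F}
    {m n : WithTop ℕ∞} (hf : ContDiff ℝ n f) (hmn : m + 1 ≤ n) (j : Fin 3) :
    ContDiff ℝ m (pd f j) :=
  contDiffOn_univ.1 (contDiffOn_pd isOpen_univ hf.contDiffOn hmn j)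

lemma tsupport_pd_subset {F : Type*} [NormedAddCommGroup F] [NormedSpace ℝ F] (f : R3 → F)
    (j : Fin 3) : tsupport (pd f j) ⊆ tsupport f :=
  (tsupport_fderiv_apply_subset ℝ (basisVec j))

lemma hasCompactSupport_pd {F : Type*} [NormedAddCommGroup F] [NormedSpace ℝ F] {f : R3 → F}
    (hf : HasCompactSupport f) (j : Fin 3) : HasCompactSupport (pd f j) :=
  hf.fderiv_apply ℝ (basisVec j)

lemma contDiff_mul_of_tsupport {n : WithTop ℕ∞} {W : Set R3} (hW : IsOpen W) {f g : R3 → ℂ}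
    (hf : ContDiffOn ℝ n f W) (hg : ContDiff ℝ n g) (hs : tsupport g ⊆ W) :
    ContDiff ℝ n (fun x => f x * g x) := by
  refine contDiff_iff_contDiffAt.2 fun x => ?_
  by_cases hx : x ∈ tsupport g
  · exact (hf.contDiffAt (hW.mem_nhds (hs hx))).mul hg.contDiffAt
  · have h0 : (fun x => f x * g x) =ᶠ[𝓝 x] fun _ => 0 := by
      filter_upwards [notMem_tsupport_iff_eventuallyEq.1 hx] with y hy
      simp [hy]
    exact contDiffAt_const.congr_of_eventuallyEq h0

lemma continuous_mul_of_tsupport {W : Set R3} (hW : IsOpen W) {f g : R3 → ℂ}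
    (hf : ContinuousOn f W) (hg : Continuous g) (hs : tsupport g ⊆ W) :
    Continuous (fun x => f x * g x) :=
  contDiff_zero.1 (contDiff_mul_of_tsupport hW (contDiffOn_zero.2 hf) (contDiff_zero.2 hg) hs)

lemma integrable_mul_of_tsupport {W : Set R3} (hW : IsOpen W) {f g : R3 → ℂ}
    (hf : ContinuousOn f W) (hg : Continuous g) (hs : tsupport g ⊆ W) (hc : HasCompactSupport g) :
    Integrable (fun x => f x * g x) :=
  (continuous_mul_of_tsupport hW hf hg hs).integrable_of_hasCompactSupport hc.mul_left

/-- Integration by parts for a function of class `C¹` near the support of a test function. -/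
lemma integral_pd_mul {W : Set R3} (hW : IsOpen W) {f g : R3 → ℂ} (hf : ContDiffOn ℝ 1 f W)
    (hg : ContDiff ℝ 1 g) (hc : HasCompactSupport g) (hs : tsupport g ⊆ W) (j : Fin 3) :
    ∫ x, pd f j x * g x = - ∫ x, f x * pd g j x := by
  have hf1 : ContinuousOn (pd f j) W := (contDiffOn_pd (m := 0) hW hf (by simp) j).continuousOn
  have hg1 : Continuous (pd g j) := (contDiff_pd (m := 0) hg (by simp) j).continuous
  have h := integral_mul_fderiv_eq_neg_fderiv_mul_of_integrable (μ := volume) (f := f) (g := g)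
    (v := basisVec j)
    (integrable_mul_of_tsupport hW hf1 hg.continuous hs hc)
    (integrable_mul_of_tsupport hW hf.continuousOn hg1 ((tsupport_pd_subset g j).trans hs)
      (hasCompactSupport_pd hc j))
    (integrable_mul_of_tsupport hW hf.continuousOn hg.continuous hs hc)
    (fun x hx => (hf.contDiffAt (hW.mem_nhds (hs hx))).differentiableAt one_ne_zero)
    (fun x _ => hg.differentiable one_ne_zero x)
  unfold pd
  rw [h, neg_neg]

/-- The equation `∂_l (c_{ijkl} ∂_j u_i) + ω² u_k = 0` in weak form, tested with a test function in
the `k`-th component. -/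
lemma weak_form {c : Fin 3 → Fin 3 → Fin 3 → Fin 3 → ℝ} {omega : ℝ} {W : Set R3} (hW : IsOpen W)
    {u : Fin 3 → R3 → ℂ} (hu : ∀ i, ContDiffOn ℝ ∞ (u i) W)
    {k : Fin 3} (heq : ∀ x ∈ W, ∑ i, ∑ j, ∑ l, (c i j k l : ℂ) * pd (pd (u i) j) l x
      + (omega : ℂ) ^ 2 * u k x = 0) {φ : R3 → ℂ} (hφ : ContDiff ℝ 1 φ)
    (hc : HasCompactSupport φ) (hs : tsupport φ ⊆ W) :
    ∑ i, ∑ j, ∑ l, (c i j k l : ℂ) * ∫ x, pd (u i) j x * pd φ l x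
      = (omega : ℂ) ^ 2 * ∫ x, u k x * φ x := by
  have h1 : ∀ i j, ContDiffOn ℝ ∞ (pd (u i) j) W := fun i j =>
    contDiffOn_pd hW (hu i) (by simp) j
  have h2 : ∀ i j l, ContDiffOn ℝ ∞ (pd (pd (u i) j) l) W := fun i j l =>
    contDiffOn_pd hW (h1 i j) (by simp) l
  have hI : ∀ i j l, Integrable (fun x => (c i j k l : ℂ) * (pd (pd (u i) j) l x * φ x)) :=
    fun i j l =>
      (integrable_mul_of_tsupport hW (h2 i j l).continuousOn hφ.continuous hs hc).const_mul _
  have hibp : ∀ i j l, ∫ x, pd (u i) j x * pd φ l x = - ∫ x, pd (pd (u i) j) l x * φ x := by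
    intro i j l
    rw [integral_pd_mul hW ((h1 i j).of_le (by simp)) hφ hc hs l, neg_neg]
  have hsum : ∫ x, ∑ i, ∑ j, ∑ l, (c i j k l : ℂ) * (pd (pd (u i) j) l x * φ x)
      = ∑ i, ∑ j, ∑ l, (c i j k l : ℂ) * ∫ x, pd (pd (u i) j) l x * φ x := by
    rw [integral_finsetSum _ fun i _ => integrable_finsetSum _ fun j _ =>
      integrable_finsetSum _ fun l _ => hI i j l]
    refine Finset.sum_congr rfl fun i _ => ?_
    rw [integral_finsetSum _ fun j _ => integrable_finsetSum _ fun l _ => hI i j l]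
    refine Finset.sum_congr rfl fun j _ => ?_
    rw [integral_finsetSum _ fun l _ => hI i j l]
    exact Finset.sum_congr rfl fun l _ => integral_const_mul _ _
  have hpt : ∀ x, ∑ i, ∑ j, ∑ l, (c i j k l : ℂ) * (pd (pd (u i) j) l x * φ x)
      = - ((omega : ℂ) ^ 2 * (u k x * φ x)) := by
    intro x
    by_cases hx : x ∈ tsupport φ
    · have h := heq x (hs hx)
      have h' : (∑ i, ∑ j, ∑ l, (c i j k l : ℂ) * pd (pd (u i) j) l x) * φ x
          = - ((omega : ℂ) ^ 2 * (u k x * φ x)) := by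
        linear_combination φ x * h
      rw [← h']
      simp only [Finset.sum_mul, mul_assoc]
    · simp [image_eq_zero_of_notMem_tsupport hx]
  simp only [hibp, mul_neg, Finset.sum_neg_distrib]
  rw [← hsum, integral_congr_ae (Eventually.of_forall hpt), integral_neg, neg_neg,
    integral_const_mul]

/-! ### The local energy identity -/

lemma tendsto_integral_mul_of_L2 {ν : Measure R3} {g F : R3 → ℂ} {Fn : ℕ → R3 → ℂ}
    (hg : MemLp g 2 ν) (hFn : ∀ n, MemLp (Fn n) 2 ν) (hF : AEStronglyMeasurable F ν)
    (h : Tendsto (fun n => eLpNorm (fun x => Fn n x - F x) 2 ν) atTop (𝓝 0)) :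
    Tendsto (fun n => ∫ x, g x * Fn n x ∂ν) atTop (𝓝 (∫ x, g x * F x ∂ν)) := by
  refine tendsto_integral_of_L1' _ (hg.1.mul hF)
    (Eventually.of_forall fun n => hg.integrable_mul (hFn n)) ?_
  have hle : ∀ n, eLpNorm ((fun x => g x * Fn n x) - fun x => g x * F x) 1 ν
      ≤ eLpNorm g 2 ν * eLpNorm (fun x => Fn n x - F x) 2 ν := by
    intro n
    have := eLpNorm_smul_le_mul_eLpNorm (p := 2) (q := 2) (r := 1) ((hFn n).1.sub hF) hg.1
    refine le_trans (le_of_eq ?_) this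
    congr 1
    ext x
    simp [mul_sub]
  have h0 : Tendsto (fun n => eLpNorm g 2 ν * eLpNorm (fun x => Fn n x - F x) 2 ν) atTop (𝓝 0) := by
    simpa using ENNReal.Tendsto.const_mul h (Or.inr hg.2.ne)
  exact tendsto_of_tendsto_of_tendsto_of_le_of_le tendsto_const_nhds h0 (fun _ => zero_le) hle

/-- Square integrability on the bounded parts of `W`. -/
def LocL2 (W : Set R3) (f : R3 → ℂ) : Prop :=
  ∀ R : ℝ, MemLp f 2 (volume.restrict (W ∩ Metric.ball 0 R))

lemma exists_tsupport_subset_ball {F : Type*} [Zero F] {χ : R3 → F} (hχ : HasCompactSupport χ) :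
    ∃ R : ℝ, 0 < R ∧ tsupport χ ⊆ Metric.ball 0 R := by
  obtain ⟨R, hR⟩ := hχ.isCompact.isBounded.subset_ball (0 : R3)
  exact ⟨max R 1, by positivity, hR.trans (Metric.ball_subset_ball (le_max_left _ _))⟩

lemma LocL2.memLp_mul {W : Set R3} {f : R3 → ℂ} (hf : LocL2 W f) {χ : R3 → ℂ}
    (hχ : Continuous χ) (hc : HasCompactSupport χ) :
    MemLp (fun x => χ x * f x) 2 (volume.restrict W) := by
  obtain ⟨R, -, hR⟩ := exists_tsupport_subset_ball hc
  obtain ⟨C, hC⟩ := hχ.bounded_above_of_compact_support hc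
  have h1 : MemLp (fun x => χ x * f x) 2 (volume.restrict (W ∩ Metric.ball 0 R)) :=
    (hf R).of_le_mul (hχ.aestronglyMeasurable.mul (hf R).1) (c := C)
      (Eventually.of_forall fun x => by
        rw [norm_mul]; exact mul_le_mul_of_nonneg_right (hC x) (norm_nonneg _))
  have h2 : (Metric.ball (0 : R3) R).indicator (fun x => χ x * f x) = fun x => χ x * f x := by
    refine Set.indicator_eq_self.2 fun x hx => hR (subset_tsupport _ ?_)
    exact left_ne_zero_of_mul hx
  rw [← h2, memLp_indicator_iff_restrict Metric.isOpen_ball.measurableSet,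
    Measure.restrict_restrict Metric.isOpen_ball.measurableSet, Set.inter_comm]
  exact h1

/-- A scalar function belongs to `H¹₀(W)`: it is a limit of test functions in `H¹(W)`. -/
def MemScalarH10 (W : Set R3) (f : R3 → ℂ) : Prop :=
  ∃ φ : ℕ → R3 → ℂ,
    (∀ n, ContDiff ℝ ∞ (φ n) ∧ HasCompactSupport (φ n) ∧ tsupport (φ n) ⊆ W) ∧
    Tendsto (fun n => eLpNorm (fun x => φ n x - f x) 2 (volume.restrict W)) atTop (𝓝 0) ∧
    ∀ j, Tendsto (fun n => eLpNorm (fun x => pd (φ n) j x - pd f j x) 2 (volume.restrict W))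
      atTop (𝓝 0)

/-- Solutions, given by their components, of the second order system
`∑ c_{ijkl} ∂_l ∂_j u_i + ω² u_k = 0` with constant coefficients in the open set `W`, of class `H¹`
on bounded parts of `W` and with vanishing Dirichlet data on `∂W`. -/
structure IsDirichletSolution (c : Fin 3 → Fin 3 → Fin 3 → Fin 3 → ℝ) (omega : ℝ) (W : Set R3)
    (u : Fin 3 → R3 → ℂ) : Prop where
  smooth : ∀ i, ContDiffOn ℝ ∞ (u i) W
  eq : ∀ k, ∀ x ∈ W, ∑ i, ∑ j, ∑ l, (c i j k l : ℂ) * pd (pd (u i) j) l x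
      + (omega : ℂ) ^ 2 * u k x = 0
  locL2 : ∀ i, LocL2 W (u i)
  locL2_pd : ∀ i j, LocL2 W (pd (u i) j)
  dirichlet : ∀ i, ∀ χ : R3 → ℝ, ContDiff ℝ ∞ χ → HasCompactSupport χ →
    MemScalarH10 W (fun x => (χ x : ℂ) * u i x)

lemma eLpNorm_conj_sub (ν : Measure R3) (f g : R3 → ℂ) :
    eLpNorm (fun x => conj (f x) - conj (g x)) 2 ν = eLpNorm (fun x => f x - g x) 2 ν := by
  refine eLpNorm_congr_norm_ae (Eventually.of_forall fun x => ?_)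
  rw [← map_sub, RCLike.norm_conj]

lemma exists_cutoff_eq_one_on_ball (R : ℝ) (hR : 0 < R) :
    ∃ χ : R3 → ℝ, ContDiff ℝ ∞ χ ∧ HasCompactSupport χ ∧ ∀ x ∈ Metric.ball (0 : R3) R, χ x = 1 := by
  let b : ContDiffBump (0 : R3) := ⟨R, R + 1, hR, by linarith⟩
  exact ⟨b, b.contDiff, b.hasCompactSupport, fun x hx =>
    b.one_of_mem_closedBall (Metric.ball_subset_closedBall hx)⟩

/-- The solution may be tested with `χ` times its own conjugate, although `χ` need not vanish near
`∂W`: this is where the Dirichlet condition enters. -/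
lemma IsDirichletSolution.energy_identity {c : Fin 3 → Fin 3 → Fin 3 → Fin 3 → ℝ} {omega : ℝ}
    {W : Set R3} (hW : IsOpen W) {u : Fin 3 → R3 → ℂ} (hu : IsDirichletSolution c omega W u)
    {χ : R3 → ℝ} (hχ : ContDiff ℝ ∞ χ) (hc : HasCompactSupport χ) (k : Fin 3) :
    ∑ i, ∑ j, ∑ l, (c i j k l : ℂ) *
        ((∫ x in W, (χ x : ℂ) * pd (u i) j x * conj (pd (u k) l x))
          + ∫ x in W, ((pd χ l x : ℝ) : ℂ) * pd (u i) j x * conj (u k x))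
      = (omega : ℂ) ^ 2 * ∫ x in W, (χ x : ℂ) * u k x * conj (u k x) := by
  obtain ⟨R, hR0, hR⟩ := exists_tsupport_subset_ball hc
  obtain ⟨χ₁, hχ₁, hc₁, hone⟩ := exists_cutoff_eq_one_on_ball R hR0
  obtain ⟨φ, hφ, hφ0, hφ1⟩ := hu.dirichlet k χ₁ hχ₁ hc₁
  set f : R3 → ℂ := fun x => (χ₁ x : ℂ) * u k x with hf
  have hWm : MeasurableSet W := hW.measurableSet
  let X : R3 → ℂ := fun x => (χ x : ℂ)
  have hX : ContDiff ℝ ∞ X := Complex.ofRealCLM.contDiff.comp hχ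
  have hXc : HasCompactSupport X := hc.comp_left (g := fun t : ℝ => (t : ℂ)) (by simp)
  have hXpd : ∀ l x, pd X l x = ((pd χ l x : ℝ) : ℂ) := fun l x =>
    pd_ofReal (hχ.differentiable (by simp) x)
  have hdX : ∀ l, ContDiff ℝ ∞ (pd X l) := fun l => contDiff_pd hX (by simp) l
  have hdXc : ∀ l, HasCompactSupport (pd X l) := fun l => hasCompactSupport_pd hXc l
  -- on the support of `χ`, the function `χ₁ u` agrees with `u`, together with its derivatives
  have hball : ∀ x ∈ Metric.ball (0 : R3) R, f =ᶠ[𝓝 x] u k := by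
    intro x hx
    filter_upwards [Metric.isOpen_ball.mem_nhds hx] with y hy
    simp [hf, hone y hy]
  have hX0 : ∀ x, x ∉ Metric.ball (0 : R3) R → X x = 0 ∧ ∀ l, pd X l x = 0 := by
    intro x hx
    have hx' : x ∉ tsupport χ := fun h => hx (hR h)
    have h0 : χ =ᶠ[𝓝 x] 0 := notMem_tsupport_iff_eventuallyEq.1 hx'
    refine ⟨by simp [X, h0.eq_of_nhds], fun l => ?_⟩
    rw [hXpd, pd_congr h0]
    simp [pd]
  have hfs : ContDiffOn ℝ ∞ f W :=
    (Complex.ofRealCLM.contDiff.comp hχ₁).contDiffOn.mul (hu.smooth k)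
  have hfm : AEStronglyMeasurable (fun x => conj (f x)) (volume.restrict W) :=
    Complex.continuous_conj.comp_aestronglyMeasurable (hfs.continuousOn.aestronglyMeasurable hWm)
  have hfm' : ∀ l, AEStronglyMeasurable (fun x => conj (pd f l x)) (volume.restrict W) := fun l =>
    Complex.continuous_conj.comp_aestronglyMeasurable
      ((contDiffOn_pd (m := ∞) hW hfs (by simp) l).continuousOn.aestronglyMeasurable hWm)
  have hφm : ∀ n, MemLp (fun x => conj (φ n x)) 2 (volume.restrict W) := fun n =>
    (Complex.continuous_conj.comp (hφ n).1.continuous).memLp_of_hasCompactSupport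
      ((hφ n).2.1.comp_left (g := conj) (by simp))
  have hφm' : ∀ n l, MemLp (fun x => conj (pd (φ n) l x)) 2 (volume.restrict W) := fun n l =>
    (Complex.continuous_conj.comp
      (contDiff_pd (m := ∞) (hφ n).1 (by simp) l).continuous).memLp_of_hasCompactSupport
      ((hasCompactSupport_pd (hφ n).2.1 l).comp_left (g := conj) (by simp))
  have hT0 : Tendsto (fun n => eLpNorm (fun x => conj (φ n x) - conj (f x)) 2 (volume.restrict W))
      atTop (𝓝 0) := by
    simp_rw [eLpNorm_conj_sub]; exact hφ0
  have hT1 : ∀ l, Tendsto (fun n => eLpNorm (fun x => conj (pd (φ n) l x) - conj (pd f l x)) 2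
      (volume.restrict W)) atTop (𝓝 0) := by
    intro l
    simp_rw [eLpNorm_conj_sub]; exact hφ1 l
  -- admissible test functions, which converge to `χ` times the conjugate of `u k` in `H¹(W)`
  let ψ : ℕ → R3 → ℂ := fun n x => conj (φ n x) * X x
  have hψs : ∀ n, tsupport (ψ n) ⊆ W := fun n =>
    (closure_mono fun x hx => by
      have := left_ne_zero_of_mul hx
      simpa using this).trans (hφ n).2.2
  have hψ : ∀ n, ContDiff ℝ ∞ (ψ n) := fun n =>
    (Complex.conjCLE.contDiff.comp (hφ n).1).mul hX
  have hψpd : ∀ n l x, pd (ψ n) l x = X x * conj (pd (φ n) l x) + pd X l x * conj (φ n x) := by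
    intro n l x
    have h1 : DifferentiableAt ℝ (fun x => conj (φ n x)) x :=
      (Complex.conjCLE.contDiff.comp (hφ n).1).differentiable (by simp) x
    have := pd_mul (j := l) h1 (hX.differentiable (by simp) x)
    rw [show pd (ψ n) l x = _ from this, pd_conj]
    ring
  have hweak : ∀ n, ∑ i, ∑ j, ∑ l, (c i j k l : ℂ) *
      ((∫ x in W, (X x * pd (u i) j x) * conj (pd (φ n) l x))
        + ∫ x in W, (pd X l x * pd (u i) j x) * conj (φ n x))
      = (omega : ℂ) ^ 2 * ∫ x in W, (X x * u k x) * conj (φ n x) := by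
    intro n
    have h := weak_form hW hu.smooth (hu.eq k) ((hψ n).of_le (by simp)) (hXc.mul_left) (hψs n)
    have h0 : ∀ x ∉ W, ψ n x = 0 ∧ ∀ l, pd (ψ n) l x = 0 := by
      intro x hx
      have hx' : x ∉ tsupport (ψ n) := fun h => hx (hψs n h)
      exact ⟨image_eq_zero_of_notMem_tsupport hx', fun l =>
        image_eq_zero_of_notMem_tsupport fun h => hx' (tsupport_pd_subset _ l h)⟩
    rw [← setIntegral_eq_integral_of_forall_compl_eq_zero (s := W)
      (fun x hx => by rw [(h0 x hx).1, mul_zero])] at h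
    have h3 : ∀ i j l, ∫ x, pd (u i) j x * pd (ψ n) l x
        = (∫ x in W, (X x * pd (u i) j x) * conj (pd (φ n) l x))
        + ∫ x in W, (pd X l x * pd (u i) j x) * conj (φ n x) := by
      intro i j l
      rw [← setIntegral_eq_integral_of_forall_compl_eq_zero (s := W)
        (fun x hx => by rw [(h0 x hx).2, mul_zero]), ← integral_add]
      · refine integral_congr_ae (Eventually.of_forall fun x => ?_)
        simp only [hψpd]
        ring
      · exact ((hu.locL2_pd i j).memLp_mul hX.continuous hXc).integrable_mul (hφm' n l)
      · exact ((hu.locL2_pd i j).memLp_mul (hdX l).continuous (hdXc l)).integrable_mul (hφm n)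
    simp only [h3] at h
    rw [h]
    congr 1
    refine integral_congr_ae (Eventually.of_forall fun x => ?_)
    simp only [ψ]
    ring
  have hL : Tendsto (fun n => ∑ i, ∑ j, ∑ l, (c i j k l : ℂ) *
      ((∫ x in W, (X x * pd (u i) j x) * conj (pd (φ n) l x))
        + ∫ x in W, (pd X l x * pd (u i) j x) * conj (φ n x))) atTop
      (𝓝 (∑ i, ∑ j, ∑ l, (c i j k l : ℂ) *
      ((∫ x in W, (X x * pd (u i) j x) * conj (pd f l x))
        + ∫ x in W, (pd X l x * pd (u i) j x) * conj (f x)))) := by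
    refine tendsto_finsetSum _ fun i _ => tendsto_finsetSum _ fun j _ =>
      tendsto_finsetSum _ fun l _ => Tendsto.const_mul _ (Tendsto.add ?_ ?_)
    · exact tendsto_integral_mul_of_L2 ((hu.locL2_pd i j).memLp_mul hX.continuous hXc)
        (fun n => hφm' n l) (hfm' l) (hT1 l)
    · exact tendsto_integral_mul_of_L2 ((hu.locL2_pd i j).memLp_mul (hdX l).continuous (hdXc l))
        hφm hfm hT0
  have hRt : Tendsto (fun n => (omega : ℂ) ^ 2 * ∫ x in W, (X x * u k x) * conj (φ n x)) atTop
      (𝓝 ((omega : ℂ) ^ 2 * ∫ x in W, (X x * u k x) * conj (f x))) :=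
    (tendsto_integral_mul_of_L2 ((hu.locL2 k).memLp_mul hX.continuous hXc) hφm hfm hT0).const_mul _
  have hfin := tendsto_nhds_unique hL (hRt.congr fun n => (hweak n).symm)
  have hcut : ∀ (g : R3 → ℂ) (l : Fin 3) (x : R3), X x * g x * conj (pd f l x)
      = X x * g x * conj (pd (u k) l x) := by
    intro g l x
    by_cases hx : x ∈ Metric.ball (0 : R3) R
    · rw [pd_congr (hball x hx)]
    · simp [(hX0 x hx).1]
  have hcut' : ∀ (g Y : R3 → ℂ), (∀ x ∉ Metric.ball (0 : R3) R, Y x = 0) → ∀ x : R3,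
      Y x * g x * conj (f x) = Y x * g x * conj (u k x) := by
    intro g Y hY x
    by_cases hx : x ∈ Metric.ball (0 : R3) R
    · rw [(hball x hx).eq_of_nhds]
    · simp [hY x hx]
  simp only [hcut, hcut' _ (pd X _) (fun x hx => (hX0 x hx).2 _),
    hcut' _ X (fun x hx => (hX0 x hx).1)] at hfin
  simp only [← hXpd]
  exact hfin

/-! ### Rescaling to a fixed shell -/

/-- The rescaled function `y ↦ R f(R y)`. Functions decaying like `1/|x|` stay bounded on a fixed
shell as `R → ∞`. -/
def scaled (f : R3 → ℂ) (R : ℝ) (y : R3) : ℂ := (R : ℂ) * f (R • y)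

lemma contDiffOn_scaled {n : WithTop ℕ∞} {f : R3 → ℂ} {W : Set R3} (hf : ContDiffOn ℝ n f W)
    (R : ℝ) : ContDiffOn ℝ n (scaled f R) ((fun y : R3 => R • y) ⁻¹' W) :=
  contDiffOn_const.mul (hf.comp (contDiff_const_smul R).contDiffOn fun _ h => h)

lemma pd_scaled {f : R3 → ℂ} {R : ℝ} {y : R3} (hf : DifferentiableAt ℝ f (R • y)) (j : Fin 3) :
    pd (scaled f R) j y = (R : ℂ) * scaled (pd f j) R y := by
  have h : DifferentiableAt ℝ (fun z : R3 => f (R • z)) y :=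
    hf.comp (f := fun z : R3 => R • z) y (by fun_prop)
  unfold scaled
  rw [pd_const_mul h, pd_comp_smul, Complex.real_smul]

lemma isOpen_smul_preimage {W : Set R3} (hW : IsOpen W) (R : ℝ) :
    IsOpen ((fun y : R3 => R • y) ⁻¹' W) :=
  hW.preimage (continuous_const_smul R)

lemma setIntegral_eq_mul_integral_of_comp_smul {W : Set R3} {F g : R3 → ℂ} {R : ℝ} (hR : 0 < R)
    {s : ℂ} (hF : ∀ x ∉ W, F x = 0) (h : ∀ y, F (R • y) = s * g y) :
    ∫ x in W, F x = (R : ℂ) ^ 3 * s * ∫ y, g y := by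
  rw [setIntegral_eq_integral_of_forall_compl_eq_zero hF]
  have h1 := Measure.integral_comp_smul (volume : Measure R3) F R
  simp only [h, finrank_euclideanSpace, Fintype.card_fin, integral_const_mul] at h1
  rw [abs_of_pos (by positivity), Complex.real_smul] at h1
  have hR' : (R : ℂ) ≠ 0 := by exact_mod_cast hR.ne'
  rw [mul_assoc, h1]
  push_cast
  field_simp

/-- The dilated cutoff `χ(x / R)`, its smoothness, support and derivatives. -/
lemma dilated_cutoff {χ : R3 → ℝ} (hχ : ContDiff ℝ ∞ χ) (hc : HasCompactSupport χ) {R : ℝ}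
    (hR : 0 < R) :
    ContDiff ℝ ∞ (fun x : R3 => χ (R⁻¹ • x)) ∧ HasCompactSupport (fun x : R3 => χ (R⁻¹ • x)) ∧
      (∀ l y, pd (fun x : R3 => χ (R⁻¹ • x)) l (R • y) = R⁻¹ * pd χ l y) ∧
      ∀ l x, pd (fun x : R3 => χ (R⁻¹ • x)) l x = R⁻¹ * pd χ l (R⁻¹ • x) := by
  refine ⟨hχ.comp (contDiff_const_smul _), hc.comp_smul (inv_ne_zero hR.ne'), fun l y => ?_,
    fun l x => ?_⟩
  · rw [pd_comp_smul, smul_smul, inv_mul_cancel₀ hR.ne', one_smul, smul_eq_mul]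
  · rw [pd_comp_smul, smul_eq_mul]

/-- The energy identity for the rescaled field, with a cutoff supported in the rescaled domain. The
gradients are those of the original field, so only the derivative of the cutoff brings in `R⁻¹`. -/
lemma IsDirichletSolution.scaled_energy_identity (hW : IsOpen W)
    (hu : IsDirichletSolution c omega W u) {R : ℝ} (hR : 0 < R)
    {χ : R3 → ℝ} (hχ : ContDiff ℝ ∞ χ) (hc : HasCompactSupport χ)
    (hs : tsupport χ ⊆ (fun y : R3 => R • y) ⁻¹' W) (k : Fin 3) :
    ∑ i, ∑ j, ∑ l, (c i j k l : ℂ) *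
        ((∫ y, (χ y : ℂ) * scaled (pd (u i) j) R y * conj (scaled (pd (u k) l) R y))
          + (R : ℂ)⁻¹ * ∫ y, ((pd χ l y : ℝ) : ℂ) * scaled (pd (u i) j) R y
            * conj (scaled (u k) R y))
      = (omega : ℂ) ^ 2 * ∫ y, (χ y : ℂ) * scaled (u k) R y * conj (scaled (u k) R y) := by
  obtain ⟨h1, h2, h3, h4⟩ := dilated_cutoff hχ hc hR
  have hR' : (R : ℂ) ≠ 0 := by exact_mod_cast hR.ne'
  have h0 : ∀ x ∉ W, χ (R⁻¹ • x) = 0 ∧ ∀ l, pd χ l (R⁻¹ • x) = 0 := by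
    intro x hx
    have hx' : R⁻¹ • x ∉ tsupport χ := fun h => hx (by
      have := hs h
      simpa [smul_smul, hR.ne'] using this)
    exact ⟨image_eq_zero_of_notMem_tsupport hx', fun l =>
      image_eq_zero_of_notMem_tsupport fun h => hx' (tsupport_pd_subset _ l h)⟩
  have h := hu.energy_identity hW h1 h2 k
  have e1 : ∀ i j l, ∫ x in W, ((χ (R⁻¹ • x) : ℝ) : ℂ) * pd (u i) j x * conj (pd (u k) l x)
      = (R : ℂ) ^ 3 * ((R : ℂ)⁻¹ ^ 2) * ∫ y, (χ y : ℂ) * scaled (pd (u i) j) R y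
        * conj (scaled (pd (u k) l) R y) := fun i j l =>
    setIntegral_eq_mul_integral_of_comp_smul hR (fun x hx => by simp [(h0 x hx).1]) (fun y => by
      simp only [smul_smul, inv_mul_cancel₀ hR.ne', one_smul, scaled, map_mul, Complex.conj_ofReal]
      field_simp)
  have e2 : ∀ i j l, ∫ x in W, ((pd (fun x : R3 => χ (R⁻¹ • x)) l x : ℝ) : ℂ) * pd (u i) j x
        * conj (u k x)
      = (R : ℂ) ^ 3 * ((R : ℂ)⁻¹ ^ 3) * ∫ y, ((pd χ l y : ℝ) : ℂ) * scaled (pd (u i) j) R y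
        * conj (scaled (u k) R y) := fun i j l =>
    setIntegral_eq_mul_integral_of_comp_smul hR (fun x hx => by simp [h4, (h0 x hx).2])
      (fun y => by
        simp only [h3, scaled, map_mul, Complex.conj_ofReal, Complex.ofReal_mul, Complex.ofReal_inv]
        field_simp)
  have e3 : ∫ x in W, ((χ (R⁻¹ • x) : ℝ) : ℂ) * u k x * conj (u k x)
      = (R : ℂ) ^ 3 * ((R : ℂ)⁻¹ ^ 2) * ∫ y, (χ y : ℂ) * scaled (u k) R y
        * conj (scaled (u k) R y) :=
    setIntegral_eq_mul_integral_of_comp_smul hR (fun x hx => by simp [(h0 x hx).1]) (fun y => by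
      simp only [smul_smul, inv_mul_cancel₀ hR.ne', one_smul, scaled, map_mul, Complex.conj_ofReal]
      field_simp)
  simp only [e1, e2, e3] at h
  have h' := congrArg (fun z : ℂ => (R : ℂ)⁻¹ * z) h
  simp only [Finset.mul_sum] at h'
  calc _ = _ := Finset.sum_congr rfl fun i _ => Finset.sum_congr rfl fun j _ =>
          Finset.sum_congr rfl fun l _ => by field_simp
    _ = _ := h'
    _ = _ := by field_simp

lemma sum_swap_pairs (F : Fin 3 → Fin 3 → Fin 3 → Fin 3 → ℂ) :
    ∑ k, ∑ i, ∑ j, ∑ l, F k l i j = ∑ k, ∑ i, ∑ j, ∑ l, F i j k l := by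
  rw [Finset.sum_comm]
  exact Finset.sum_congr rfl fun _ _ => Finset.sum_congr rfl fun _ _ => Finset.sum_comm

/-- Conservation of energy: the flux through a shell, smeared by the gradient of a cutoff `χ` that
is constant near `∂W`, is real. -/
lemma IsDirichletSolution.scaled_flux_eq_zero (hW : IsOpen W)
    (hsym : ∀ i j k l, c i j k l = c k l i j)
    (hu : IsDirichletSolution c omega W u) {R : ℝ} (hR : 0 < R)
    {χ : R3 → ℝ} (hχ : ContDiff ℝ ∞ χ) (hc : HasCompactSupport χ)
    (hs : ∀ y l, pd χ l y ≠ 0 → R • y ∈ W) :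
    (∑ k, ∑ i, ∑ j, ∑ l, (c i j k l : ℂ) *
        ∫ y, ((pd χ l y : ℝ) : ℂ) * scaled (pd (u i) j) R y * conj (scaled (u k) R y)).im = 0 := by
  obtain ⟨h1, h2, h3, h4⟩ := dilated_cutoff hχ hc hR
  have hR' : (R : ℂ) ≠ 0 := by exact_mod_cast hR.ne'
  have h0 : ∀ x ∉ W, ∀ l, pd χ l (R⁻¹ • x) = 0 := by
    intro x hx l
    by_contra hne
    exact hx (by simpa [smul_smul, hR.ne'] using hs _ l hne)
  have h := fun k => hu.energy_identity hW h1 h2 k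
  have e2 : ∀ i j k l, ∫ x in W, ((pd (fun x : R3 => χ (R⁻¹ • x)) l x : ℝ) : ℂ) * pd (u i) j x
        * conj (u k x)
      = ∫ y, ((pd χ l y : ℝ) : ℂ) * scaled (pd (u i) j) R y
        * conj (scaled (u k) R y) := fun i j k l => by
    have := setIntegral_eq_mul_integral_of_comp_smul (W := W) (R := R) (s := ((R : ℂ)⁻¹ ^ 3))
      (F := fun x => ((pd (fun x : R3 => χ (R⁻¹ • x)) l x : ℝ) : ℂ) * pd (u i) j x * conj (u k x))
      (g := fun y => ((pd χ l y : ℝ) : ℂ) * scaled (pd (u i) j) R y * conj (scaled (u k) R y)) hR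
      (fun x hx => by simp [h4, h0 x hx]) (fun y => by
        simp only [h3, scaled, map_mul, Complex.conj_ofReal, Complex.ofReal_mul, Complex.ofReal_inv]
        field_simp)
    rw [this, ← mul_pow, mul_inv_cancel₀ hR', one_pow, one_mul]
  simp only [e2, mul_add, Finset.sum_add_distrib] at h
  have hsum := Finset.sum_congr (rfl : (Finset.univ : Finset (Fin 3)) = _) fun k _ => h k
  rw [Finset.sum_add_distrib] at hsum
  -- the quadratic part is real by the symmetry of the coefficients
  have hreal : (∑ k, ∑ i, ∑ j, ∑ l, (c i j k l : ℂ) *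
      ∫ x in W, ((χ (R⁻¹ • x) : ℝ) : ℂ) * pd (u i) j x * conj (pd (u k) l x)).im = 0 := by
    rw [← Complex.conj_eq_iff_im]
    conv_rhs => rw [← sum_swap_pairs (fun i j k l => (c i j k l : ℂ) *
      ∫ x in W, ((χ (R⁻¹ • x) : ℝ) : ℂ) * pd (u i) j x * conj (pd (u k) l x))]
    simp only [map_sum, map_mul, Complex.conj_ofReal, ← integral_conj, Complex.conj_conj]
    refine Finset.sum_congr rfl fun k _ => Finset.sum_congr rfl fun i _ =>
      Finset.sum_congr rfl fun j _ => Finset.sum_congr rfl fun l _ => ?_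
    rw [hsym i j k l]
    congr 2
    ext x
    ring
  have hreal' : (∑ k, (omega : ℂ) ^ 2 *
      ∫ x in W, ((χ (R⁻¹ • x) : ℝ) : ℂ) * u k x * conj (u k x)).im = 0 := by
    rw [← Complex.conj_eq_iff_im]
    simp only [map_sum, map_mul, map_pow, Complex.conj_ofReal, ← integral_conj, Complex.conj_conj]
    refine Finset.sum_congr rfl fun k _ => ?_
    congr 2
    ext x
    ring
  have := congrArg Complex.im hsum
  rw [Complex.add_im, hreal, hreal', zero_add] at this
  exact this

/-! ### Interior gradient bounds -/

/-- The field decays like `1/|x|` on the far region `|x| > R₀`, which lies in `W`. -/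
structure FarBound (W : Set R3) (u : Fin 3 → R3 → ℂ) (R₀ M : ℝ) : Prop where
  pos : 0 < R₀
  subset : ∀ x : R3, R₀ < ‖x‖ → x ∈ W
  bound : ∀ i, ∀ x : R3, R₀ < ‖x‖ → ‖u i x‖ ≤ M / ‖x‖

lemma FarBound.smul_mem {R₀ M δ : ℝ} (h : FarBound W u R₀ M) (hδ : 0 < δ) {R : ℝ} (hR : R₀ / δ < R)
    {y : R3} (hy : δ ≤ ‖y‖) : R₀ < ‖R • y‖ := by
  have hR0 : 0 < R := (div_pos h.pos hδ).trans hR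
  rw [norm_smul, Real.norm_of_nonneg hR0.le]
  calc R₀ = R₀ / δ * δ := by field_simp
    _ < R * δ := by gcongr
    _ ≤ R * ‖y‖ := by gcongr

lemma FarBound.norm_scaled_le {R₀ M δ : ℝ} (h : FarBound W u R₀ M) (hδ : 0 < δ) {R : ℝ}
    (hR : R₀ / δ < R) {y : R3} (hy : δ ≤ ‖y‖) (i : Fin 3) :
    ‖scaled (u i) R y‖ ≤ M / ‖y‖ := by
  have hR0 : 0 < R := (div_pos h.pos hδ).trans hR
  have h1 := h.bound i _ (h.smul_mem hδ hR hy)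
  have hy0 : 0 < ‖y‖ := hδ.trans_le hy
  rw [norm_smul, Real.norm_of_nonneg hR0.le] at h1
  rw [scaled, norm_mul, Complex.norm_real, Real.norm_of_nonneg hR0.le]
  calc R * ‖u i (R • y)‖ ≤ R * (M / (R * ‖y‖)) := by gcongr
    _ = M / ‖y‖ := by field_simp

/-- Coercivity of the quadratic form `∑ c_{ijkl} P_{ij} conj P_{kl}` on all matrices. -/
def Coercive (c : Fin 3 → Fin 3 → Fin 3 → Fin 3 → ℝ) (m : ℝ) : Prop :=
  ∀ P : Fin 3 → Fin 3 → ℂ, m * ∑ i, ∑ j, ‖P i j‖ ^ 2 ≤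
    (∑ k, ∑ i, ∑ j, ∑ l, (c i j k l : ℂ) * (P i j * conj (P k l))).re

/-- The pointwise inequality behind Caccioppoli's estimate: the cross terms are absorbed with
Young's inequality. -/
lemma Coercive.absorb {m : ℝ} (hm : 0 < m) (hc : Coercive c m) (P : Fin 3 → Fin 3 → ℂ)
    (v : Fin 3 → ℂ) (t : ℝ) (s : Fin 3 → ℝ) {h : ℝ} (h0 : 0 ≤ h) (h1 : h ≤ 1) :
    m / 2 * ∑ i, ∑ j, t ^ 2 * ‖P i j‖ ^ 2 ≤
      (∑ k, ∑ i, ∑ j, ∑ l, (c i j k l : ℂ) * (((t ^ 2 : ℝ) : ℂ) * P i j * conj (P k l)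
        + (h : ℂ) * (((2 * t * s l : ℝ) : ℂ) * P i j * conj (v k)))).re
      + ∑ k, ∑ i, ∑ j, ∑ l, (18 / m) * c i j k l ^ 2 * s l ^ 2 * ‖v k‖ ^ 2 := by
  have hA := hc (fun i j => (t : ℂ) * P i j)
  have hA' : (∑ k, ∑ i, ∑ j, ∑ l, (c i j k l : ℂ) * ((t : ℂ) * P i j * conj ((t : ℂ) * P k l))).re
      = (∑ k, ∑ i, ∑ j, ∑ l, (c i j k l : ℂ) * (((t ^ 2 : ℝ) : ℂ) * P i j * conj (P k l))).re := by
    congr 1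
    refine Finset.sum_congr rfl fun k _ => Finset.sum_congr rfl fun i _ =>
      Finset.sum_congr rfl fun j _ => Finset.sum_congr rfl fun l _ => ?_
    simp only [map_mul, Complex.conj_ofReal]
    push_cast
    ring
  -- `m / 18` is half of `m / 9`, as each entry `P i j` occurs for nine pairs `(k, l)`
  have hB : ∀ k i j l, -(m / 18 * (t ^ 2 * ‖P i j‖ ^ 2)) ≤
      ((c i j k l : ℂ) * ((h : ℂ) * (((2 * t * s l : ℝ) : ℂ) * P i j * conj (v k)))).re
      + (18 / m) * c i j k l ^ 2 * s l ^ 2 * ‖v k‖ ^ 2 := by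
    intro k i j l
    have h2 := (abs_le.1 (Complex.abs_re_le_norm
      ((c i j k l : ℂ) * ((h : ℂ) * (((2 * t * s l : ℝ) : ℂ) * P i j * conj (v k)))))).1
    simp only [norm_mul, RCLike.norm_conj, Complex.norm_real, Real.norm_eq_abs, abs_of_nonneg h0,
      abs_two] at h2
    have h3 : |c i j k l| * (h * (2 * |t| * |s l| * ‖P i j‖ * ‖v k‖))
        ≤ |c i j k l| * (1 * (2 * |t| * |s l| * ‖P i j‖ * ‖v k‖)) := by gcongr
    have h4 : |c i j k l| * (1 * (2 * |t| * |s l| * ‖P i j‖ * ‖v k‖)) ≤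
        m / 18 * (t ^ 2 * ‖P i j‖ ^ 2) + (18 / m) * c i j k l ^ 2 * s l ^ 2 * ‖v k‖ ^ 2 := by
      have := two_mul_le_add_sq (|t| * ‖P i j‖ * m) (18 * (|c i j k l| * |s l| * ‖v k‖))
      rw [← sub_nonneg]
      have e : m / 18 * (t ^ 2 * ‖P i j‖ ^ 2) + (18 / m) * c i j k l ^ 2 * s l ^ 2 * ‖v k‖ ^ 2
          - |c i j k l| * (1 * (2 * |t| * |s l| * ‖P i j‖ * ‖v k‖))
          = (1 / (18 * m)) * ((|t| * ‖P i j‖ * m) ^ 2 + (18 * (|c i j k l| * |s l| * ‖v k‖)) ^ 2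
            - 2 * (|t| * ‖P i j‖ * m) * (18 * (|c i j k l| * |s l| * ‖v k‖))) := by
        rw [← sq_abs t, ← sq_abs (c i j k l), ← sq_abs (s l)]
        field_simp
      rw [e]
      exact mul_nonneg (by positivity) (by linarith)
    linarith
  have hB' := Finset.sum_le_sum fun k (_ : k ∈ Finset.univ) => Finset.sum_le_sum
    fun i (_ : i ∈ Finset.univ) => Finset.sum_le_sum fun j (_ : j ∈ Finset.univ) =>
    Finset.sum_le_sum fun l (_ : l ∈ Finset.univ) => hB k i j l
  have hN : ∑ i, ∑ j, ‖(t : ℂ) * P i j‖ ^ 2 = ∑ i, ∑ j, t ^ 2 * ‖P i j‖ ^ 2 := by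
    simp [mul_pow]
  have hC : ∑ k : Fin 3, ∑ i, ∑ j, ∑ l : Fin 3, -(m / 18 * (t ^ 2 * ‖P i j‖ ^ 2))
      = -(m / 2 * ∑ i, ∑ j, t ^ 2 * ‖P i j‖ ^ 2) := by
    simp only [Finset.sum_const, Finset.card_univ, Fintype.card_fin, Finset.mul_sum,
      nsmul_eq_mul, ← Finset.sum_neg_distrib]
    refine Finset.sum_congr rfl fun i _ => Finset.sum_congr rfl fun j _ => ?_
    push_cast; ring
  rw [hA', hN] at hA
  rw [hC] at hB'
  simp only [mul_add, Finset.sum_add_distrib, Complex.add_re, Complex.re_sum] at hA hB' ⊢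
  linarith

lemma integrable_cutoff_mul_conj {U : Set R3} (hU : IsOpen U) {ζ : R3 → ℝ} (hζ : Continuous ζ)
    (hc : HasCompactSupport ζ) (hs : tsupport ζ ⊆ U) {f g : R3 → ℂ} (hf : ContinuousOn f U)
    (hg : ContinuousOn g U) : Integrable (fun y => (ζ y : ℂ) * f y * conj (g y)) := by
  have h := integrable_mul_of_tsupport hU (hf.mul (Complex.continuous_conj.comp_continuousOn hg))
    (g := fun y => (ζ y : ℂ)) (Complex.continuous_ofReal.comp hζ)
    ((closure_mono fun x hx => by simpa using hx).trans hs)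
    (hc.comp_left (g := fun t : ℝ => (t : ℂ)) (by simp))
  exact h.congr (Eventually.of_forall fun y => by simp only [Pi.mul_apply, Function.comp]; ring)

lemma re_ofReal_mul_conj (t : ℝ) (z : ℂ) : ((t : ℂ) * z * conj z).re = t * ‖z‖ ^ 2 := by
  rw [mul_assoc, Complex.mul_conj, Complex.normSq_eq_norm_sq, ← Complex.ofReal_mul,
    Complex.ofReal_re]

lemma integrable_cutoff_mul_norm_sq {U : Set R3} (hU : IsOpen U) {ζ : R3 → ℝ} (hζ : Continuous ζ)
    (hc : HasCompactSupport ζ) (hs : tsupport ζ ⊆ U) {f : R3 → ℂ} (hf : ContinuousOn f U) :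
    Integrable (fun y => ζ y * ‖f y‖ ^ 2) :=
  (integrable_cutoff_mul_conj hU hζ hc hs hf hf).re.congr
    (Eventually.of_forall fun _ => re_ofReal_mul_conj _ _)

lemma tsupport_sq_subset (η : R3 → ℝ) : tsupport (fun y => η y ^ 2) ⊆ tsupport η :=
  closure_mono fun x hx h0 => hx (by simp [h0])

lemma hasCompactSupport_sq {η : R3 → ℝ} (hη : HasCompactSupport η) :
    HasCompactSupport (fun y => η y ^ 2) :=
  hη.of_isClosed_subset (isClosed_tsupport _) (tsupport_sq_subset η)

/-- Caccioppoli's estimate on a shell: as the decay of the field is like `1/|x|`, the rescaled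
gradients are bounded in `L²` of a fixed shell, uniformly in the scale. -/
lemma IsDirichletSolution.caccioppoli (hW : IsOpen W) {m : ℝ} (hm : 0 < m) (hco : Coercive c m)
    (hu : IsDirichletSolution c omega W u) {R₀ M : ℝ} (hfar : FarBound W u R₀ M)
    {η : R3 → ℝ} (hη : ContDiff ℝ ∞ η) (hηc : HasCompactSupport η) {δ : ℝ} (hδ : 0 < δ)
    (hηs : ∀ y ∈ tsupport η, δ ≤ ‖y‖) :
    ∃ C : ℝ, ∀ᶠ R : ℝ in atTop,
      ∫ y, ∑ i, ∑ j, η y ^ 2 * ‖scaled (pd (u i) j) R y‖ ^ 2 ≤ C := by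
  let B : R3 → ℝ := fun y => ∑ k : Fin 3, omega ^ 2 * (η y ^ 2 * (M / δ) ^ 2)
    + ∑ k, ∑ i, ∑ j, ∑ l, (18 / m) * c i j k l ^ 2 * pd η l y ^ 2 * (M / δ) ^ 2
  refine ⟨2 / m * ∫ y, B y, ?_⟩
  filter_upwards [eventually_gt_atTop (R₀ / δ), eventually_ge_atTop 1] with R hR hR1
  have hR0 : 0 < R := by linarith
  set U : Set R3 := (fun y : R3 => R • y) ⁻¹' W with hUdef
  have hU : IsOpen U := isOpen_smul_preimage hW R
  have hηU : tsupport η ⊆ U := fun y hy => hfar.subset _ (hfar.smul_mem hδ hR (hηs y hy))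
  let χ : R3 → ℝ := fun y => η y ^ 2
  have hχ : ContDiff ℝ ∞ χ := hη.pow 2
  have hχs : tsupport χ ⊆ tsupport η := tsupport_sq_subset η
  have hχc : HasCompactSupport χ := hasCompactSupport_sq hηc
  have hχpd : ∀ l y, pd χ l y = 2 * η y * pd η l y := by
    intro l y
    simp only [pd, χ]
    rw [fderiv_fun_pow 2 (hη.differentiable (by simp) y)]
    simp
  have hv : ∀ k, ContinuousOn (scaled (u k) R) U := fun k =>
    (contDiffOn_scaled (hu.smooth k) R).continuousOn
  have hp : ∀ i j, ContinuousOn (scaled (pd (u i) j) R) U := fun i j =>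
    (contDiffOn_scaled (contDiffOn_pd (m := ∞) hW (hu.smooth i) (by simp) j) R).continuousOn
  have hdχ : ∀ l, Continuous (pd χ l) := fun l => (contDiff_pd (m := ∞) hχ (by simp) l).continuous
  have hdη : ∀ l, Continuous (pd η l) := fun l => (contDiff_pd (m := ∞) hη (by simp) l).continuous
  have I1 : ∀ i j k l, Integrable (fun y => (χ y : ℂ) * scaled (pd (u i) j) R y
      * conj (scaled (pd (u k) l) R y)) := fun i j k l =>
    integrable_cutoff_mul_conj hU hχ.continuous hχc (hχs.trans hηU) (hp i j) (hp k l)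
  have I2 : ∀ i j k l, Integrable (fun y => ((pd χ l y : ℝ) : ℂ) * scaled (pd (u i) j) R y
      * conj (scaled (u k) R y)) := fun i j k l =>
    integrable_cutoff_mul_conj hU (hdχ l) (hasCompactSupport_pd hχc l)
      ((tsupport_pd_subset χ l).trans (hχs.trans hηU)) (hp i j) (hv k)
  have I3 : ∀ k, Integrable (fun y => (χ y : ℂ) * scaled (u k) R y * conj (scaled (u k) R y)) :=
    fun k => integrable_cutoff_mul_conj hU hχ.continuous hχc (hχs.trans hηU) (hv k) (hv k)
  have I4 : ∀ l k, Integrable (fun y => pd η l y ^ 2 * ‖scaled (u k) R y‖ ^ 2) := fun l k =>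
    integrable_cutoff_mul_norm_sq (ζ := fun y => pd η l y ^ 2) hU ((hdη l).pow 2)
      (hasCompactSupport_sq (hasCompactSupport_pd hηc l))
      ((tsupport_sq_subset _).trans ((tsupport_pd_subset η l).trans hηU)) (hv k)
  let T : Fin 3 → Fin 3 → Fin 3 → Fin 3 → R3 → ℂ := fun k i j l y => (c i j k l : ℂ) *
    ((χ y : ℂ) * scaled (pd (u i) j) R y * conj (scaled (pd (u k) l) R y)
      + (R : ℂ)⁻¹ * (((pd χ l y : ℝ) : ℂ) * scaled (pd (u i) j) R y * conj (scaled (u k) R y)))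
  have IT : ∀ k i j l, Integrable (T k i j l) := fun k i j l =>
    ((I1 i j k l).add ((I2 i j k l).const_mul _)).const_mul _
  let V : R3 → ℂ := fun y => ∑ k, (omega : ℂ) ^ 2 *
    ((χ y : ℂ) * scaled (u k) R y * conj (scaled (u k) R y))
  have IV : Integrable V := integrable_finsetSum _ fun k _ => (I3 k).const_mul _
  have ITs : Integrable (fun y => ∑ k, ∑ i, ∑ j, ∑ l, T k i j l y) :=
    integrable_finsetSum _ fun k _ => integrable_finsetSum _ fun i _ =>
      integrable_finsetSum _ fun j _ => integrable_finsetSum _ fun l _ => IT k i j l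
  have hTV : ∫ y, ∑ k, ∑ i, ∑ j, ∑ l, T k i j l y = ∫ y, V y := by
    have hid := fun k => hu.scaled_energy_identity hW hR0 hχ hχc (hχs.trans hηU) k
    rw [integral_finsetSum _ fun k _ => (I3 k).const_mul _,
      integral_finsetSum _ fun k _ => integrable_finsetSum _ fun i _ =>
      integrable_finsetSum _ fun j _ => integrable_finsetSum _ fun l _ => IT k i j l]
    refine Finset.sum_congr rfl fun k _ => ?_
    rw [integral_const_mul, ← hid k, integral_finsetSum _ fun i _ =>
      integrable_finsetSum _ fun j _ => integrable_finsetSum _ fun l _ => IT k i j l]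
    refine Finset.sum_congr rfl fun i _ => ?_
    rw [integral_finsetSum _ fun j _ => integrable_finsetSum _ fun l _ => IT k i j l]
    refine Finset.sum_congr rfl fun j _ => ?_
    rw [integral_finsetSum _ fun l _ => IT k i j l]
    refine Finset.sum_congr rfl fun l _ => ?_
    rw [integral_const_mul, integral_add (I1 i j k l) ((I2 i j k l).const_mul _),
      integral_const_mul]
  let Y : R3 → ℝ := fun y => ∑ k, ∑ i, ∑ j, ∑ l,
    (18 / m) * c i j k l ^ 2 * pd η l y ^ 2 * ‖scaled (u k) R y‖ ^ 2
  have IY : Integrable Y :=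
    integrable_finsetSum _ fun k _ => integrable_finsetSum _ fun i _ =>
      integrable_finsetSum _ fun j _ => integrable_finsetSum _ fun l _ =>
        ((I4 l k).const_mul ((18 / m) * c i j k l ^ 2)).congr
          (Eventually.of_forall fun y => by simp only; ring)
  have IB : Integrable B := by
    have hBc : Continuous B := by
      have := hη.continuous
      have := hdη
      simp only [B]
      fun_prop
    refine hBc.integrable_of_hasCompactSupport (hηc.mono' fun y hy => ?_)
    by_contra h0
    refine hy ?_
    have h1 : ∀ l, pd η l y = 0 := fun l =>
      image_eq_zero_of_notMem_tsupport fun h => h0 (tsupport_pd_subset _ l h)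
    simp [B, h1, image_eq_zero_of_notMem_tsupport h0]
  have hle : ∀ y, m / 2 * ∑ i, ∑ j, η y ^ 2 * ‖scaled (pd (u i) j) R y‖ ^ 2
      ≤ (∑ k, ∑ i, ∑ j, ∑ l, T k i j l y).re + Y y := by
    intro y
    have := hco.absorb hm (fun i j => scaled (pd (u i) j) R y) (fun k => scaled (u k) R y) (η y)
      (fun l => pd η l y) (h := R⁻¹) (by positivity) (inv_le_one_of_one_le₀ hR1)
    simp only [T, Y, hχpd, χ]
    simpa only [Complex.ofReal_inv] using this
  -- by the decay of the field, the remaining terms are bounded independently of `R`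
  have hle2 : ∀ y, (V y).re + Y y ≤ B y := by
    intro y
    have hvb : ∀ k, ∀ t : ℝ, 0 ≤ t → (y ∉ tsupport η → t = 0) →
        t * ‖scaled (u k) R y‖ ^ 2 ≤ t * (M / δ) ^ 2 := by
      intro k t ht h0
      by_cases hy : y ∈ tsupport η
      · have hyδ := hηs y hy
        have h1 := hfar.norm_scaled_le hδ hR hyδ k
        have hM : 0 ≤ M := by
          have h2 := (norm_nonneg _).trans h1
          by_contra hneg
          exact absurd h2 (not_le.2 (div_neg_of_neg_of_pos (not_le.1 hneg) (hδ.trans_le hyδ)))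
        have h2 : M / ‖y‖ ≤ M / δ := by gcongr
        gcongr
        exact h1.trans h2
      · simp [h0 hy]
    simp only [V, Y, B, Complex.re_sum]
    refine add_le_add (Finset.sum_le_sum fun k _ => ?_) (Finset.sum_le_sum fun k _ =>
      Finset.sum_le_sum fun i _ => Finset.sum_le_sum fun j _ => Finset.sum_le_sum fun l _ => ?_)
    · rw [← Complex.ofReal_pow, Complex.re_ofReal_mul, re_ofReal_mul_conj]
      exact mul_le_mul_of_nonneg_left (hvb k _ (by positivity) fun h => by
        simp [χ, image_eq_zero_of_notMem_tsupport h]) (by positivity)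
    · exact hvb k _ (by positivity) fun h => by
        simp [image_eq_zero_of_notMem_tsupport fun h' => h (tsupport_pd_subset _ l h')]
  have I5 : Integrable (fun y => ∑ i, ∑ j, η y ^ 2 * ‖scaled (pd (u i) j) R y‖ ^ 2) :=
    integrable_finsetSum _ fun i _ => integrable_finsetSum _ fun j _ =>
      integrable_cutoff_mul_norm_sq hU hχ.continuous hχc (hχs.trans hηU) (hp i j)
  have key : m / 2 * ∫ y, ∑ i, ∑ j, η y ^ 2 * ‖scaled (pd (u i) j) R y‖ ^ 2 ≤ ∫ y, B y := by
    rw [← integral_const_mul]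
    have ITr : Integrable (fun y => (∑ k, ∑ i, ∑ j, ∑ l, T k i j l y).re) := ITs.re
    have IVr : Integrable (fun y => (V y).re) := IV.re
    calc _ ≤ ∫ y, ((∑ k, ∑ i, ∑ j, ∑ l, T k i j l y).re + Y y) :=
          integral_mono (I5.const_mul _) (ITr.add IY) hle
      _ = (∫ y, (V y).re) + ∫ y, Y y := by
          rw [integral_add ITr IY]
          congr 1
          have h1 := integral_re ITs
          have h2 := integral_re IV
          simp only [RCLike.re_eq_complex_re] at h1 h2
          rw [h1, h2, hTV]
      _ = ∫ y, ((V y).re + Y y) := (integral_add IVr IY).symm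
      _ ≤ ∫ y, B y := integral_mono (IVr.add IY) IB hle2
  calc _ = 2 / m * (m / 2 * ∫ y, ∑ i, ∑ j, η y ^ 2 * ‖scaled (pd (u i) j) R y‖ ^ 2) := by
        field_simp
    _ ≤ _ := by gcongr

/-- The rescaled gradients are bounded in `L¹` against a fixed weight supported in a shell. -/
lemma IsDirichletSolution.gradient_bound (hW : IsOpen W) {m : ℝ} (hm : 0 < m)
    (hco : Coercive c m) (hu : IsDirichletSolution c omega W u) {R₀ M : ℝ}
    (hfar : FarBound W u R₀ M) {η : R3 → ℝ} (hη : ContDiff ℝ ∞ η) (hηc : HasCompactSupport η)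
    {δ : ℝ} (hδ : 0 < δ) (hηs : ∀ y ∈ tsupport η, δ ≤ ‖y‖) {ψ : R3 → ℝ} (hψ : Continuous ψ)
    (hψη : ∀ y ∈ tsupport ψ, η y = 1) :
    ∃ C : ℝ, 0 ≤ C ∧ ∀ᶠ R : ℝ in atTop, ∀ i j,
      ∫ y, |ψ y| * ‖scaled (pd (u i) j) R y‖ ≤ C := by
  obtain ⟨C, hC⟩ := hu.caccioppoli hW hm hco hfar hη hηc hδ hηs
  have hψsub : tsupport ψ ⊆ tsupport η := fun y hy => subset_tsupport _ (by simp [hψη y hy])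
  have hψc : HasCompactSupport ψ := hηc.of_isClosed_subset (isClosed_tsupport _) hψsub
  have haψ : Continuous fun y => |ψ y| := hψ.abs
  have haψs : tsupport (fun y => |ψ y|) ⊆ tsupport ψ := closure_mono fun x hx => by
    simpa using hx
  have haψc : HasCompactSupport fun y => |ψ y| := hψc.comp_left (g := fun t : ℝ => |t|) (by simp)
  obtain ⟨A, hA⟩ := hψ.bounded_above_of_compact_support hψc
  have hA0 : 0 ≤ A := (norm_nonneg _).trans (hA 0)
  refine ⟨|(∫ y, |ψ y|) / 2 + A / 2 * C|, abs_nonneg _, ?_⟩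
  filter_upwards [hC, eventually_gt_atTop (R₀ / δ)] with R hRC hR i j
  set U : Set R3 := (fun y : R3 => R • y) ⁻¹' W with hUdef
  have hU : IsOpen U := isOpen_smul_preimage hW R
  have hηU : tsupport η ⊆ U := fun y hy => hfar.subset _ (hfar.smul_mem hδ hR (hηs y hy))
  have hp : ∀ i j, ContinuousOn (scaled (pd (u i) j) R) U := fun i j =>
    (contDiffOn_scaled (contDiffOn_pd (m := ∞) hW (hu.smooth i) (by simp) j) R).continuousOn
  have I1 : Integrable (fun y => |ψ y| * ‖scaled (pd (u i) j) R y‖) := by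
    refine ((integrable_mul_of_tsupport hU (hp i j) (g := fun y => (ψ y : ℂ))
      (Complex.continuous_ofReal.comp hψ) ((closure_mono fun x hx => by simpa using hx).trans
      (hψsub.trans hηU)) (hψc.comp_left (g := fun t : ℝ => (t : ℂ)) (by simp))).norm).congr
      (Eventually.of_forall fun y => ?_)
    simp [mul_comm]
  have I2 : Integrable (fun y => ∑ i, ∑ j, η y ^ 2 * ‖scaled (pd (u i) j) R y‖ ^ 2) :=
    integrable_finsetSum _ fun i _ => integrable_finsetSum _ fun j _ =>
      integrable_cutoff_mul_norm_sq (ζ := fun y => η y ^ 2) hU (hη.continuous.pow 2)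
        (hasCompactSupport_sq hηc) ((tsupport_sq_subset _).trans hηU) (hp i j)
  have I3 : Integrable fun y => |ψ y| := haψ.integrable_of_hasCompactSupport haψc
  refine le_trans ?_ (le_abs_self _)
  calc _ ≤ ∫ y, (|ψ y| / 2 + A / 2 * ∑ i, ∑ j, η y ^ 2 * ‖scaled (pd (u i) j) R y‖ ^ 2) := by
        refine integral_mono I1 ((I3.div_const 2).add (I2.const_mul _)) fun y => ?_
        have hsum : 0 ≤ ∑ i, ∑ j, η y ^ 2 * ‖scaled (pd (u i) j) R y‖ ^ 2 := by positivity
        by_cases hy : y ∈ tsupport ψ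
        · have h1 : ‖scaled (pd (u i) j) R y‖ ^ 2
              ≤ ∑ i, ∑ j, η y ^ 2 * ‖scaled (pd (u i) j) R y‖ ^ 2 := by
            simp only [hψη y hy, one_pow, one_mul]
            refine le_trans ?_ (Finset.single_le_sum
              (f := fun i => ∑ j, ‖scaled (pd (u i) j) R y‖ ^ 2) (fun _ _ => by positivity)
              (Finset.mem_univ i))
            exact Finset.single_le_sum (f := fun j => ‖scaled (pd (u i) j) R y‖ ^ 2)
              (fun _ _ => by positivity) (Finset.mem_univ j)
          have h2 : |ψ y| ≤ A := hA y
          have h3 : ‖scaled (pd (u i) j) R y‖ ≤ 1 / 2 + ‖scaled (pd (u i) j) R y‖ ^ 2 / 2 := by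
            nlinarith [sq_nonneg (‖scaled (pd (u i) j) R y‖ - 1)]
          calc _ ≤ |ψ y| * (1 / 2 + ‖scaled (pd (u i) j) R y‖ ^ 2 / 2) := by gcongr
            _ = |ψ y| / 2 + |ψ y| / 2 * ‖scaled (pd (u i) j) R y‖ ^ 2 := by ring
            _ ≤ _ := by gcongr
        · simp only [image_eq_zero_of_notMem_tsupport hy, abs_zero, zero_mul, zero_div, zero_add]
          positivity
    _ = (∫ y, |ψ y|) / 2 + A / 2 * ∫ y, ∑ i, ∑ j, η y ^ 2 * ‖scaled (pd (u i) j) R y‖ ^ 2 := by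
        rw [integral_add (I3.div_const 2) (I2.const_mul _), integral_const_mul, integral_div]
    _ ≤ _ := by gcongr

section

variable {a b a' b' : R3 → ℂ}

/-! ### Radial waves and oscillatory integrals -/

lemma norm_phase (t : ℝ) : ‖phase t‖ = 1 := by
  rw [phase, mul_comm]; exact Complex.norm_exp_ofReal_mul_I t

lemma phase_add (s t : ℝ) : phase (s + t) = phase s * phase t := by
  rw [phase, phase, phase, ← Complex.exp_add]; push_cast; ring_nf

lemma conj_phase (t : ℝ) : conj (phase t) = phase (-t) := by
  rw [phase, phase, ← Complex.exp_conj]; simp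

lemma phase_mul_phase_neg (t : ℝ) : phase t * phase (-t) = 1 := by
  rw [← phase_add]; simp [phase]

lemma continuous_phase : Continuous phase := by unfold phase; fun_prop

lemma contDiff_phase {n : WithTop ℕ∞} : ContDiff ℝ n phase := by
  unfold phase
  exact (contDiff_const.mul Complex.ofRealCLM.contDiff).cexp

lemma hasDerivAt_phase (t : ℝ) : HasDerivAt phase (Complex.I * phase t) t := by
  have h1 : HasDerivAt (fun s : ℝ => Complex.I * (s : ℂ)) (Complex.I * 1) t :=
    (Complex.ofRealCLM.hasDerivAt (x := t)).const_mul _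
  have := h1.cexp
  rw [mul_one, mul_comm] at this
  exact this

lemma hasFDerivAt_norm {x : R3} (hx : x ≠ 0) :
    HasFDerivAt (fun y : R3 => ‖y‖) (‖x‖⁻¹ • innerSL ℝ x) x := by
  have h := (hasStrictFDerivAt_norm_sq x).hasFDerivAt.sqrt (by simpa using hx)
  have h2 : (fun y : R3 => √(‖y‖ ^ 2)) = fun y => ‖y‖ := by
    ext y; exact Real.sqrt_sq (norm_nonneg y)
  rw [h2] at h
  refine h.congr_fderiv ?_
  rw [Real.sqrt_sq (norm_nonneg x)]
  ext v
  simp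
  ring

lemma pd_phase_norm {x : R3} (hx : x ≠ 0) (s : ℝ) (j : Fin 3) :
    pd (fun y => phase (s * ‖y‖)) j x
      = Complex.I * s * ((x j / ‖x‖ : ℝ) : ℂ) * phase (s * ‖x‖) := by
  have h := (hasDerivAt_phase (s * ‖x‖)).hasFDerivAt.comp x ((hasFDerivAt_norm hx).const_mul s)
  have h2 : (phase ∘ fun y : R3 => s * ‖y‖) = fun y => phase (s * ‖y‖) := rfl
  rw [h2] at h
  rw [pd, h.fderiv]
  simp [inner_basisVec]
  ring

lemma contDiffOn_phase_norm {n : WithTop ℕ∞} (s : ℝ) :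
    ContDiffOn ℝ n (fun y : R3 => phase (s * ‖y‖)) {0}ᶜ :=
  contDiff_phase.comp_contDiffOn (contDiffOn_const.mul (contDiffOn_id.norm ℝ fun _ hx => hx))

lemma contDiffOn_dir {n : WithTop ℕ∞} (j : Fin 3) :
    ContDiffOn ℝ n (fun y : R3 => ((y j / ‖y‖ : ℝ) : ℂ)) {0}ᶜ := by
  refine Complex.ofRealCLM.contDiff.comp_contDiffOn (ContDiffOn.div ?_
    (contDiffOn_id.norm ℝ fun _ hx => hx) fun x hx => by simpa using hx)
  exact (EuclideanSpace.proj (𝕜 := ℝ) j).contDiff.contDiffOn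

/-- The superposition `e^{i k₁ R|y|} a(y) + e^{i k₂ R|y|} b(y)` of two radial waves with slowly
varying amplitudes. -/
def twoWave (k₁ k₂ : ℝ) (a b : R3 → ℂ) (R : ℝ) (y : R3) : ℂ :=
  phase (k₁ * R * ‖y‖) * a y + phase (k₂ * R * ‖y‖) * b y

lemma norm_twoWave_le (R : ℝ) (y : R3) : ‖twoWave k₁ k₂ a b R y‖ ≤ ‖a y‖ + ‖b y‖ := by
  refine (norm_add_le _ _).trans ?_
  simp [norm_phase]

lemma contDiffOn_twoWave {n : WithTop ℕ∞} (ha : ContDiffOn ℝ n a {0}ᶜ)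
    (hb : ContDiffOn ℝ n b {0}ᶜ) (R : ℝ) : ContDiffOn ℝ n (twoWave k₁ k₂ a b R) {0}ᶜ :=
  ((contDiffOn_phase_norm _).mul ha).add ((contDiffOn_phase_norm _).mul hb)

lemma differentiableAt_of_punctured {f : R3 → ℂ} (hf : ContDiffOn ℝ 1 f {0}ᶜ) {y : R3}
    (hy : y ≠ 0) : DifferentiableAt ℝ f y :=
  (hf.contDiffAt (isOpen_compl_singleton.mem_nhds hy)).differentiableAt one_ne_zero

lemma pd_twoWave (ha : ContDiffOn ℝ 1 a {0}ᶜ) (hb : ContDiffOn ℝ 1 b {0}ᶜ) (R : ℝ) {y : R3}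
    (hy : y ≠ 0) (j : Fin 3) :
    pd (twoWave k₁ k₂ a b R) j y
      = R * (Complex.I * ((y j / ‖y‖ : ℝ) : ℂ) *
          twoWave k₁ k₂ (fun z => k₁ * a z) (fun z => k₂ * b z) R y)
        + twoWave k₁ k₂ (pd a j) (pd b j) R y := by
  have h1 := differentiableAt_of_punctured (contDiffOn_phase_norm (k₁ * R)) hy
  have h2 := differentiableAt_of_punctured (contDiffOn_phase_norm (k₂ * R)) hy
  have h3 := differentiableAt_of_punctured ha hy
  have h4 := differentiableAt_of_punctured hb hy
  unfold twoWave
  rw [pd_add (h1.fun_mul h3) (h2.fun_mul h4), pd_mul h1 h3, pd_mul h2 h4, pd_phase_norm hy,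
    pd_phase_norm hy]
  push_cast
  ring

lemma sum_dir_sq {y : R3} (hy : y ≠ 0) : ∑ j, (y j / ‖y‖) * (y j / ‖y‖) = 1 := by
  have h : ‖y‖ ≠ 0 := norm_ne_zero_iff.2 hy
  have h2 := EuclideanSpace.real_norm_sq_eq y
  simp_rw [div_mul_div_comm, ← Finset.sum_div, ← sq]
  rw [← h2, div_self (pow_ne_zero 2 h)]

/-- Non-stationary phase: oscillation in the radial direction makes the integral vanish in the
limit, by one integration by parts along the radial field. -/
lemma tendsto_oscillatory {Ψ : R3 → ℂ} (hΨ : ContDiff ℝ 1 Ψ) (hc : HasCompactSupport Ψ)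
    (hs : tsupport Ψ ⊆ {0}ᶜ) {κ : ℝ} (hκ : κ ≠ 0) :
    Tendsto (fun R : ℝ => ∫ y, Ψ y * phase (κ * R * ‖y‖)) atTop (𝓝 0) := by
  let Θ : Fin 3 → R3 → ℂ := fun j y => ((y j / ‖y‖ : ℝ) : ℂ) * Ψ y
  have hΘ : ∀ j, ContDiff ℝ 1 (Θ j) := fun j =>
    contDiff_mul_of_tsupport isOpen_compl_singleton (contDiffOn_dir j) hΨ hs
  have hΘc : ∀ j, HasCompactSupport (Θ j) := fun j => hc.mul_left
  have hΘs : ∀ j, tsupport (Θ j) ⊆ {0}ᶜ := fun j => (tsupport_mul_subset_right).trans hs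
  have hdΘ : ∀ j, Continuous (pd (Θ j) j) := fun j =>
    (contDiff_pd (m := 0) (hΘ j) (by simp) j).continuous
  have hI : ∀ j, Integrable (fun y => ‖pd (Θ j) j y‖) := fun j =>
    ((hdΘ j).integrable_of_hasCompactSupport (hasCompactSupport_pd (hΘc j) j)).norm
  have key : ∀ R : ℝ, 0 < R → ‖∫ y, Ψ y * phase (κ * R * ‖y‖)‖
      ≤ (∑ j, ∫ y, ‖pd (Θ j) j y‖) / (|κ| * R) := by
    intro R hR
    have hibp : ∀ j, ∫ y, pd (fun y => phase (κ * R * ‖y‖)) j y * Θ j y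
        = - ∫ y, phase (κ * R * ‖y‖) * pd (Θ j) j y := fun j =>
      integral_pd_mul isOpen_compl_singleton (contDiffOn_phase_norm (κ * R)) (hΘ j) (hΘc j)
        (hΘs j) j
    have hint : ∀ j, Integrable (fun y => pd (fun y => phase (κ * R * ‖y‖)) j y * Θ j y) := fun j =>
      integrable_mul_of_tsupport isOpen_compl_singleton
        (contDiffOn_pd (m := 0) isOpen_compl_singleton (contDiffOn_phase_norm (n := 1) (κ * R))
          (by simp) j).continuousOn (hΘ j).continuous (hΘs j) (hΘc j)
    -- `x̂ · ∇ e^{i s|x|} = i s e^{i s|x|}`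
    have hpt : ∀ y, ∑ j, pd (fun y => phase (κ * R * ‖y‖)) j y * Θ j y
        = Complex.I * (κ * R : ℝ) * (Ψ y * phase (κ * R * ‖y‖)) := by
      intro y
      by_cases hy : y = 0
      · have : Ψ y = 0 := image_eq_zero_of_notMem_tsupport fun h => hs h hy
        simp [Θ, this]
      · have h1 : ∑ j, ((y j / ‖y‖ : ℝ) : ℂ) * ((y j / ‖y‖ : ℝ) : ℂ) = 1 := by
          exact_mod_cast sum_dir_sq hy
        calc _ = ∑ j, (((y j / ‖y‖ : ℝ) : ℂ) * ((y j / ‖y‖ : ℝ) : ℂ)) *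
              (Complex.I * (κ * R : ℝ) * (Ψ y * phase (κ * R * ‖y‖))) := by
              refine Finset.sum_congr rfl fun j _ => ?_
              rw [pd_phase_norm hy]
              simp only [Θ]
              ring
          _ = _ := by rw [← Finset.sum_mul, h1, one_mul]
    have h1 : Complex.I * (κ * R : ℝ) * ∫ y, Ψ y * phase (κ * R * ‖y‖)
        = - ∑ j, ∫ y, phase (κ * R * ‖y‖) * pd (Θ j) j y := by
      rw [← integral_const_mul, ← integral_congr_ae (Eventually.of_forall hpt),
        integral_finsetSum _ fun j _ => hint j, ← Finset.sum_neg_distrib]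
      exact Finset.sum_congr rfl fun j _ => hibp j
    have h2 := congrArg norm h1
    rw [norm_mul, norm_mul, Complex.norm_I, one_mul, Complex.norm_real, Real.norm_eq_abs, abs_mul,
      abs_of_pos hR, norm_neg] at h2
    rw [le_div_iff₀ (by positivity), mul_comm, h2]
    refine (norm_sum_le _ _).trans (Finset.sum_le_sum fun j _ => ?_)
    refine (norm_integral_le_integral_norm _).trans (le_of_eq ?_)
    simp [norm_phase]
  refine squeeze_zero_norm' ((eventually_gt_atTop 0).mono fun R hR => key R hR) ?_
  exact tendsto_const_nhds.div_atTop (tendsto_id.const_mul_atTop (abs_pos.2 hκ))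

lemma tsupport_ofReal_subset (ψ : R3 → ℝ) : tsupport (fun y => (ψ y : ℂ)) ⊆ tsupport ψ :=
  closure_mono fun x hx => by simpa using hx

lemma hasCompactSupport_ofReal {ψ : R3 → ℝ} (hc : HasCompactSupport ψ) :
    HasCompactSupport (fun y => (ψ y : ℂ)) :=
  hc.comp_left (g := fun t : ℝ => (t : ℂ)) (by simp)

lemma integrable_ofReal_mul {U : Set R3} (hU : IsOpen U) {ψ : R3 → ℝ} (hψ : Continuous ψ)
    (hc : HasCompactSupport ψ) (hs : tsupport ψ ⊆ U) {g : R3 → ℂ} (hg : ContinuousOn g U) :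
    Integrable (fun y => (ψ y : ℂ) * g y) :=
  (integrable_mul_of_tsupport hU hg (Complex.continuous_ofReal.comp hψ)
    ((tsupport_ofReal_subset ψ).trans hs) (hasCompactSupport_ofReal hc)).congr
    (Eventually.of_forall fun y => by simp only [Function.comp]; ring)

/-- The limiting flux of two radial waves: the terms mixing the two wave numbers oscillate away. -/
lemma tendsto_flux_twoWave (hk : k₁ ≠ k₂) (ha : ContDiffOn ℝ 1 a {0}ᶜ) (hb : ContDiffOn ℝ 1 b {0}ᶜ)
    (ha' : ContDiffOn ℝ 1 a' {0}ᶜ) (hb' : ContDiffOn ℝ 1 b' {0}ᶜ) {ψ : R3 → ℝ}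
    (hψ : ContDiff ℝ 1 ψ) (hc : HasCompactSupport ψ) (hs : tsupport ψ ⊆ {0}ᶜ) (j : Fin 3) :
    Tendsto (fun R : ℝ => (R : ℂ)⁻¹ * ∫ y, (ψ y : ℂ) * (pd (twoWave k₁ k₂ a b R) j y
        * conj (twoWave k₁ k₂ a' b' R y))) atTop
      (𝓝 (Complex.I * ∫ y, (ψ y : ℂ) * (((y j / ‖y‖ : ℝ) : ℂ) *
        (k₁ * (a y * conj (a' y)) + k₂ * (b y * conj (b' y)))))) := by
  have hO : IsOpen ({0}ᶜ : Set R3) := isOpen_compl_singleton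
  have hconj : ∀ {f : R3 → ℂ}, ContDiffOn ℝ 1 f {0}ᶜ →
      ContDiffOn ℝ 1 (fun y => conj (f y)) {0}ᶜ := fun hf =>
    Complex.conjCLE.contDiff.comp_contDiffOn hf
  have hint : ∀ {g : R3 → ℂ}, ContinuousOn g {0}ᶜ → Integrable (fun y => (ψ y : ℂ) * g y) :=
    fun hg => integrable_ofReal_mul hO hψ.continuous hc hs hg
  have hpdc : ∀ {f : R3 → ℂ}, ContDiffOn ℝ 1 f {0}ᶜ → ContinuousOn (pd f j) {0}ᶜ := fun hf =>
    (contDiffOn_pd (m := 0) hO hf (by simp) j).continuousOn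
  have hph : ∀ s : ℝ, ContinuousOn (fun y : R3 => phase (s * ‖y‖)) {0}ᶜ := fun s =>
    (contDiffOn_phase_norm (n := 0) s).continuousOn
  let θ : R3 → ℂ := fun y => ((y j / ‖y‖ : ℝ) : ℂ)
  have hθ : ContDiffOn ℝ 1 θ {0}ᶜ := contDiffOn_dir j
  let g₀ : R3 → ℂ := fun y => θ y * (k₁ * (a y * conj (a' y)) + k₂ * (b y * conj (b' y)))
  let g₁ : R3 → ℂ := fun y => θ y * (k₁ * (a y * conj (b' y)))
  let g₂ : R3 → ℂ := fun y => θ y * (k₂ * (b y * conj (a' y)))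
  have hg₀ : ContDiffOn ℝ 1 g₀ {0}ᶜ := hθ.mul
    ((contDiffOn_const.mul (ha.mul (hconj ha'))).add (contDiffOn_const.mul (hb.mul (hconj hb'))))
  have hg₁ : ContDiffOn ℝ 1 g₁ {0}ᶜ := hθ.mul (contDiffOn_const.mul (ha.mul (hconj hb')))
  have hg₂ : ContDiffOn ℝ 1 g₂ {0}ᶜ := hθ.mul (contDiffOn_const.mul (hb.mul (hconj ha')))
  -- the part of the gradient that does not fall on the phases is of lower order in `R`
  let E : ℝ → R3 → ℂ := fun R y => twoWave k₁ k₂ (pd a j) (pd b j) R y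
    * conj (twoWave k₁ k₂ a' b' R y)
  have hE : ∀ R, ContinuousOn (E R) {0}ᶜ := fun R =>
    (((hph _).mul (hpdc ha)).add ((hph _).mul (hpdc hb))).mul
      (hconj (contDiffOn_twoWave ha' hb' R)).continuousOn
  let osc : (R3 → ℂ) → ℝ → ℝ → ℂ := fun g κ R => ∫ y, ((ψ y : ℂ) * g y) * phase (κ * R * ‖y‖)
  have hosc : ∀ {g : R3 → ℂ}, ContDiffOn ℝ 1 g {0}ᶜ → ∀ {κ : ℝ}, κ ≠ 0 →
      Tendsto (osc g κ) atTop (𝓝 0) := by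
    intro g hg κ hκ
    have hΨ : ContDiff ℝ 1 (fun y => (ψ y : ℂ) * g y) := by
      have := contDiff_mul_of_tsupport hO hg (Complex.ofRealCLM.contDiff.comp hψ)
        ((tsupport_ofReal_subset ψ).trans hs)
      simpa only [Function.comp, Complex.ofRealCLM_apply, mul_comm] using this
    exact tendsto_oscillatory hΨ (hasCompactSupport_ofReal hc).mul_right
      ((tsupport_mul_subset_left).trans ((tsupport_ofReal_subset ψ).trans hs)) hκ
  have hEb : Tendsto (fun R : ℝ => (R : ℂ)⁻¹ * ∫ y, (ψ y : ℂ) * E R y) atTop (𝓝 0) := by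
    let N : R3 → ℝ := fun y => ‖(ψ y : ℂ) * (((‖pd a j y‖ + ‖pd b j y‖) *
      (‖a' y‖ + ‖b' y‖) : ℝ) : ℂ)‖
    have hN : Integrable N := (hint (Complex.continuous_ofReal.comp_continuousOn
      (((hpdc ha).norm.add (hpdc hb).norm).mul
        (ha'.continuousOn.norm.add hb'.continuousOn.norm)))).norm
    refine squeeze_zero_norm' (a := fun R : ℝ => (∫ y, N y) / R) ?_
      (tendsto_const_nhds.div_atTop tendsto_id)
    filter_upwards [eventually_gt_atTop 0] with R hR
    rw [norm_mul, norm_inv, Complex.norm_real, Real.norm_of_nonneg hR.le, inv_mul_eq_div]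
    gcongr
    refine norm_integral_le_of_norm_le hN (Eventually.of_forall fun y => ?_)
    simp only [N, E, norm_mul, RCLike.norm_conj, Complex.norm_real]
    rw [Real.norm_of_nonneg (by positivity : 0 ≤ ‖pd a j y‖ + ‖pd b j y‖),
      Real.norm_of_nonneg (by positivity : 0 ≤ ‖a' y‖ + ‖b' y‖)]
    gcongr
    · exact norm_twoWave_le R y
    · exact norm_twoWave_le R y
  have hexp : ∀ᶠ R : ℝ in atTop, Complex.I * (∫ y, (ψ y : ℂ) * g₀ y)
      + Complex.I * osc g₁ (k₁ - k₂) R + Complex.I * osc g₂ (k₂ - k₁) R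
      + (R : ℂ)⁻¹ * ∫ y, (ψ y : ℂ) * E R y
      = (R : ℂ)⁻¹ * ∫ y, (ψ y : ℂ) * (pd (twoWave k₁ k₂ a b R) j y
        * conj (twoWave k₁ k₂ a' b' R y)) := by
    filter_upwards [eventually_gt_atTop 0] with R hR
    have hR' : (R : ℂ) ≠ 0 := by exact_mod_cast hR.ne'
    have i0 := (hint hg₀.continuousOn).const_mul Complex.I
    have i1 : Integrable fun y => Complex.I * (((ψ y : ℂ) * g₁ y) * phase ((k₁ - k₂) * R * ‖y‖)) :=
      ((hint (hg₁.continuousOn.mul (hph ((k₁ - k₂) * R)))).const_mul Complex.I).congr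
        (Eventually.of_forall fun y => by simp only [Pi.mul_apply]; ring)
    have i2 : Integrable fun y => Complex.I * (((ψ y : ℂ) * g₂ y) * phase ((k₂ - k₁) * R * ‖y‖)) :=
      ((hint (hg₂.continuousOn.mul (hph ((k₂ - k₁) * R)))).const_mul Complex.I).congr
        (Eventually.of_forall fun y => by simp only [Pi.mul_apply]; ring)
    have i3 := (hint (hE R)).const_mul ((R : ℂ)⁻¹)
    have i01 : Integrable fun y => Complex.I * ((ψ y : ℂ) * g₀ y)
        + Complex.I * (((ψ y : ℂ) * g₁ y) * phase ((k₁ - k₂) * R * ‖y‖)) := i0.add i1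
    have i02 : Integrable fun y => Complex.I * ((ψ y : ℂ) * g₀ y)
        + Complex.I * (((ψ y : ℂ) * g₁ y) * phase ((k₁ - k₂) * R * ‖y‖))
        + Complex.I * (((ψ y : ℂ) * g₂ y) * phase ((k₂ - k₁) * R * ‖y‖)) := i01.add i2
    simp only [osc]
    rw [← integral_const_mul, ← integral_const_mul, ← integral_const_mul, ← integral_const_mul,
      ← integral_const_mul, ← integral_add i0 i1, ← integral_add i01 i2,
      ← integral_add i02 i3]
    refine integral_congr_ae (Eventually.of_forall fun y => ?_)
    by_cases hy : y = 0
    · have : ψ y = 0 := image_eq_zero_of_notMem_tsupport fun h => hs h hy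
      simp [this]
    · beta_reduce
      rw [pd_twoWave ha hb R hy]
      have p1 : phase ((k₁ - k₂) * R * ‖y‖) = phase (k₁ * R * ‖y‖) * phase (-(k₂ * R * ‖y‖)) := by
        rw [← phase_add]; ring_nf
      have p2 : phase ((k₂ - k₁) * R * ‖y‖) = phase (k₂ * R * ‖y‖) * phase (-(k₁ * R * ‖y‖)) := by
        rw [← phase_add]; ring_nf
      have q1 := phase_mul_phase_neg (k₁ * R * ‖y‖)
      have q2 := phase_mul_phase_neg (k₂ * R * ‖y‖)
      simp only [p1, p2, g₀, g₁, g₂, E, θ, twoWave, map_add, map_mul, conj_phase]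
      generalize phase (k₁ * R * ‖y‖) = e₁ at q1 ⊢
      generalize phase (-(k₁ * R * ‖y‖)) = f₁ at q1 ⊢
      generalize phase (k₂ * R * ‖y‖) = e₂ at q2 ⊢
      generalize phase (-(k₂ * R * ‖y‖)) = f₂ at q2 ⊢
      field_simp
      linear_combination (-(Complex.I * (ψ y : ℂ) * R * ((y j / ‖y‖ : ℝ) : ℂ) * k₁ * a y
        * conj (a' y))) * q1 - (Complex.I * (ψ y : ℂ) * R * ((y j / ‖y‖ : ℝ) : ℂ) * k₂ * b y
        * conj (b' y)) * q2
  refine Tendsto.congr' hexp ?_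
  have := ((tendsto_const_nhds (x := Complex.I * ∫ y, (ψ y : ℂ) * g₀ y)).add
    ((hosc hg₁ (sub_ne_zero.2 hk)).const_mul Complex.I)).add
    ((hosc hg₂ (sub_ne_zero.2 hk.symm)).const_mul Complex.I) |>.add hEb
  simpa only [mul_zero, add_zero] using this

/-! ### Outgoing asymptotics -/

/-- `f(x) = |x|⁻¹ (e^{i k₁|x|} A(x) + e^{i k₂|x|} B(x)) + o(|x|⁻¹)` as `|x| → ∞`, uniformly in all
directions. The amplitudes are meant to depend on the direction of `x` only. -/
def Outgoing (k₁ k₂ : ℝ) (f A B : R3 → ℂ) : Prop :=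
  Tendsto (fun x : R3 => (‖x‖ : ℂ) * f x - twoWave k₁ k₂ A B 1 x) (Bornology.cobounded R3) (𝓝 0)

/-- Positive homogeneity of degree zero. -/
def Homog (A : R3 → ℂ) : Prop := ∀ t : ℝ, 0 < t → ∀ x : R3, x ≠ 0 → A (t • x) = A x

lemma Outgoing.swap {f A B : R3 → ℂ} (h : Outgoing k₁ k₂ f A B) : Outgoing k₂ k₁ f B A := by
  refine h.congr fun x => ?_
  simp only [twoWave]
  ring

lemma Outgoing.exists_bound {f A B : R3 → ℂ} (h : Outgoing k₁ k₂ f A B) {ε : ℝ} (hε : 0 < ε) :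
    ∃ ρ : ℝ, 0 < ρ ∧ ∀ x : R3, ρ ≤ ‖x‖ → ‖(‖x‖ : ℂ) * f x - twoWave k₁ k₂ A B 1 x‖ ≤ ε := by
  have h1 : ∀ᶠ x in Bornology.cobounded R3,
      ‖(‖x‖ : ℂ) * f x - twoWave k₁ k₂ A B 1 x‖ ≤ ε := by
    have := (tendsto_zero_iff_norm_tendsto_zero.1 h).eventually (gt_mem_nhds hε)
    exact this.mono fun x hx => hx.le
  obtain ⟨r, -, hr⟩ := (hasBasis_cobounded_norm.eventually_iff).1 h1
  exact ⟨max r 1, by positivity, fun x hx => hr ((le_max_left _ _).trans hx)⟩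

lemma twoWave_smul {A B : R3 → ℂ} (hA : Homog A) (hB : Homog B) {R : ℝ} (hR : 0 < R) {y : R3}
    (hy : y ≠ 0) : twoWave k₁ k₂ A B 1 (R • y) = twoWave k₁ k₂ A B R y := by
  simp only [twoWave, hA R hR y hy, hB R hR y hy, norm_smul, Real.norm_of_nonneg hR.le, mul_one,
    mul_assoc]

lemma norm_dir_smul {ρ : ℝ} (hρ : 0 < ρ) {y : R3} (hy : y ≠ 0) : ‖(ρ * ‖y‖⁻¹) • y‖ = ρ := by
  have : ‖y‖ ≠ 0 := norm_ne_zero_iff.2 hy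
  rw [norm_smul, Real.norm_of_nonneg (by positivity)]
  field_simp

lemma contDiffOn_inv_norm {n : WithTop ℕ∞} : ContDiffOn ℝ n (fun y : R3 => ‖y‖⁻¹) {0}ᶜ := by
  have h : ContDiffOn ℝ n (fun y : R3 => ‖y‖) {0}ᶜ := contDiffOn_id.norm ℝ fun _ hx => hx
  exact h.inv fun x hx => norm_ne_zero_iff.2 hx

/-- The amplitudes are uniform limits of continuously differentiable functions: combining the field
at two large radii whose phases `(k₁ - k₂) r` differ by `π` eliminates the other amplitude. -/
lemma Outgoing.exists_smooth_approx {f A B : R3 → ℂ} (h : Outgoing k₁ k₂ f A B) (hA : Homog A)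
    (hB : Homog B) (hk : k₁ ≠ k₂) {R₀ : ℝ} (hf : ContDiffOn ℝ 1 f {x | R₀ < ‖x‖}) {ε : ℝ}
    (hε : 0 < ε) :
    ∃ A' : R3 → ℂ, ContDiffOn ℝ 1 A' {0}ᶜ ∧ ∀ y ≠ 0, ‖A y - A' y‖ ≤ ε := by
  obtain ⟨ρ₀, hρ₀, hb⟩ := h.exists_bound hε
  let ρ := max ρ₀ (R₀ + 1)
  have hρ : 0 < ρ := lt_max_of_lt_left hρ₀
  let ρ' := ρ + Real.pi / |k₂ - k₁|
  have hκ : 0 < |k₂ - k₁| := abs_pos.2 (sub_ne_zero.2 hk.symm)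
  have hρρ' : ρ ≤ ρ' := le_add_of_nonneg_right (by positivity)
  let H : ℝ → R3 → ℂ := fun r y => (r : ℂ) * f ((r * ‖y‖⁻¹) • y)
  have hH : ∀ r, ρ ≤ r → ContDiffOn ℝ 1 (H r) {0}ᶜ := by
    intro r hr
    refine contDiffOn_const.mul (hf.comp (((contDiffOn_const (c := r)).mul
      contDiffOn_inv_norm).smul contDiffOn_id)
      fun y hy => ?_)
    have h1 : ‖(r * ‖y‖⁻¹) • y‖ = r := norm_dir_smul (hρ.trans_le hr) hy
    change R₀ < ‖(r * ‖y‖⁻¹) • y‖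
    rw [h1]
    exact (lt_add_one R₀).trans_le ((le_max_right _ _).trans hr)
  have hHb : ∀ r, ρ ≤ r → ∀ y ≠ 0, ‖H r y - (phase (k₁ * r) * A y + phase (k₂ * r) * B y)‖ ≤ ε := by
    intro r hr y hy
    have hr0 : 0 < r := hρ.trans_le hr
    have hn := norm_dir_smul hr0 hy
    have ht : 0 < r * ‖y‖⁻¹ := by
      have := norm_pos_iff.2 hy
      positivity
    have h1 := hb ((r * ‖y‖⁻¹) • y) (by rw [hn]; exact (le_max_left _ _).trans hr)
    simp only [twoWave, hn, hA _ ht y hy, hB _ ht y hy, mul_one] at h1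
    exact h1
  have hph : phase ((k₂ - k₁) * ρ') = - phase ((k₂ - k₁) * ρ) := by
    have e : (k₂ - k₁) * ρ' = (k₂ - k₁) * ρ + (k₂ - k₁) * (Real.pi / |k₂ - k₁|) := by
      simp only [ρ']; ring
    have e2 : phase ((k₂ - k₁) * (Real.pi / |k₂ - k₁|)) = -1 := by
      rcases lt_or_gt_of_ne (sub_ne_zero.2 hk.symm) with hneg | hpos
      · rw [abs_of_neg hneg, show (k₂ - k₁) * (Real.pi / -(k₂ - k₁)) = -Real.pi by
          field_simp [hneg.ne], ← conj_phase, phase, mul_comm, Complex.exp_pi_mul_I]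
        simp
      · rw [abs_of_pos hpos, mul_div_cancel₀ _ hpos.ne', phase, mul_comm, Complex.exp_pi_mul_I]
    rw [e, phase_add, e2]
    ring
  refine ⟨fun y => (phase (-(k₁ * ρ)) * H ρ y + phase (-(k₁ * ρ')) * H ρ' y) / 2, ?_, ?_⟩
  · exact ((contDiffOn_const.mul (hH ρ le_rfl)).add (contDiffOn_const.mul (hH ρ' hρρ'))).div_const 2
  · intro y hy
    have p : ∀ r, phase (-(k₁ * r)) * phase (k₂ * r) = phase ((k₂ - k₁) * r) := by
      intro r
      rw [← phase_add]; ring_nf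
    have q : ∀ r, phase (-(k₁ * r)) * phase (k₁ * r) = 1 := by
      intro r
      rw [mul_comm, phase_mul_phase_neg]
    have e : A y - (phase (-(k₁ * ρ)) * H ρ y + phase (-(k₁ * ρ')) * H ρ' y) / 2
        = -(phase (-(k₁ * ρ)) * (H ρ y - (phase (k₁ * ρ) * A y + phase (k₂ * ρ) * B y))
          + phase (-(k₁ * ρ')) * (H ρ' y - (phase (k₁ * ρ') * A y + phase (k₂ * ρ') * B y)))
          / 2 := by
      linear_combination (-(A y) / 2) * (q ρ) - (A y) / 2 * (q ρ') - (B y) / 2 * (p ρ)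
        - (B y) / 2 * (p ρ') - (B y) / 2 * hph
    rw [e, norm_div, norm_neg, Complex.norm_ofNat]
    have h1 := hHb ρ le_rfl y hy
    have h2 := hHb ρ' hρρ' y hy
    have h3 := norm_add_le
      (phase (-(k₁ * ρ)) * (H ρ y - (phase (k₁ * ρ) * A y + phase (k₂ * ρ) * B y)))
      (phase (-(k₁ * ρ')) * (H ρ' y - (phase (k₁ * ρ') * A y + phase (k₂ * ρ') * B y)))
    rw [norm_mul, norm_mul, norm_phase, norm_phase, one_mul, one_mul] at h3
    linarith

lemma Outgoing.continuousOn {f A B : R3 → ℂ} (h : Outgoing k₁ k₂ f A B) (hA : Homog A)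
    (hB : Homog B) (hk : k₁ ≠ k₂) {R₀ : ℝ} (hf : ContDiffOn ℝ 1 f {x | R₀ < ‖x‖}) :
    ContinuousOn A {0}ᶜ := by
  refine continuousOn_of_uniform_approx_of_continuousOn fun s hs => ?_
  obtain ⟨ε, hε, hεs⟩ := Metric.mem_uniformity_dist.1 hs
  obtain ⟨A', hA', hb⟩ := h.exists_smooth_approx hA hB hk hf (half_pos hε)
  exact ⟨A', hA'.continuousOn, fun y hy => hεs (by
    rw [dist_eq_norm]; exact (hb y hy).trans_lt (half_lt_self hε))⟩

lemma Homog.exists_bound {A : R3 → ℂ} (hA : Homog A) (hc : ContinuousOn A {0}ᶜ) :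
    ∃ N : ℝ, 0 ≤ N ∧ ∀ y ≠ 0, ‖A y‖ ≤ N := by
  obtain ⟨N, hN⟩ := (isCompact_sphere (0 : R3) 1).exists_bound_of_continuousOn
    (hc.mono fun y hy => by
      intro h0
      simp [Set.mem_singleton_iff.1 h0] at hy)
  refine ⟨|N|, abs_nonneg N, fun y hy => ?_⟩
  have hy0 := norm_pos_iff.2 hy
  rw [← hA ‖y‖⁻¹ (by positivity) y hy]
  refine (hN _ ?_).trans (le_abs_self N)
  rw [mem_sphere_zero_iff_norm, norm_smul, norm_inv, norm_norm, inv_mul_cancel₀ hy0.ne']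

/-! ### Replacing the field by its asymptotics in the flux -/

lemma abs_dir_le_one (y : R3) (j : Fin 3) : |y j / ‖y‖| ≤ 1 := by
  rw [abs_div, abs_norm]
  exact div_le_one_of_le₀ (PiLp.norm_apply_le y j) (norm_nonneg y)

lemma norm_pd_twoWave_le (hk₁ : 0 ≤ k₁) (hk₂ : 0 ≤ k₂) (ha : ContDiffOn ℝ 1 a {0}ᶜ)
    (hb : ContDiffOn ℝ 1 b {0}ᶜ) {R : ℝ} (hR : 0 ≤ R) {y : R3} (hy : y ≠ 0) (j : Fin 3) :
    ‖pd (twoWave k₁ k₂ a b R) j y‖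
      ≤ R * (k₁ * ‖a y‖ + k₂ * ‖b y‖) + (‖pd a j y‖ + ‖pd b j y‖) := by
  rw [pd_twoWave ha hb R hy]
  refine (norm_add_le _ _).trans (add_le_add ?_ (norm_twoWave_le R y))
  rw [norm_mul, norm_mul, norm_mul, Complex.norm_I, one_mul, Complex.norm_real, Complex.norm_real,
    Real.norm_of_nonneg hR, Real.norm_eq_abs]
  have h1 := norm_twoWave_le (k₁ := k₁) (k₂ := k₂) (a := fun z => k₁ * a z)
    (b := fun z => k₂ * b z) R y
  simp only [norm_mul, Complex.norm_real, Real.norm_of_nonneg hk₁, Real.norm_of_nonneg hk₂] at h1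
  gcongr
  calc _ ≤ 1 * (k₁ * ‖a y‖ + k₂ * ‖b y‖) := by
        gcongr
        exact abs_dir_le_one y j
    _ = _ := one_mul _

/-- The flux of a pair of fields that are uniformly `ε`-close to radial waves. No control on the
gradient of the difference is needed: the difference is integrated by parts against the wave. -/
lemma flux_compare {U : Set R3} (hU : IsOpen U) {f g p : R3 → ℂ} (hf : ContDiffOn ℝ 1 f U)
    (hg : ContinuousOn g U) (hpc : ContinuousOn p U) {R : ℝ} (hR : 0 < R) {j : Fin 3}
    (hp : ∀ y ∈ U, pd f j y = R * p y) {ψ : R3 → ℝ} (hψ : ContDiff ℝ 1 ψ)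
    (hc : HasCompactSupport ψ) (hsU : tsupport ψ ⊆ U) (hs : tsupport ψ ⊆ {0}ᶜ)
    (hk₁ : 0 ≤ k₁) (hk₂ : 0 ≤ k₂) (ha : ContDiffOn ℝ 1 a {0}ᶜ) (hb : ContDiffOn ℝ 1 b {0}ᶜ)
    (ha' : ContDiffOn ℝ 1 a' {0}ᶜ) (hb' : ContDiffOn ℝ 1 b' {0}ᶜ) {ε N : ℝ}
    (hfε : ∀ y ∈ tsupport ψ, ‖f y - twoWave k₁ k₂ a b R y‖ ≤ ε)
    (hgε : ∀ y ∈ tsupport ψ, ‖g y - twoWave k₁ k₂ a' b' R y‖ ≤ ε)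
    (hN : ∀ y ∈ tsupport ψ, ‖a' y‖ ≤ N ∧ ‖b' y‖ ≤ N) :
    ‖(∫ y, (ψ y : ℂ) * p y * conj (g y)) - (R : ℂ)⁻¹ * ∫ y, (ψ y : ℂ) *
        (pd (twoWave k₁ k₂ a b R) j y * conj (twoWave k₁ k₂ a' b' R y))‖
      ≤ ε * (∫ y, |ψ y| * ‖p y‖) + ε * ((k₁ + k₂) * N * ∫ y, |ψ y|)
        + ε * (R⁻¹ * ∫ y, (|pd ψ j y| * (‖a' y‖ + ‖b' y‖)
          + |ψ y| * (‖pd a' j y‖ + ‖pd b' j y‖))) := by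
  have hO : IsOpen ({0}ᶜ : Set R3) := isOpen_compl_singleton
  have hR' : (R : ℂ) ≠ 0 := by exact_mod_cast hR.ne'
  set F := twoWave k₁ k₂ a b R with hFdef
  set H := twoWave k₁ k₂ a' b' R with hHdef
  have hF : ContDiffOn ℝ 1 F {0}ᶜ := contDiffOn_twoWave ha hb R
  have hH : ContDiffOn ℝ 1 H {0}ᶜ := contDiffOn_twoWave ha' hb' R
  have hHc : ContDiffOn ℝ 1 (fun y => conj (H y)) {0}ᶜ :=
    Complex.conjCLE.contDiff.comp_contDiffOn hH
  let V : Set R3 := U ∩ {0}ᶜ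
  have hV : IsOpen V := hU.inter hO
  have hsV : tsupport ψ ⊆ V := Set.subset_inter hsU hs
  let ψc : R3 → ℂ := fun y => (ψ y : ℂ)
  have hψc : ContDiff ℝ 1 ψc := Complex.ofRealCLM.contDiff.comp hψ
  have hψcc : HasCompactSupport ψc := hasCompactSupport_ofReal hc
  have hψcs : tsupport ψc ⊆ tsupport ψ := tsupport_ofReal_subset ψ
  let φ : R3 → ℂ := fun y => conj (H y) * ψc y
  have hφ : ContDiff ℝ 1 φ := contDiff_mul_of_tsupport hO hHc hψc (hψcs.trans hs)
  have hφc : HasCompactSupport φ := hψcc.mul_left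
  have hφs : tsupport φ ⊆ tsupport ψ := (tsupport_mul_subset_right).trans hψcs
  let D : R3 → ℂ := fun y => f y - F y
  have hD : ContDiffOn ℝ 1 D V :=
    (hf.mono Set.inter_subset_left).sub (hF.mono Set.inter_subset_right)
  have hpdF : ContinuousOn (pd F j) {0}ᶜ := (contDiffOn_pd (m := 0) hO hF (by simp) j).continuousOn
  have hpdD : ContinuousOn (pd D j) V := (contDiffOn_pd (m := 0) hV hD (by simp) j).continuousOn
  have hint : ∀ {q : R3 → ℂ}, ContinuousOn q V → Integrable (fun y => (ψ y : ℂ) * q y) :=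
    fun hq => integrable_ofReal_mul hV hψ.continuous hc hsV hq
  have hgc : ContinuousOn (fun y => conj (g y)) U := Complex.continuous_conj.comp_continuousOn hg
  have hpV := hpc.mono (Set.inter_subset_left : V ⊆ U)
  have hHV := hHc.continuousOn.mono (Set.inter_subset_right : V ⊆ {0}ᶜ)
  have hgV := hgc.mono (Set.inter_subset_left : V ⊆ U)
  have i1 : Integrable (fun y => (ψ y : ℂ) * (p y * (conj (g y) - conj (H y)))) :=
    hint (hpV.mul (hgV.sub hHV))
  have i2 : Integrable (fun y => (ψ y : ℂ) * (pd D j y * conj (H y))) := hint (hpdD.mul hHV)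
  have i3 : Integrable (fun y => (ψ y : ℂ) * (pd F j y * conj (H y))) :=
    hint ((hpdF.mono Set.inter_subset_right).mul hHV)
  have i12 : Integrable (fun y => (ψ y : ℂ) * (p y * (conj (g y) - conj (H y)))
      + (R : ℂ)⁻¹ * ((ψ y : ℂ) * (pd D j y * conj (H y)))) := i1.add (i2.const_mul _)
  -- split off the error in `g` and the error `D = f - F`, and integrate the latter by parts
  have hsplit : (∫ y, (ψ y : ℂ) * p y * conj (g y)) - (R : ℂ)⁻¹ * ∫ y, (ψ y : ℂ) *
      (pd F j y * conj (H y)) = (∫ y, (ψ y : ℂ) * (p y * (conj (g y) - conj (H y))))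
      + (R : ℂ)⁻¹ * ∫ y, (ψ y : ℂ) * (pd D j y * conj (H y)) := by
    rw [sub_eq_iff_eq_add, ← integral_const_mul, ← integral_const_mul,
      ← integral_add i1 (i2.const_mul _), ← integral_add i12 (i3.const_mul _)]
    refine integral_congr_ae (Eventually.of_forall fun y => ?_)
    by_cases hy : y ∈ tsupport ψ
    · have hyV := hsV hy
      have hd : pd D j y = R * p y - pd F j y := by
        rw [← hp y hyV.1]
        exact pd_sub ((hf.contDiffAt (hU.mem_nhds hyV.1)).differentiableAt one_ne_zero)
          (differentiableAt_of_punctured hF hyV.2)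
      simp only [hd]
      field_simp
      ring
    · simp [image_eq_zero_of_notMem_tsupport hy]
  have hibp : ∫ y, (ψ y : ℂ) * (pd D j y * conj (H y)) = - ∫ y, D y * pd φ j y := by
    rw [← integral_pd_mul hV hD hφ hφc (hφs.trans hsV) j]
    refine integral_congr_ae (Eventually.of_forall fun y => ?_)
    simp only [φ, ψc]
    ring
  have i4 : Integrable (fun y => |ψ y| * ‖p y‖) :=
    (hint hpV).norm.congr (Eventually.of_forall fun y => by simp)
  have b1 : ‖∫ y, (ψ y : ℂ) * (p y * (conj (g y) - conj (H y)))‖ ≤ ε * ∫ y, |ψ y| * ‖p y‖ := by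
    rw [← integral_const_mul]
    refine norm_integral_le_of_norm_le (i4.const_mul _) (Eventually.of_forall fun y => ?_)
    by_cases hy : y ∈ tsupport ψ
    · rw [norm_mul, norm_mul, ← map_sub, RCLike.norm_conj, Complex.norm_real, Real.norm_eq_abs]
      calc _ ≤ |ψ y| * (‖p y‖ * ε) := by
            gcongr
            exact hgε y hy
        _ = _ := by ring
    · simp [image_eq_zero_of_notMem_tsupport hy]
  let G : R3 → ℝ := fun y => |pd ψ j y| * (‖a' y‖ + ‖b' y‖) + |ψ y| * (‖pd a' j y‖ + ‖pd b' j y‖)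
  have hpdc : ∀ {q : R3 → ℂ}, ContDiffOn ℝ 1 q {0}ᶜ → ContinuousOn (pd q j) {0}ᶜ := fun hq =>
    (contDiffOn_pd (m := 0) hO hq (by simp) j).continuousOn
  have iG : Integrable G := by
    have j1 := (integrable_ofReal_mul hO (contDiff_pd (m := 0) hψ (by simp) j).continuous
      (hasCompactSupport_pd hc j) ((tsupport_pd_subset ψ j).trans hs)
      (Complex.continuous_ofReal.comp_continuousOn
        (ha'.continuousOn.norm.add hb'.continuousOn.norm))).norm
    have j2 := (integrable_ofReal_mul hO hψ.continuous hc hs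
      (Complex.continuous_ofReal.comp_continuousOn ((hpdc ha').norm.add (hpdc hb').norm))).norm
    refine (j1.add j2).congr (Eventually.of_forall fun y => ?_)
    simp only [Pi.add_apply, Function.comp, norm_mul, Complex.norm_real, Real.norm_eq_abs, G]
    rw [abs_of_nonneg (by positivity : 0 ≤ ‖a' y‖ + ‖b' y‖),
      abs_of_nonneg (by positivity : 0 ≤ ‖pd a' j y‖ + ‖pd b' j y‖)]
  have iψ : Integrable (fun y => |ψ y|) :=
    (hψ.continuous.integrable_of_hasCompactSupport hc).norm
  have b2 : ‖∫ y, D y * pd φ j y‖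
      ≤ ε * (R * ((k₁ + k₂) * N) * (∫ y, |ψ y|) + ∫ y, G y) := by
    rw [← integral_const_mul, ← integral_add (iψ.const_mul _) iG, ← integral_const_mul]
    refine norm_integral_le_of_norm_le (((iψ.const_mul _).add iG).const_mul _)
      (Eventually.of_forall fun y => ?_)
    by_cases hy : y ∈ tsupport ψ
    · have hy0 : y ≠ 0 := hs hy
      have hφpd : pd φ j y = conj (H y) * ((pd ψ j y : ℝ) : ℂ) + conj (pd H j y) * (ψ y : ℂ) := by
        have := pd_mul (j := j) (differentiableAt_of_punctured hHc hy0)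
          (hψc.differentiable one_ne_zero y)
        rw [show pd φ j y = _ from this, pd_conj, pd_ofReal (hψ.differentiable one_ne_zero y)]
      have hpdH := norm_pd_twoWave_le hk₁ hk₂ ha' hb' hR.le hy0 j
      have hHn := norm_twoWave_le (k₁ := k₁) (k₂ := k₂) (a := a') (b := b') R y
      obtain ⟨n1, n2⟩ := hN y hy
      have hφn : ‖pd φ j y‖ ≤ R * ((k₁ + k₂) * N) * |ψ y| + G y := by
        rw [hφpd]
        refine (norm_add_le _ _).trans ?_
        simp only [norm_mul, RCLike.norm_conj, Complex.norm_real, Real.norm_eq_abs]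
        calc _ ≤ (‖a' y‖ + ‖b' y‖) * |pd ψ j y|
              + (R * (k₁ * N + k₂ * N) + (‖pd a' j y‖ + ‖pd b' j y‖)) * |ψ y| := by
              gcongr
              refine hpdH.trans ?_
              gcongr
          _ = _ := by simp only [G]; ring
      have hε0 : 0 ≤ ε := (norm_nonneg _).trans (hfε y hy)
      rw [norm_mul]
      exact mul_le_mul (hfε y hy) hφn (norm_nonneg _) hε0
    · have h1 : pd φ j y = 0 := image_eq_zero_of_notMem_tsupport fun h =>
        hy (hφs (tsupport_pd_subset _ j h))
      have h2 : pd ψ j y = 0 := image_eq_zero_of_notMem_tsupport fun h =>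
        hy (tsupport_pd_subset _ j h)
      simp [h1, h2, G, image_eq_zero_of_notMem_tsupport hy]
  rw [hsplit, hibp]
  refine (norm_add_le _ _).trans ?_
  rw [norm_mul, norm_neg, norm_inv, Complex.norm_real, Real.norm_of_nonneg hR.le]
  calc _ ≤ ε * (∫ y, |ψ y| * ‖p y‖)
        + R⁻¹ * (ε * (R * ((k₁ + k₂) * N) * (∫ y, |ψ y|) + ∫ y, G y)) := by gcongr
    _ = _ := by
      simp only [G]
      field_simp
      ring

end

/-! ### A radial cutoff -/

/-- A smooth radial cutoff, equal to `1` for `|y| ≤ 1` and to `0` for `|y|² ≥ 2`. -/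
def cutoff (y : R3) : ℝ := Real.smoothTransition (2 - ‖y‖ ^ 2)

/-- A smooth bump equal to `1` where the gradient of `cutoff` lives, supported away from `0`. -/
def shellBump (y : R3) : ℝ :=
  Real.smoothTransition (2 * ‖y‖ ^ 2 - 1) * Real.smoothTransition (3 - ‖y‖ ^ 2)

lemma contDiff_smoothTransition : ContDiff ℝ ∞ Real.smoothTransition :=
  Real.smoothTransition.contDiff

lemma contDiff_cutoff : ContDiff ℝ ∞ cutoff :=
  contDiff_smoothTransition.comp (contDiff_const.sub (contDiff_norm_sq ℝ))

lemma contDiff_shellBump : ContDiff ℝ ∞ shellBump :=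
  (contDiff_smoothTransition.comp
    ((contDiff_const.mul (contDiff_norm_sq ℝ)).sub contDiff_const)).mul
    (contDiff_smoothTransition.comp (contDiff_const.sub (contDiff_norm_sq ℝ)))

lemma hasCompactSupport_cutoff : HasCompactSupport cutoff := by
  refine HasCompactSupport.of_support_subset_isCompact (isCompact_closedBall (0 : R3) 2)
    fun y hy => ?_
  rw [mem_closedBall_zero_iff]
  by_contra h
  refine hy (Real.smoothTransition.zero_of_nonpos ?_)
  nlinarith

lemma hasCompactSupport_shellBump : HasCompactSupport shellBump := by
  refine HasCompactSupport.of_support_subset_isCompact (isCompact_closedBall (0 : R3) 2)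
    fun y hy => ?_
  rw [mem_closedBall_zero_iff]
  by_contra h
  refine hy ?_
  rw [shellBump, Real.smoothTransition.zero_of_nonpos (x := 3 - ‖y‖ ^ 2) (by nlinarith), mul_zero]

lemma half_le_norm_of_mem_tsupport_shellBump {y : R3} (hy : y ∈ tsupport shellBump) :
    1 / 2 ≤ ‖y‖ := by
  have hcl : IsClosed {y : R3 | 1 / 2 ≤ ‖y‖} := isClosed_le continuous_const continuous_norm
  refine closure_minimal (fun z hz => ?_) hcl hy
  change 1 / 2 ≤ ‖z‖
  by_contra h
  refine hz ?_
  rw [shellBump, Real.smoothTransition.zero_of_nonpos (by nlinarith [norm_nonneg z]), zero_mul]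

lemma pd_cutoff (l : Fin 3) (y : R3) :
    pd cutoff l y = -(2 * deriv Real.smoothTransition (2 - ‖y‖ ^ 2) * y l) := by
  have h1 : HasDerivAt Real.smoothTransition (deriv Real.smoothTransition (2 - ‖y‖ ^ 2))
      (2 - ‖y‖ ^ 2) := (contDiff_smoothTransition.differentiable (by simp) _).hasDerivAt
  have h2 := h1.comp_hasFDerivAt y ((hasStrictFDerivAt_norm_sq y).hasFDerivAt.const_sub 2)
  have h3 : (Real.smoothTransition ∘ fun y : R3 => 2 - ‖y‖ ^ 2) = cutoff := rfl
  rw [h3] at h2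
  rw [pd, h2.fderiv]
  simp [inner_basisVec]
  ring

lemma deriv_smoothTransition_nonneg (t : ℝ) : 0 ≤ deriv Real.smoothTransition t :=
  Real.smoothTransition.monotone.deriv_nonneg

lemma deriv_smoothTransition_eq_zero {t : ℝ} (ht : t < 0 ∨ 1 < t) :
    deriv Real.smoothTransition t = 0 := by
  rcases ht with h | h
  · have : Real.smoothTransition =ᶠ[𝓝 t] fun _ => (0 : ℝ) := by
      filter_upwards [gt_mem_nhds h] with s hs using Real.smoothTransition.zero_of_nonpos hs.le
    rw [this.deriv_eq, deriv_const]
  · have : Real.smoothTransition =ᶠ[𝓝 t] fun _ => (1 : ℝ) := by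
      filter_upwards [lt_mem_nhds h] with s hs using Real.smoothTransition.one_of_one_le hs.le
    rw [this.deriv_eq, deriv_const]

lemma exists_deriv_smoothTransition_eq_one :
    ∃ t ∈ Set.Ioo (0 : ℝ) 1, deriv Real.smoothTransition t = 1 := by
  obtain ⟨t, ht, h⟩ := exists_deriv_eq_slope Real.smoothTransition zero_lt_one
    Real.smoothTransition.continuous.continuousOn
    (contDiff_smoothTransition.differentiable (by simp)).differentiableOn
  exact ⟨t, ht, by simpa [Real.smoothTransition.zero, Real.smoothTransition.one] using h⟩

lemma continuous_shellWeight :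
    Continuous fun y : R3 => deriv Real.smoothTransition (2 - ‖y‖ ^ 2) :=
  (contDiff_smoothTransition.continuous_deriv (by simp)).comp
    (continuous_const.sub (continuous_norm.pow 2))

/-- The weight `y ↦ deriv Real.smoothTransition (2 - ‖y‖ ^ 2)` carries the gradient of `cutoff`. -/
lemma shellWeight_support {y : R3} (h : deriv Real.smoothTransition (2 - ‖y‖ ^ 2) ≠ 0) :
    1 ≤ ‖y‖ ∧ ‖y‖ ^ 2 ≤ 2 := by
  by_contra hne
  refine h (deriv_smoothTransition_eq_zero ?_)
  rw [not_and_or] at hne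
  rcases hne with h1 | h1
  · exact Or.inr (by nlinarith [norm_nonneg y])
  · exact Or.inl (by linarith)

lemma isClosed_shell : IsClosed {y : R3 | 1 ≤ ‖y‖ ∧ ‖y‖ ^ 2 ≤ 2} :=
  (isClosed_le continuous_const continuous_norm).inter
    (isClosed_le (continuous_norm.pow 2) continuous_const)

lemma tsupport_shellWeight {y : R3}
    (h : y ∈ tsupport fun y : R3 => deriv Real.smoothTransition (2 - ‖y‖ ^ 2)) :
    1 ≤ ‖y‖ ∧ ‖y‖ ^ 2 ≤ 2 :=
  closure_minimal (fun _ hz => shellWeight_support hz) isClosed_shell h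

lemma tsupport_pd_cutoff {l : Fin 3} {y : R3} (h : y ∈ tsupport (pd cutoff l)) :
    1 ≤ ‖y‖ ∧ ‖y‖ ^ 2 ≤ 2 :=
  closure_minimal (fun z (hz : pd cutoff l z ≠ 0) => shellWeight_support (y := z) fun h0 =>
    hz (by rw [pd_cutoff, h0]; ring)) isClosed_shell h

lemma shellBump_eq_one {y : R3} (h : 1 ≤ ‖y‖ ∧ ‖y‖ ^ 2 ≤ 2) : shellBump y = 1 := by
  rw [shellBump, Real.smoothTransition.one_of_one_le (by nlinarith),
    Real.smoothTransition.one_of_one_le (by linarith), one_mul]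

lemma hasCompactSupport_shellWeight :
    HasCompactSupport fun y : R3 => deriv Real.smoothTransition (2 - ‖y‖ ^ 2) :=
  HasCompactSupport.of_support_subset_isCompact (isCompact_closedBall (0 : R3) 2) fun y hy => by
    rw [mem_closedBall_zero_iff]
    have := (shellWeight_support hy).2
    nlinarith [norm_nonneg y]

/-! ### Vanishing of the far field -/

/-- Coercivity on rank one matrices gives a lower bound for the outgoing energy flux density. -/
lemma Coercive.flux_density {m : ℝ} (hco : Coercive c m) (hk₁ : 0 ≤ k₁) (hk₂ : 0 ≤ k₂)
    (hm : 0 < m) (A B : Fin 3 → ℂ) (y : R3) :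
    m * (deriv Real.smoothTransition (2 - ‖y‖ ^ 2) * (k₁ * ∑ i, ‖A i‖ ^ 2 + k₂ * ∑ i, ‖B i‖ ^ 2))
      ≤ -(∑ k, ∑ i, ∑ j, ∑ l, (c i j k l : ℂ) * (((pd cutoff l y : ℝ) : ℂ) *
        (((y j / ‖y‖ : ℝ) : ℂ) *
          (k₁ * ((((‖y‖⁻¹ : ℝ) : ℂ) * A i) * conj (((‖y‖⁻¹ : ℝ) : ℂ) * A k))
            + k₂ * ((((‖y‖⁻¹ : ℝ) : ℂ) * B i) * conj (((‖y‖⁻¹ : ℝ) : ℂ) * B k)))))).re := by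
  set w := deriv Real.smoothTransition (2 - ‖y‖ ^ 2) with hw
  have hw0 : 0 ≤ w := deriv_smoothTransition_nonneg _
  by_cases hwz : w = 0
  · have h0 : ∀ l, pd cutoff l y = 0 := fun l => by rw [pd_cutoff, ← hw, hwz]; ring
    simp [h0, hwz]
  obtain ⟨hy1, hy2⟩ := shellWeight_support (y := y) hwz
  have hy0 : 0 < ‖y‖ := by linarith
  have hA : ∀ A : Fin 3 → ℂ, m * (‖y‖ ^ 2 * ∑ i, ‖A i‖ ^ 2)
      ≤ (∑ k, ∑ i, ∑ j, ∑ l, (c i j k l : ℂ) *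
        (((y j : ℂ) * A i) * conj ((y l : ℂ) * A k))).re := by
    intro A
    refine le_trans (le_of_eq ?_) (hco fun i j => (y j : ℂ) * A i)
    congr 1
    rw [EuclideanSpace.real_norm_sq_eq, Finset.sum_mul_sum, Finset.sum_comm]
    refine Finset.sum_congr rfl fun i _ => Finset.sum_congr rfl fun j _ => ?_
    rw [norm_mul, mul_pow, Complex.norm_real, Real.norm_eq_abs, sq_abs]
  have hyc : ((‖y‖ : ℝ) : ℂ) ≠ 0 := by exact_mod_cast hy0.ne'
  have hexp : ∑ k, ∑ i, ∑ j, ∑ l, (c i j k l : ℂ) * (((pd cutoff l y : ℝ) : ℂ) *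
        (((y j / ‖y‖ : ℝ) : ℂ) *
          (k₁ * ((((‖y‖⁻¹ : ℝ) : ℂ) * A i) * conj (((‖y‖⁻¹ : ℝ) : ℂ) * A k))
            + k₂ * ((((‖y‖⁻¹ : ℝ) : ℂ) * B i) * conj (((‖y‖⁻¹ : ℝ) : ℂ) * B k)))))
      = -(((2 * w / ‖y‖ ^ 3 * k₁ : ℝ) : ℂ) * (∑ k, ∑ i, ∑ j, ∑ l, (c i j k l : ℂ) *
          (((y j : ℂ) * A i) * conj ((y l : ℂ) * A k)))
        + ((2 * w / ‖y‖ ^ 3 * k₂ : ℝ) : ℂ) * (∑ k, ∑ i, ∑ j, ∑ l, (c i j k l : ℂ) *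
          (((y j : ℂ) * B i) * conj ((y l : ℂ) * B k)))) := by
    simp only [Finset.mul_sum, ← Finset.sum_add_distrib, ← Finset.sum_neg_distrib]
    refine Finset.sum_congr rfl fun k _ => Finset.sum_congr rfl fun i _ =>
      Finset.sum_congr rfl fun j _ => Finset.sum_congr rfl fun l _ => ?_
    rw [pd_cutoff, ← hw]
    simp only [map_mul, Complex.conj_ofReal]
    push_cast
    field_simp
  rw [hexp, Complex.neg_re, neg_neg, Complex.add_re, Complex.re_ofReal_mul, Complex.re_ofReal_mul]
  set SA := ∑ i, ‖A i‖ ^ 2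
  set SB := ∑ i, ‖B i‖ ^ 2
  have hSA : 0 ≤ SA := by positivity
  have hSB : 0 ≤ SB := by positivity
  have hyle : 1 ≤ 2 / ‖y‖ := by
    rw [le_div_iff₀ hy0]
    nlinarith
  calc m * (w * (k₁ * SA + k₂ * SB)) = 1 * (m * (w * (k₁ * SA + k₂ * SB))) := (one_mul _).symm
    _ ≤ 2 / ‖y‖ * (m * (w * (k₁ * SA + k₂ * SB))) := by gcongr
    _ = 2 * w / ‖y‖ ^ 3 * k₁ * (m * (‖y‖ ^ 2 * SA))
        + 2 * w / ‖y‖ ^ 3 * k₂ * (m * (‖y‖ ^ 2 * SB)) := by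
        field_simp
    _ ≤ _ := by
        gcongr
        · exact hA A
        · exact hA B

lemma Outgoing.exists_bound_family {f A B : Fin 3 → R3 → ℂ}
    (h : ∀ i, Outgoing k₁ k₂ (f i) (A i) (B i)) {ε : ℝ} (hε : 0 < ε) :
    ∃ ρ : ℝ, 0 < ρ ∧ ∀ i, ∀ x : R3, ρ ≤ ‖x‖ →
      ‖(‖x‖ : ℂ) * f i x - twoWave k₁ k₂ (A i) (B i) 1 x‖ ≤ ε := by
  choose ρ hρ hb using fun i => (h i).exists_bound hε
  refine ⟨∑ i, ρ i, Finset.sum_pos (fun i _ => hρ i) Finset.univ_nonempty, fun i x hx => hb i x ?_⟩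
  exact (Finset.single_le_sum (fun j _ => (hρ j).le) (Finset.mem_univ i)).trans hx

lemma exists_farBound {R₀ : ℝ} (hR₀ : 0 < R₀) (hsub : ∀ x : R3, R₀ < ‖x‖ → x ∈ W)
    {A B : Fin 3 → R3 → ℂ} (h : ∀ i, Outgoing k₁ k₂ (u i) (A i) (B i)) {N : ℝ}
    (hN : ∀ i, ∀ y ≠ 0, ‖A i y‖ ≤ N ∧ ‖B i y‖ ≤ N) :
    ∃ R₁ M : ℝ, FarBound W u R₁ M := by
  obtain ⟨ρ, hρ, hb⟩ := Outgoing.exists_bound_family h one_pos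
  refine ⟨max R₀ ρ, 1 + (N + N), lt_max_of_lt_left hR₀, fun x hx =>
    hsub x ((le_max_left _ _).trans_lt hx), fun i x hx => ?_⟩
  have hx0 : 0 < ‖x‖ := (lt_max_of_lt_left hR₀).trans hx
  have h1 := hb i x ((le_max_right _ _).trans hx.le)
  have h2 := norm_twoWave_le (k₁ := k₁) (k₂ := k₂) (a := A i) (b := B i) 1 x
  obtain ⟨n1, n2⟩ := hN i x (norm_pos_iff.1 hx0)
  have h3 : ‖(‖x‖ : ℂ) * u i x‖ ≤ 1 + (N + N) := by
    have := norm_add_le ((‖x‖ : ℂ) * u i x - twoWave k₁ k₂ (A i) (B i) 1 x)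
      (twoWave k₁ k₂ (A i) (B i) 1 x)
    rw [sub_add_cancel] at this
    linarith
  rw [norm_mul, Complex.norm_real, norm_norm] at h3
  rw [le_div_iff₀ hx0, mul_comm]
  exact h3

/-- On the fixed shell, the rescaled field is eventually close to a superposition of radial waves
with smooth amplitudes. -/
lemma scaled_close {f A B A' B' : R3 → ℂ} (hA : Homog A) (hB : Homog B) {ε ρ : ℝ}
    (hb : ∀ x : R3, ρ ≤ ‖x‖ → ‖(‖x‖ : ℂ) * f x - twoWave k₁ k₂ A B 1 x‖ ≤ ε)
    (hA' : ∀ y ≠ 0, ‖A y - A' y‖ ≤ ε) (hB' : ∀ y ≠ 0, ‖B y - B' y‖ ≤ ε) {R : ℝ} (hR : 0 < R)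
    (hRρ : ρ ≤ R) {y : R3} (hy : 1 ≤ ‖y‖) :
    ‖scaled f R y - twoWave k₁ k₂ (fun z => ((‖z‖⁻¹ : ℝ) : ℂ) * A' z)
      (fun z => ((‖z‖⁻¹ : ℝ) : ℂ) * B' z) R y‖ ≤ 3 * ε := by
  have hy0 : 0 < ‖y‖ := by linarith
  have hyne : y ≠ 0 := norm_pos_iff.1 hy0
  have hnorm : ‖R • y‖ = R * ‖y‖ := by rw [norm_smul, Real.norm_of_nonneg hR.le]
  have h1 := hb (R • y) (by rw [hnorm]; nlinarith)
  rw [twoWave_smul hA hB hR hyne, hnorm] at h1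
  have hyc : ((‖y‖ : ℝ) : ℂ) ≠ 0 := by exact_mod_cast hy0.ne'
  have h2 : (‖y‖ : ℂ) * (scaled f R y - twoWave k₁ k₂ (fun z => ((‖z‖⁻¹ : ℝ) : ℂ) * A' z)
      (fun z => ((‖z‖⁻¹ : ℝ) : ℂ) * B' z) R y)
      = (((R * ‖y‖ : ℝ) : ℂ) * f (R • y) - twoWave k₁ k₂ A B R y)
        + twoWave k₁ k₂ (fun z => A z - A' z) (fun z => B z - B' z) R y := by
    simp only [scaled, twoWave]
    push_cast
    field_simp
    ring
  have h3 := norm_add_le (((R * ‖y‖ : ℝ) : ℂ) * f (R • y) - twoWave k₁ k₂ A B R y)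
    (twoWave k₁ k₂ (fun z => A z - A' z) (fun z => B z - B' z) R y)
  have h4 := norm_twoWave_le (k₁ := k₁) (k₂ := k₂) (a := fun z => A z - A' z)
    (b := fun z => B z - B' z) R y
  rw [← h2, norm_mul, Complex.norm_real, norm_norm] at h3
  have h5 := hA' y hyne
  have h6 := hB' y hyne
  refine le_trans ?_ (h3.trans (by linarith : _ ≤ 3 * ε))
  exact le_mul_of_one_le_left (norm_nonneg _) hy

/-- The amplitudes of a far field satisfy an `O(ε)` bound for their energy, if they are replaced by
smooth amplitudes at distance at most `ε`. The constant does not depend on the approximation. -/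
lemma IsDirichletSolution.energy_le (hW : IsOpen W) {m : ℝ} (hm : 0 < m) (hco : Coercive c m)
    (hsym : ∀ i j k l, c i j k l = c k l i j) (hu : IsDirichletSolution c omega W u)
    {A B : Fin 3 → R3 → ℂ} (hA : ∀ i, Homog (A i)) (hB : ∀ i, Homog (B i))
    (hout : ∀ i, Outgoing k₁ k₂ (u i) (A i) (B i)) (hk₁ : 0 < k₁) (hk₂ : 0 < k₂) (hk : k₁ ≠ k₂)
    {N : ℝ} (hN : ∀ i, ∀ y ≠ 0, ‖A i y‖ ≤ N ∧ ‖B i y‖ ≤ N) {R₁ M : ℝ}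
    (hfar : FarBound W u R₁ M) :
    ∃ C : ℝ, ∀ ε : ℝ, 0 < ε → ε ≤ 1 → ∀ A' B' : Fin 3 → R3 → ℂ,
      (∀ i, ContDiffOn ℝ 1 (A' i) {0}ᶜ) → (∀ i, ContDiffOn ℝ 1 (B' i) {0}ᶜ) →
      (∀ i, ∀ y ≠ 0, ‖A i y - A' i y‖ ≤ ε) → (∀ i, ∀ y ≠ 0, ‖B i y - B' i y‖ ≤ ε) →
      ∫ y : R3, deriv Real.smoothTransition (2 - ‖y‖ ^ 2)
        * (k₁ * ∑ i, ‖A' i y‖ ^ 2 + k₂ * ∑ i, ‖B' i y‖ ^ 2) ≤ ε * C := by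
  have hO : IsOpen ({0}ᶜ : Set R3) := isOpen_compl_singleton
  have hψ : ∀ l, ContDiff ℝ 1 (pd cutoff l) := fun l =>
    (contDiff_pd (m := ∞) contDiff_cutoff (by simp) l).of_le (by simp)
  have hψc : ∀ l, HasCompactSupport (pd cutoff l) := fun l =>
    hasCompactSupport_pd hasCompactSupport_cutoff l
  have hψs : ∀ l, tsupport (pd cutoff l) ⊆ {0}ᶜ := fun l y hy h0 => by
    have := (tsupport_pd_cutoff hy).1
    rw [Set.mem_singleton_iff.1 h0, norm_zero] at this
    linarith
  choose G hG0 hG using fun l => hu.gradient_bound hW hm hco hfar contDiff_shellBump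
    hasCompactSupport_shellBump one_half_pos
    (fun y hy => half_le_norm_of_mem_tsupport_shellBump hy) (hψ l).continuous
    (fun y hy => shellBump_eq_one (tsupport_pd_cutoff hy))
  let S : Fin 3 → ℝ := fun l => ∫ y, |pd cutoff l y|
  let C₂ : ℝ := ∑ k : Fin 3, ∑ i : Fin 3, ∑ j : Fin 3, ∑ l : Fin 3,
    |c i j k l| * (G l + (k₁ + k₂) * (N + 1) * S l)
  refine ⟨3 * C₂ / m, fun ε hε hε1 A' B' hA'c hB'c hA' hB' => ?_⟩
  obtain ⟨ρ, hρ, hb⟩ := Outgoing.exists_bound_family hout hε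
  let a : Fin 3 → R3 → ℂ := fun i z => ((‖z‖⁻¹ : ℝ) : ℂ) * A' i z
  let b : Fin 3 → R3 → ℂ := fun i z => ((‖z‖⁻¹ : ℝ) : ℂ) * B' i z
  have hinv : ContDiffOn ℝ 1 (fun z : R3 => ((‖z‖⁻¹ : ℝ) : ℂ)) {0}ᶜ :=
    Complex.ofRealCLM.contDiff.comp_contDiffOn contDiffOn_inv_norm
  have ha : ∀ i, ContDiffOn ℝ 1 (a i) {0}ᶜ := fun i => hinv.mul (hA'c i)
  have hb' : ∀ i, ContDiffOn ℝ 1 (b i) {0}ᶜ := fun i => hinv.mul (hB'c i)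
  have hbd : ∀ {Z Z' : R3 → ℂ}, (∀ y ≠ 0, ‖Z y‖ ≤ N) → (∀ y ≠ 0, ‖Z y - Z' y‖ ≤ ε) →
      ∀ y : R3, 1 ≤ ‖y‖ → ‖((‖y‖⁻¹ : ℝ) : ℂ) * Z' y‖ ≤ N + 1 := by
    intro Z Z' hZ hZ' y hy
    have hyne : y ≠ 0 := norm_pos_iff.1 (by linarith)
    have h1 : ‖Z' y‖ ≤ N + 1 := by
      have := norm_sub_le (Z y) (Z y - Z' y)
      rw [sub_sub_cancel] at this
      linarith [hZ y hyne, hZ' y hyne]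
    rw [norm_mul, Complex.norm_real, norm_inv, norm_norm]
    exact (mul_le_of_le_one_left (norm_nonneg _) (inv_le_one_of_one_le₀ hy)).trans h1
  -- `X` is the flux of the field at scale `R`, `Y` that of the waves, `Q` the limiting density
  let X : ℝ → Fin 3 → Fin 3 → Fin 3 → Fin 3 → ℂ := fun R i j k l =>
    ∫ y, ((pd cutoff l y : ℝ) : ℂ) * scaled (pd (u i) j) R y * conj (scaled (u k) R y)
  let Y : ℝ → Fin 3 → Fin 3 → Fin 3 → Fin 3 → ℂ := fun R i j k l =>
    (R : ℂ)⁻¹ * ∫ y, ((pd cutoff l y : ℝ) : ℂ) *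
      (pd (twoWave k₁ k₂ (a i) (b i) R) j y * conj (twoWave k₁ k₂ (a k) (b k) R y))
  let Q : Fin 3 → Fin 3 → Fin 3 → Fin 3 → R3 → ℂ := fun i j k l y =>
    ((pd cutoff l y : ℝ) : ℂ) * (((y j / ‖y‖ : ℝ) : ℂ) *
        (k₁ * (a i y * conj (a k y)) + k₂ * (b i y * conj (b k y))))
  let K : Fin 3 → Fin 3 → Fin 3 → ℝ := fun j k l =>
    ∫ y, (|pd (pd cutoff l) j y| * (‖a k y‖ + ‖b k y‖)
      + |pd cutoff l y| * (‖pd (a k) j y‖ + ‖pd (b k) j y‖))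
  have hY : Tendsto (fun R => ∑ k, ∑ i, ∑ j, ∑ l, (c i j k l : ℂ) * Y R i j k l) atTop
      (𝓝 (∑ k, ∑ i, ∑ j, ∑ l, (c i j k l : ℂ) * (Complex.I * ∫ y, Q i j k l y))) :=
    tendsto_finsetSum _ fun k _ => tendsto_finsetSum _ fun i _ => tendsto_finsetSum _ fun j _ =>
      tendsto_finsetSum _ fun l _ => (tendsto_flux_twoWave hk (ha i) (hb' i) (ha k) (hb' k)
        (hψ l) (hψc l) (hψs l) j).const_mul _
  have hXY : ∀ᶠ R : ℝ in atTop, |(∑ k, ∑ i, ∑ j, ∑ l, (c i j k l : ℂ) * Y R i j k l).im|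
      ≤ ∑ k, ∑ i, ∑ j, ∑ l, |c i j k l| * (3 * ε * G l + 3 * ε * ((k₁ + k₂) * (N + 1) * S l)
        + 3 * ε * (R⁻¹ * K j k l)) := by
    filter_upwards [eventually_all.2 hG, eventually_gt_atTop R₁, eventually_ge_atTop ρ]
      with R hGR hRR₁ hRρ
    have hR : 0 < R := hfar.pos.trans hRR₁
    have hU := isOpen_smul_preimage hW R
    have hsU : ∀ y : R3, 1 ≤ ‖y‖ → R • y ∈ W := fun y hy =>
      hfar.subset _ (hfar.smul_mem one_pos (by simpa using hRR₁) hy)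
    have hflux := hu.scaled_flux_eq_zero hW hsym hR contDiff_cutoff hasCompactSupport_cutoff
      (fun y l h => hsU y (tsupport_pd_cutoff (subset_tsupport _ h)).1)
    have hcmp : ∀ i j k l, ‖X R i j k l - Y R i j k l‖ ≤
        3 * ε * G l + 3 * ε * ((k₁ + k₂) * (N + 1) * S l) + 3 * ε * (R⁻¹ * K j k l) := by
      intro i j k l
      have hpW : ContDiffOn ℝ 1 (pd (u i) j) W :=
        (contDiffOn_pd (m := ∞) hW (hu.smooth i) (by simp) j).of_le (by simp)
      have h := flux_compare (j := j) (k₁ := k₁) (k₂ := k₂) (a := a i) (b := b i) (a' := a k)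
        (b' := b k) (ε := 3 * ε) (N := N + 1) hU
        (contDiffOn_scaled ((hu.smooth i).of_le (by simp)) R)
        (contDiffOn_scaled (hu.smooth k) R).continuousOn
        (contDiffOn_scaled hpW R).continuousOn hR
        (fun y hy => pd_scaled (((hu.smooth i).contDiffAt (hW.mem_nhds hy)).differentiableAt
          (by simp)) j)
        (hψ l) (hψc l) (fun y hy => hsU y (tsupport_pd_cutoff hy).1) (hψs l) hk₁.le hk₂.le
        (ha i) (hb' i) (ha k) (hb' k)
        (fun y hy => scaled_close (hA i) (hB i) (hb i) (hA' i) (hB' i) hR hRρ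
          (tsupport_pd_cutoff hy).1)
        (fun y hy => scaled_close (hA k) (hB k) (hb k) (hA' k) (hB' k) hR hRρ
          (tsupport_pd_cutoff hy).1)
        (fun y hy => ⟨hbd (fun y hy => (hN k y hy).1) (hA' k) y (tsupport_pd_cutoff hy).1,
          hbd (fun y hy => (hN k y hy).2) (hB' k) y (tsupport_pd_cutoff hy).1⟩)
      refine h.trans ?_
      gcongr
      exact hGR l i j
    have hdiff : (∑ k, ∑ i, ∑ j, ∑ l, (c i j k l : ℂ) * Y R i j k l).im
        = -(∑ k, ∑ i, ∑ j, ∑ l, (c i j k l : ℂ) * (X R i j k l - Y R i j k l)).im := by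
      have : ∑ k, ∑ i, ∑ j, ∑ l, (c i j k l : ℂ) * (X R i j k l - Y R i j k l)
          = (∑ k, ∑ i, ∑ j, ∑ l, (c i j k l : ℂ) * X R i j k l)
          - ∑ k, ∑ i, ∑ j, ∑ l, (c i j k l : ℂ) * Y R i j k l := by
        simp only [mul_sub, Finset.sum_sub_distrib]
      rw [this, Complex.sub_im, show (∑ k, ∑ i, ∑ j, ∑ l, (c i j k l : ℂ) * X R i j k l).im = 0
        from hflux]
      ring
    rw [hdiff, abs_neg]
    refine (Complex.abs_im_le_norm _).trans ?_
    refine (norm_sum_le _ _).trans (Finset.sum_le_sum fun k _ => ?_)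
    refine (norm_sum_le _ _).trans (Finset.sum_le_sum fun i _ => ?_)
    refine (norm_sum_le _ _).trans (Finset.sum_le_sum fun j _ => ?_)
    refine (norm_sum_le _ _).trans (Finset.sum_le_sum fun l _ => ?_)
    rw [norm_mul, Complex.norm_real, Real.norm_eq_abs]
    exact mul_le_mul_of_nonneg_left (hcmp i j k l) (abs_nonneg _)
  have hlim : Tendsto (fun R : ℝ => ∑ k, ∑ i, ∑ j, ∑ l, |c i j k l| *
      (3 * ε * G l + 3 * ε * ((k₁ + k₂) * (N + 1) * S l) + 3 * ε * (R⁻¹ * K j k l))) atTop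
      (𝓝 (∑ k : Fin 3, ∑ i : Fin 3, ∑ j : Fin 3, ∑ l : Fin 3, |c i j k l| *
      (3 * ε * G l + 3 * ε * ((k₁ + k₂) * (N + 1) * S l) + 3 * ε * (0 * K j k l)))) :=
    tendsto_finsetSum _ fun k _ => tendsto_finsetSum _ fun i _ => tendsto_finsetSum _ fun j _ =>
      tendsto_finsetSum _ fun l _ => (tendsto_const_nhds.add
        ((tendsto_inv_atTop_zero.mul_const _).const_mul _)).const_mul _
  have hbound := le_of_tendsto_of_tendsto
    ((continuous_abs.tendsto _).comp ((Complex.continuous_im.tendsto _).comp hY)) hlim hXY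
  have hC₂ : ∑ k : Fin 3, ∑ i : Fin 3, ∑ j : Fin 3, ∑ l : Fin 3, |c i j k l| *
      (3 * ε * G l + 3 * ε * ((k₁ + k₂) * (N + 1) * S l) + 3 * ε * (0 * K j k l))
      = ε * (3 * C₂) := by
    simp only [C₂, Finset.mul_sum]
    refine Finset.sum_congr rfl fun k _ => Finset.sum_congr rfl fun i _ =>
      Finset.sum_congr rfl fun j _ => Finset.sum_congr rfl fun l _ => ?_
    ring
  rw [hC₂] at hbound
  have hQi : ∀ i j k l, Integrable (fun y => (c i j k l : ℂ) * Q i j k l y) := fun i j k l => by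
    have hconj : ∀ {f : R3 → ℂ}, ContDiffOn ℝ 1 f {0}ᶜ →
        ContinuousOn (fun y => conj (f y)) {0}ᶜ := fun hf =>
      Complex.continuous_conj.comp_continuousOn hf.continuousOn
    exact (integrable_ofReal_mul hO (hψ l).continuous (hψc l) (hψs l)
      ((contDiffOn_dir (n := 0) j).continuousOn.mul
        ((continuousOn_const.mul ((ha i).continuousOn.mul (hconj (ha k)))).add
          (continuousOn_const.mul ((hb' i).continuousOn.mul (hconj (hb' k))))))).const_mul _
  have hQint : ∑ k, ∑ i, ∑ j, ∑ l, (c i j k l : ℂ) * (Complex.I * ∫ y, Q i j k l y)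
      = Complex.I * ∫ y, ∑ k, ∑ i, ∑ j, ∑ l, (c i j k l : ℂ) * Q i j k l y := by
    rw [integral_finsetSum _ fun k _ => integrable_finsetSum _ fun i _ =>
      integrable_finsetSum _ fun j _ => integrable_finsetSum _ fun l _ => hQi i j k l,
      Finset.mul_sum]
    refine Finset.sum_congr rfl fun k _ => ?_
    rw [integral_finsetSum _ fun i _ => integrable_finsetSum _ fun j _ =>
      integrable_finsetSum _ fun l _ => hQi i j k l, Finset.mul_sum]
    refine Finset.sum_congr rfl fun i _ => ?_
    rw [integral_finsetSum _ fun j _ => integrable_finsetSum _ fun l _ => hQi i j k l,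
      Finset.mul_sum]
    refine Finset.sum_congr rfl fun j _ => ?_
    rw [integral_finsetSum _ fun l _ => hQi i j k l, Finset.mul_sum]
    refine Finset.sum_congr rfl fun l _ => ?_
    rw [integral_const_mul]
    ring
  have hQs : Integrable (fun y => ∑ k, ∑ i, ∑ j, ∑ l, (c i j k l : ℂ) * Q i j k l y) :=
    integrable_finsetSum _ fun k _ => integrable_finsetSum _ fun i _ =>
      integrable_finsetSum _ fun j _ => integrable_finsetSum _ fun l _ => hQi i j k l
  have hQre : Integrable (fun y => (∑ k, ∑ i, ∑ j, ∑ l, (c i j k l : ℂ) * Q i j k l y).re) :=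
    hQs.re
  have hre := integral_re hQs
  simp only [RCLike.re_eq_complex_re] at hre
  have hfin : -(∫ y, (∑ k, ∑ i, ∑ j, ∑ l, (c i j k l : ℂ) * Q i j k l y).re) ≤ ε * (3 * C₂) := by
    refine le_trans ?_ hbound
    rw [hQint, Complex.I_mul_im, hre]
    exact neg_le_abs _
  -- the limiting density is bounded below by the energy of the amplitudes
  have hws : tsupport (fun y : R3 => deriv Real.smoothTransition (2 - ‖y‖ ^ 2)) ⊆ {0}ᶜ := by
    intro y hy h0
    have := (tsupport_shellWeight hy).1
    rw [Set.mem_singleton_iff.1 h0, norm_zero] at this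
    linarith
  have hle : m * ∫ y : R3, deriv Real.smoothTransition (2 - ‖y‖ ^ 2)
      * (k₁ * ∑ i, ‖A' i y‖ ^ 2 + k₂ * ∑ i, ‖B' i y‖ ^ 2) ≤ ε * (3 * C₂) := by
    refine le_trans ?_ hfin
    rw [← integral_const_mul, ← integral_neg]
    refine integral_mono ?_ hQre.neg fun y =>
      hco.flux_density hk₁.le hk₂.le hm (fun i => A' i y) (fun i => B' i y) y
    have hi : ∀ {Z : R3 → ℂ}, ContDiffOn ℝ 1 Z {0}ᶜ → Integrable fun y : R3 =>
        deriv Real.smoothTransition (2 - ‖y‖ ^ 2) * ‖Z y‖ ^ 2 := fun hZ =>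
      integrable_cutoff_mul_norm_sq hO continuous_shellWeight hasCompactSupport_shellWeight hws
        hZ.continuousOn
    refine Integrable.const_mul ?_ m
    refine (((integrable_finsetSum Finset.univ fun i _ => hi (hA'c i)).const_mul k₁).add
      ((integrable_finsetSum Finset.univ fun i _ => hi (hB'c i)).const_mul k₂)).congr
      (Eventually.of_forall fun y => ?_)
    simp only [Pi.add_apply, ← Finset.mul_sum]
    ring
  rw [mul_div_assoc', le_div_iff₀ hm, mul_comm]
  exact hle

/-- A solution in an exterior domain with vanishing Dirichlet data which is outgoing at infinity
has no far field: all the energy it radiates would have to be produced at the boundary. -/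
theorem IsDirichletSolution.amplitude_eq_zero (hW : IsOpen W) {m : ℝ} (hm : 0 < m)
    (hco : Coercive c m) (hsym : ∀ i j k l, c i j k l = c k l i j)
    (hu : IsDirichletSolution c omega W u) {R₀ : ℝ} (hR₀ : 0 < R₀)
    (hsub : ∀ x : R3, R₀ < ‖x‖ → x ∈ W)
    {A B : Fin 3 → R3 → ℂ} (hA : ∀ i, Homog (A i)) (hB : ∀ i, Homog (B i))
    (hout : ∀ i, Outgoing k₁ k₂ (u i) (A i) (B i)) (hk₁ : 0 < k₁) (hk₂ : 0 < k₂) (hk : k₁ ≠ k₂)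
    (i : Fin 3) (x : R3) (hx : x ≠ 0) : A i x = 0 ∧ B i x = 0 := by
  have hfs : ∀ i, ContDiffOn ℝ 1 (u i) {x | R₀ < ‖x‖} := fun i =>
    ((hu.smooth i).of_le (by simp)).mono hsub
  have hAc : ∀ i, ContinuousOn (A i) {0}ᶜ := fun i =>
    (hout i).continuousOn (hA i) (hB i) hk (hfs i)
  have hBc : ∀ i, ContinuousOn (B i) {0}ᶜ := fun i =>
    (hout i).swap.continuousOn (hB i) (hA i) hk.symm (hfs i)
  choose NA hNA0 hNA using fun i => (hA i).exists_bound (hAc i)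
  choose NB hNB0 hNB using fun i => (hB i).exists_bound (hBc i)
  have hN : ∀ i, ∀ y ≠ 0, ‖A i y‖ ≤ ∑ j, (NA j + NB j) ∧ ‖B i y‖ ≤ ∑ j, (NA j + NB j) := by
    intro i y hy
    have h := Finset.single_le_sum (f := fun j => NA j + NB j)
      (fun j _ => add_nonneg (hNA0 j) (hNB0 j)) (Finset.mem_univ i)
    have h1 := hNA i y hy
    have h2 := hNB i y hy
    have h3 := hNA0 i
    have h4 := hNB0 i
    constructor <;> linarith
  obtain ⟨R₁, M, hfar⟩ := exists_farBound hR₀ hsub hout hN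
  obtain ⟨C, hC⟩ := hu.energy_le hW hm hco hsym hA hB hout hk₁ hk₂ hk hN hfar
  let w : R3 → ℝ := fun y => deriv Real.smoothTransition (2 - ‖y‖ ^ 2)
  have hw0 : ∀ y, 0 ≤ w y := fun y => deriv_smoothTransition_nonneg _
  have hws : tsupport w ⊆ {0}ᶜ := by
    intro y hy h0
    have := (tsupport_shellWeight hy).1
    rw [Set.mem_singleton_iff.1 h0, norm_zero] at this
    linarith
  have hwi : Integrable w :=
    continuous_shellWeight.integrable_of_hasCompactSupport hasCompactSupport_shellWeight
  have hi : ∀ {Z Z' : Fin 3 → R3 → ℂ}, (∀ i, ContinuousOn (Z i) {0}ᶜ) →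
      (∀ i, ContinuousOn (Z' i) {0}ᶜ) → Integrable fun y : R3 =>
        w y * (k₁ * ∑ i, ‖Z i y‖ ^ 2 + k₂ * ∑ i, ‖Z' i y‖ ^ 2) := by
    intro Z Z' hZ hZ'
    have hi' : ∀ {F : R3 → ℂ}, ContinuousOn F {0}ᶜ → Integrable fun y : R3 =>
        w y * ‖F y‖ ^ 2 := fun hF =>
      integrable_cutoff_mul_norm_sq isOpen_compl_singleton continuous_shellWeight
        hasCompactSupport_shellWeight hws hF
    refine (((integrable_finsetSum Finset.univ fun i _ => hi' (hZ i)).const_mul k₁).add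
      ((integrable_finsetSum Finset.univ fun i _ => hi' (hZ' i)).const_mul k₂)).congr
      (Eventually.of_forall fun y => ?_)
    simp only [Pi.add_apply, ← Finset.mul_sum]
    ring
  -- the energy density of the exact amplitudes has integral zero: approximate them, let `ε → 0`
  let Φ : R3 → ℝ := fun y => w y * (k₁ * ∑ i, ‖A i y‖ ^ 2 + k₂ * ∑ i, ‖B i y‖ ^ 2)
  have hΦ0 : ∀ y, 0 ≤ Φ y := fun y => mul_nonneg (hw0 y) (by positivity)
  have hbound : ∀ ε : ℝ, 0 < ε → ε ≤ 1 →
      ∫ y, Φ y ≤ ε * (2 * C + 6 * (k₁ + k₂) * ∫ y, w y) := by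
    intro ε hε hε1
    choose A' hA'c hA' using fun i =>
      (hout i).exists_smooth_approx (hA i) (hB i) hk (hfs i) hε
    choose B' hB'c hB' using fun i =>
      (hout i).swap.exists_smooth_approx (hB i) (hA i) hk.symm (hfs i) hε
    have h := hC ε hε hε1 A' B' hA'c hB'c hA' hB'
    have hsq : ∀ {z z' : ℂ}, ‖z - z'‖ ≤ ε → ‖z‖ ^ 2 ≤ 2 * ‖z'‖ ^ 2 + 2 * ε := by
      intro z z' hz
      have h1 : ‖z‖ ≤ ‖z'‖ + ε := by
        have := norm_add_le z' (z - z')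
        rw [add_sub_cancel] at this
        linarith
      nlinarith [norm_nonneg z, norm_nonneg z', sq_nonneg (‖z'‖ - ε)]
    calc ∫ y, Φ y ≤ ∫ y, (2 * (w y * (k₁ * ∑ i, ‖A' i y‖ ^ 2 + k₂ * ∑ i, ‖B' i y‖ ^ 2))
          + ε * (6 * (k₁ + k₂)) * w y) := by
          refine integral_mono (hi hAc hBc) (((hi (fun i => (hA'c i).continuousOn)
            fun i => (hB'c i).continuousOn).const_mul 2).add (hwi.const_mul _)) fun y => ?_
          by_cases hy : y = 0
          · have : w y = 0 := image_eq_zero_of_notMem_tsupport fun h => hws h hy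
            simp [Φ, this]
          · have hsA : ∑ i, ‖A i y‖ ^ 2 ≤ 2 * ∑ i, ‖A' i y‖ ^ 2 + 6 * ε := by
              refine (Finset.sum_le_sum fun i _ => hsq (hA' i y hy)).trans (le_of_eq ?_)
              rw [Finset.sum_add_distrib, ← Finset.mul_sum]
              simp
              ring
            have hsB : ∑ i, ‖B i y‖ ^ 2 ≤ 2 * ∑ i, ‖B' i y‖ ^ 2 + 6 * ε := by
              refine (Finset.sum_le_sum fun i _ => hsq (hB' i y hy)).trans (le_of_eq ?_)
              rw [Finset.sum_add_distrib, ← Finset.mul_sum]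
              simp
              ring
            have hw := hw0 y
            calc Φ y ≤ w y * (k₁ * (2 * ∑ i, ‖A' i y‖ ^ 2 + 6 * ε)
                  + k₂ * (2 * ∑ i, ‖B' i y‖ ^ 2 + 6 * ε)) := by
                  simp only [Φ]
                  gcongr
              _ = _ := by ring
      _ = 2 * (∫ y, w y * (k₁ * ∑ i, ‖A' i y‖ ^ 2 + k₂ * ∑ i, ‖B' i y‖ ^ 2))
          + ε * (6 * (k₁ + k₂)) * ∫ y, w y := by
          rw [integral_add ((hi (fun i => (hA'c i).continuousOn)
            fun i => (hB'c i).continuousOn).const_mul 2) (hwi.const_mul _), integral_const_mul,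
            integral_const_mul]
      _ ≤ 2 * (ε * C) + ε * (6 * (k₁ + k₂)) * ∫ y, w y := by gcongr
      _ = _ := by ring
  have hle : ∫ y, Φ y ≤ 0 := by
    have ht : Tendsto (fun ε : ℝ => ε * (2 * C + 6 * (k₁ + k₂) * ∫ y, w y)) (𝓝[>] 0) (𝓝 0) := by
      have : Tendsto (fun ε : ℝ => ε * (2 * C + 6 * (k₁ + k₂) * ∫ y, w y)) (𝓝 0)
          (𝓝 (0 * (2 * C + 6 * (k₁ + k₂) * ∫ y, w y))) := tendsto_id.mul_const _
      rw [zero_mul] at this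
      exact this.mono_left nhdsWithin_le_nhds
    refine ge_of_tendsto ht ?_
    filter_upwards [Ioc_mem_nhdsGT (zero_lt_one (α := ℝ))] with ε hε using hbound ε hε.1 hε.2
  have hzero : Φ =ᵐ[volume] 0 := by
    rw [← integral_eq_zero_iff_of_nonneg hΦ0 (hi hAc hBc)]
    exact le_antisymm hle (integral_nonneg hΦ0)
  have hΦc : ContinuousOn Φ {0}ᶜ := by
    refine continuous_shellWeight.continuousOn.mul (ContinuousOn.add ?_ ?_)
    · exact continuousOn_const.mul (continuousOn_finsetSum _ fun i _ => (hAc i).norm.pow 2)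
    · exact continuousOn_const.mul (continuousOn_finsetSum _ fun i _ => (hBc i).norm.pow 2)
  have hΦz : Set.EqOn Φ 0 ({0}ᶜ : Set R3) :=
    Measure.eqOn_open_of_ae_eq (ae_restrict_of_ae hzero) isOpen_compl_singleton hΦc
      continuousOn_const
  -- evaluate at the radius where the weight is positive
  obtain ⟨t, ht, htd⟩ := exists_deriv_smoothTransition_eq_one
  have hx0 : 0 < ‖x‖ := norm_pos_iff.2 hx
  have hs : 0 < √(2 - t) * ‖x‖⁻¹ := mul_pos (Real.sqrt_pos.2 (by linarith [ht.2])) (by positivity)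
  have hn : ‖(√(2 - t) * ‖x‖⁻¹) • x‖ = √(2 - t) :=
    norm_dir_smul (Real.sqrt_pos.2 (by linarith [ht.2])) hx
  have h0 := hΦz (show (√(2 - t) * ‖x‖⁻¹) • x ∈ ({0}ᶜ : Set R3) from
    smul_ne_zero hs.ne' hx)
  simp only [Φ, w, hn, Real.sq_sqrt (by linarith [ht.2] : (0 : ℝ) ≤ 2 - t), sub_sub_cancel, htd,
    one_mul, Pi.zero_apply, hA _ _ hs x hx, hB _ _ hs x hx] at h0
  have hSA : 0 ≤ ∑ i, ‖A i x‖ ^ 2 := by positivity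
  have hSB : 0 ≤ ∑ i, ‖B i x‖ ^ 2 := by positivity
  have hA0 : ∑ i, ‖A i x‖ ^ 2 = 0 := by nlinarith [mul_nonneg hk₁.le hSA, mul_nonneg hk₂.le hSB]
  have hB0 : ∑ i, ‖B i x‖ ^ 2 = 0 := by nlinarith [mul_nonneg hk₁.le hSA, mul_nonneg hk₂.le hSB]
  rw [Finset.sum_eq_zero_iff_of_nonneg fun i _ => by positivity] at hA0 hB0
  exact ⟨by simpa using hA0 i (Finset.mem_univ i), by simpa using hB0 i (Finset.mem_univ i)⟩

/-! ### Translating the asymptotics -/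

lemma tendsto_inv_norm_cobounded : Tendsto (fun x : R3 => ‖x‖⁻¹) (Bornology.cobounded R3) (𝓝 0) :=
  tendsto_inv_atTop_zero.comp tendsto_norm_cobounded_atTop

lemma tendsto_add_const_cobounded (a : R3) :
    Tendsto (fun x : R3 => x + a) (Bornology.cobounded R3) (Bornology.cobounded R3) := by
  rw [← tendsto_norm_atTop_iff_cobounded]
  refine tendsto_atTop_mono (f := fun x : R3 => ‖x‖ - ‖a‖) (fun x => ?_)
    (tendsto_atTop_add_const_right _ _ tendsto_norm_cobounded_atTop)
  have := norm_sub_le (x + a) a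
  rw [add_sub_cancel_right] at this
  linarith

/-- `|x + a| = |x| + x̂ · a + O(1/|x|)`. -/
lemma tendsto_norm_add_sub (a : R3) :
    Tendsto (fun x : R3 => ‖x + a‖ - (‖x‖ + inner ℝ (‖x‖⁻¹ • x) a)) (Bornology.cobounded R3)
      (𝓝 0) := by
  have hlim : Tendsto (fun x : R3 => ‖a‖ ^ 2 / 2 * ‖x‖⁻¹) (Bornology.cobounded R3) (𝓝 0) := by
    simpa using tendsto_inv_norm_cobounded.const_mul (‖a‖ ^ 2 / 2)
  refine squeeze_zero_norm' ?_ hlim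
  have hpos : ∀ᶠ x : R3 in Bornology.cobounded R3, 0 < ‖x‖ :=
    tendsto_norm_cobounded_atTop.eventually (eventually_gt_atTop 0)
  filter_upwards [hpos] with x hx
  have h1 := norm_add_sq_real x a
  have h2 : |‖x + a‖ - ‖x‖| ≤ ‖a‖ := by simpa using abs_norm_sub_norm_le (x + a) x
  have h3 : (‖x + a‖ - ‖x‖) ^ 2 ≤ ‖a‖ ^ 2 := by
    rw [← sq_abs (‖x + a‖ - ‖x‖)]
    gcongr
  have h4 : ‖x + a‖ - (‖x‖ + inner ℝ (‖x‖⁻¹ • x) a)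
      = (‖a‖ ^ 2 - (‖x + a‖ - ‖x‖) ^ 2) / 2 * ‖x‖⁻¹ := by
    rw [inner_smul_left]
    simp only [conj_trivial]
    field_simp
    nlinarith
  rw [h4, norm_mul, norm_inv, norm_norm, Real.norm_of_nonneg (by linarith)]
  gcongr
  linarith [sq_nonneg (‖x + a‖ - ‖x‖)]

/-- The directions of `x + a` and `x` approach each other, and a continuous homogeneous function is
uniformly continuous on shells. -/
lemma Homog.tendsto_add_sub {A : R3 → ℂ} (hA : Homog A) (hc : ContinuousOn A {0}ᶜ) (a : R3) :
    Tendsto (fun x : R3 => A (x + a) - A x) (Bornology.cobounded R3) (𝓝 0) := by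
  let K : Set R3 := {z | 1 / 2 ≤ ‖z‖} ∩ Metric.closedBall 0 2
  have hK : IsCompact K := (isCompact_closedBall _ _).inter_left
    (isClosed_le continuous_const continuous_norm)
  have hKs : K ⊆ {0}ᶜ := fun z hz h0 => by
    have : (1 : ℝ) / 2 ≤ ‖z‖ := hz.1
    rw [Set.mem_singleton_iff.1 h0, norm_zero] at this
    norm_num at this
  have huc := Metric.uniformContinuousOn_iff.1
    (hK.uniformContinuousOn_of_continuous (hc.mono hKs))
  rw [Metric.tendsto_nhds]
  intro ε hε
  obtain ⟨δ, hδ, h⟩ := huc ε hε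
  have hsmall : ∀ᶠ x : R3 in Bornology.cobounded R3, ‖x‖⁻¹ * ‖a‖ < min δ (1 / 2) := by
    have : Tendsto (fun x : R3 => ‖x‖⁻¹ * ‖a‖) (Bornology.cobounded R3) (𝓝 0) := by
      simpa using tendsto_inv_norm_cobounded.mul_const ‖a‖
    exact this.eventually (gt_mem_nhds (lt_min hδ (by norm_num)))
  have hpos : ∀ᶠ x : R3 in Bornology.cobounded R3, 0 < ‖x‖ :=
    tendsto_norm_cobounded_atTop.eventually (eventually_gt_atTop 0)
  filter_upwards [hsmall, hpos] with x hx hx0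
  have hinv : 0 < ‖x‖⁻¹ := by positivity
  have hn : ‖‖x‖⁻¹ • x‖ = 1 := by
    rw [norm_smul, norm_inv, norm_norm, inv_mul_cancel₀ hx0.ne']
  have hna : ‖‖x‖⁻¹ • a‖ < min δ (1 / 2) := by
    rwa [norm_smul, norm_inv, norm_norm]
  have h1 : ‖‖x‖⁻¹ • a‖ < δ := hna.trans_le (min_le_left _ _)
  have h2 : ‖‖x‖⁻¹ • a‖ < 1 / 2 := hna.trans_le (min_le_right _ _)
  have hlow : 1 / 2 ≤ ‖‖x‖⁻¹ • (x + a)‖ := by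
    have := norm_sub_le (‖x‖⁻¹ • (x + a)) (‖x‖⁻¹ • a)
    rw [← smul_sub, add_sub_cancel_right, hn] at this
    linarith
  have hup : ‖‖x‖⁻¹ • (x + a)‖ ≤ 2 := by
    rw [smul_add]
    exact (norm_add_le _ _).trans (by linarith)
  have hxa : x + a ≠ 0 := by
    intro h0
    rw [h0, smul_zero, norm_zero] at hlow
    norm_num at hlow
  rw [← hA _ hinv _ hxa, ← hA _ hinv x (norm_pos_iff.1 hx0), dist_zero_right, ← dist_eq_norm]
  refine h _ ⟨hlow, by simpa using hup⟩ _ ⟨?_, ?_⟩ ?_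
  · change 1 / 2 ≤ ‖‖x‖⁻¹ • x‖
    rw [hn]; norm_num
  · rw [mem_closedBall_zero_iff, hn]; norm_num
  · rwa [dist_eq_norm, smul_add, add_sub_cancel_left]

lemma tendsto_phase_mul_translate {A : R3 → ℂ} (hA : Homog A) (hc : ContinuousOn A {0}ᶜ) (k : ℝ)
    (a : R3) :
    Tendsto (fun x : R3 => phase (k * ‖x + a‖) * A (x + a)
      - phase (k * ‖x‖) * (phase (k * inner ℝ (‖x‖⁻¹ • x) a) * A x)) (Bornology.cobounded R3)
      (𝓝 0) := by
  obtain ⟨N, hN0, hN⟩ := hA.exists_bound hc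
  have h1 : Tendsto (fun x : R3 => phase (k * (‖x + a‖ - (‖x‖ + inner ℝ (‖x‖⁻¹ • x) a))) - 1)
      (Bornology.cobounded R3) (𝓝 0) := by
    have := ((continuous_phase.tendsto (k * 0)).comp
      ((tendsto_norm_add_sub a).const_mul k)).sub_const 1
    simpa [phase] using this
  have hlim := ((tendsto_zero_iff_norm_tendsto_zero.1 h1).mul_const N).add
    (tendsto_zero_iff_norm_tendsto_zero.1 (hA.tendsto_add_sub hc a))
  rw [zero_mul, add_zero] at hlim
  refine squeeze_zero_norm' ?_ hlim
  have hpos : ∀ᶠ x : R3 in Bornology.cobounded R3, 0 < ‖x + a‖ :=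
    (tendsto_norm_cobounded_atTop.comp (tendsto_add_const_cobounded a)).eventually
      (eventually_gt_atTop 0)
  filter_upwards [hpos] with x hx
  set s := ‖x + a‖ - (‖x‖ + inner ℝ (‖x‖⁻¹ • x) a) with hs
  have e1 : phase (k * ‖x + a‖) = phase (k * ‖x‖) * phase (k * inner ℝ (‖x‖⁻¹ • x) a)
      * phase (k * s) := by
    rw [← phase_add, ← phase_add, hs]
    ring_nf
  have e2 : phase (k * ‖x + a‖) * A (x + a)
      - phase (k * ‖x‖) * (phase (k * inner ℝ (‖x‖⁻¹ • x) a) * A x)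
      = phase (k * ‖x‖) * phase (k * inner ℝ (‖x‖⁻¹ • x) a) *
        ((phase (k * s) - 1) * A (x + a) + (A (x + a) - A x)) := by
    rw [e1]; ring
  rw [e2, norm_mul, norm_mul, norm_phase, norm_phase, one_mul, one_mul]
  refine (norm_add_le _ _).trans ?_
  rw [norm_mul]
  gcongr
  exact hN _ (norm_pos_iff.1 hx)

/-- Outgoing asymptotics of a translate: the phase shift `e^{i k x̂·a}` comes from
`|x + a| = |x| + x̂·a + o(1)`. -/
lemma Outgoing.comp_add {f A B : R3 → ℂ} (h : Outgoing k₁ k₂ f A B) (hA : Homog A) (hB : Homog B)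
    (hAc : ContinuousOn A {0}ᶜ) (hBc : ContinuousOn B {0}ᶜ) (a : R3) :
    Outgoing k₁ k₂ (fun x => f (x + a))
      (fun x => phase (k₁ * inner ℝ (‖x‖⁻¹ • x) a) * A x)
      (fun x => phase (k₂ * inner ℝ (‖x‖⁻¹ • x) a) * B x) := by
  obtain ⟨NA, hNA0, hNA⟩ := hA.exists_bound hAc
  obtain ⟨NB, hNB0, hNB⟩ := hB.exists_bound hBc
  have hT := tendsto_add_const_cobounded a
  have hE := tendsto_zero_iff_norm_tendsto_zero.1 (h.comp hT)
  have hinv : Tendsto (fun x : R3 => ‖a‖ * ‖x + a‖⁻¹) (Bornology.cobounded R3) (𝓝 0) := by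
    simpa using (tendsto_inv_norm_cobounded.comp hT).const_mul ‖a‖
  have hPA := tendsto_zero_iff_norm_tendsto_zero.1 (tendsto_phase_mul_translate hA hAc k₁ a)
  have hPB := tendsto_zero_iff_norm_tendsto_zero.1 (tendsto_phase_mul_translate hB hBc k₂ a)
  have hlim := (hE.add (hinv.mul (hE.add_const (NA + NB)))).add (hPA.add hPB)
  simp only [zero_mul, add_zero] at hlim
  refine squeeze_zero_norm' ?_ hlim
  have hpos : ∀ᶠ x : R3 in Bornology.cobounded R3, 0 < ‖x + a‖ :=
    (tendsto_norm_cobounded_atTop.comp hT).eventually (eventually_gt_atTop 0)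
  filter_upwards [hpos] with x hx
  have hxa : x + a ≠ 0 := norm_pos_iff.1 hx
  have hxc : ((‖x + a‖ : ℝ) : ℂ) ≠ 0 := by exact_mod_cast hx.ne'
  simp only [Function.comp]
  set E := (‖x + a‖ : ℂ) * f (x + a) - twoWave k₁ k₂ A B 1 (x + a) with hEdef
  set T := twoWave k₁ k₂ A B 1 (x + a) with hTdef
  set r : ℝ := (‖x‖ - ‖x + a‖) * ‖x + a‖⁻¹ with hr
  have hTn : ‖T‖ ≤ NA + NB :=
    (norm_twoWave_le 1 (x + a)).trans (add_le_add (hNA _ hxa) (hNB _ hxa))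
  have hrn : ‖(r : ℂ)‖ ≤ ‖a‖ * ‖x + a‖⁻¹ := by
    rw [Complex.norm_real, hr, norm_mul, norm_inv, norm_norm]
    gcongr
    have := abs_norm_sub_norm_le x (x + a)
    simpa using this
  have key : (‖x‖ : ℂ) * f (x + a) - twoWave k₁ k₂
      (fun x => phase (k₁ * inner ℝ (‖x‖⁻¹ • x) a) * A x)
      (fun x => phase (k₂ * inner ℝ (‖x‖⁻¹ • x) a) * B x) 1 x
      = E + (r : ℂ) * (E + T)
        + ((phase (k₁ * ‖x + a‖) * A (x + a)
          - phase (k₁ * ‖x‖) * (phase (k₁ * inner ℝ (‖x‖⁻¹ • x) a) * A x))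
        + (phase (k₂ * ‖x + a‖) * B (x + a)
          - phase (k₂ * ‖x‖) * (phase (k₂ * inner ℝ (‖x‖⁻¹ • x) a) * B x))) := by
    simp only [hEdef, hTdef, hr, twoWave, mul_one]
    push_cast
    field_simp
    ring
  rw [key]
  refine (norm_add_le _ _).trans (add_le_add ?_ (norm_add_le _ _))
  refine (norm_add_le _ _).trans (add_le_add le_rfl ?_)
  rw [norm_mul]
  exact mul_le_mul hrn ((norm_add_le _ _).trans (add_le_add le_rfl hTn)) (norm_nonneg _)
    (by positivity)

/-! ### Translates and linear combinations of solutions -/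

lemma measurePreserving_add_right (a : R3) (W : Set R3) :
    MeasurePreserving (fun x : R3 => x + a) (volume.restrict ((fun x : R3 => x + a) ⁻¹' W))
      (volume.restrict W) :=
  (MeasureTheory.measurePreserving_add_right volume a).restrict_preimage_emb
    (measurableEmbedding_addRight a) W

lemma eLpNorm_comp_add (a : R3) (W : Set R3) (f : R3 → ℂ) :
    eLpNorm (fun x => f (x + a)) 2 (volume.restrict ((fun x : R3 => x + a) ⁻¹' W))
      = eLpNorm f 2 (volume.restrict W) := by
  rw [← (measurePreserving_add_right a W).map_eq,
    (measurableEmbedding_addRight a).eLpNorm_map_measure]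
  rfl

lemma LocL2.comp_add {f : R3 → ℂ} (hf : LocL2 W f) (a : R3) :
    LocL2 ((fun x : R3 => x + a) ⁻¹' W) (fun x => f (x + a)) := by
  intro R
  have h := (hf (R + ‖a‖)).comp_measurePreserving
    (measurePreserving_add_right a (W ∩ Metric.ball 0 (R + ‖a‖)))
  refine h.mono_measure (Measure.restrict_mono_set volume fun x hx => ?_)
  have h1 : ‖x‖ < R := by simpa using hx.2
  refine ⟨hx.1, ?_⟩
  rw [mem_ball_zero_iff]
  exact (norm_add_le x a).trans_lt (by linarith)

lemma MemScalarH10.comp_add {f : R3 → ℂ} (hf : MemScalarH10 W f) (a : R3) :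
    MemScalarH10 ((fun x : R3 => x + a) ⁻¹' W) (fun x => f (x + a)) := by
  obtain ⟨φ, hφ, h0, h1⟩ := hf
  refine ⟨fun n x => φ n (x + a), fun n => ⟨(hφ n).1.comp (contDiff_id.add contDiff_const),
    (hφ n).2.1.comp_homeomorph (Homeomorph.addRight a), ?_⟩, ?_, fun j => ?_⟩
  · exact (tsupport_comp_subset_preimage (φ n) (f := fun x : R3 => x + a) (by fun_prop)).trans
      (Set.preimage_mono (hφ n).2.2)
  · exact h0.congr fun n => (eLpNorm_comp_add a W (fun x => φ n x - f x)).symm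
  · refine (h1 j).congr fun n => ?_
    rw [← eLpNorm_comp_add a W]
    simp only [pd_comp_add]

lemma IsDirichletSolution.comp_add (hu : IsDirichletSolution c omega W u) (a : R3) :
    IsDirichletSolution c omega ((fun x : R3 => x + a) ⁻¹' W) (fun i x => u i (x + a)) where
  smooth i := (hu.smooth i).comp (contDiff_id.add contDiff_const).contDiffOn fun _ h => h
  eq k x hx := by
    have h : ∀ i j, pd (fun y => u i (y + a)) j = fun y => pd (u i) j (y + a) := fun i j => by
      ext y; exact pd_comp_add _ _ _ _
    simp only [h, pd_comp_add]
    exact hu.eq k _ hx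
  locL2 i := (hu.locL2 i).comp_add a
  locL2_pd i j := by
    have h : pd (fun y => u i (y + a)) j = fun y => pd (u i) j (y + a) := by
      ext y; exact pd_comp_add _ _ _ _
    rw [h]
    exact (hu.locL2_pd i j).comp_add a
  dirichlet i χ hχ hc := by
    have h := (hu.dirichlet i (fun x => χ (x - a)) (hχ.comp (contDiff_id.sub contDiff_const))
      (hc.comp_homeomorph (Homeomorph.subRight a))).comp_add a
    simpa using h

lemma MemScalarH10.sub_const_mul (hW : IsOpen W) {f g : R3 → ℂ} (hf : MemScalarH10 W f)
    (hg : MemScalarH10 W g) (hfs : ContDiffOn ℝ ∞ f W) (hgs : ContDiffOn ℝ ∞ g W) (z : ℂ) :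
    MemScalarH10 W (fun x => f x - z * g x) := by
  obtain ⟨φ, hφ, h0, h1⟩ := hf
  obtain ⟨ψ, hψ, g0, g1⟩ := hg
  have hWm := hW.measurableSet
  have hlim : ∀ {p q : ℕ → R3 → ℂ} {P Q : R3 → ℂ}, (∀ n, Continuous (p n)) →
      (∀ n, Continuous (q n)) → ContinuousOn P W → ContinuousOn Q W →
      Tendsto (fun n => eLpNorm (fun x => p n x - P x) 2 (volume.restrict W)) atTop (𝓝 0) →
      Tendsto (fun n => eLpNorm (fun x => q n x - Q x) 2 (volume.restrict W)) atTop (𝓝 0) →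
      Tendsto (fun n => eLpNorm (fun x => (p n x - z * q n x) - (P x - z * Q x)) 2
        (volume.restrict W)) atTop (𝓝 0) := by
    intro p q P Q hp hq hP hQ tp tq
    have hle : ∀ n, eLpNorm (fun x => (p n x - z * q n x) - (P x - z * Q x)) 2
        (volume.restrict W) ≤ eLpNorm (fun x => p n x - P x) 2 (volume.restrict W)
          + ‖z‖ₑ * eLpNorm (fun x => q n x - Q x) 2 (volume.restrict W) := by
      intro n
      have e : (fun x => (p n x - z * q n x) - (P x - z * Q x))
          = (fun x => p n x - P x) - z • fun x => q n x - Q x := by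
        ext x
        simp only [Pi.sub_apply, Pi.smul_apply, smul_eq_mul]
        ring
      rw [e, ← eLpNorm_const_smul]
      refine eLpNorm_sub_le ?_ ?_ (by norm_num)
      · exact (hp n).aestronglyMeasurable.sub (hP.aestronglyMeasurable hWm)
      · exact ((hq n).aestronglyMeasurable.sub (hQ.aestronglyMeasurable hWm)).const_smul z
    have ht : Tendsto (fun n => eLpNorm (fun x => p n x - P x) 2 (volume.restrict W)
          + ‖z‖ₑ * eLpNorm (fun x => q n x - Q x) 2 (volume.restrict W)) atTop (𝓝 0) := by
      simpa using tp.add (ENNReal.Tendsto.const_mul tq (Or.inr enorm_ne_top))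
    exact tendsto_of_tendsto_of_tendsto_of_le_of_le tendsto_const_nhds ht (fun _ => zero_le) hle
  refine ⟨fun n x => φ n x - z * ψ n x, fun n => ⟨(hφ n).1.sub (contDiff_const.mul (hψ n).1),
    (hφ n).2.1.sub (hψ n).2.1.mul_left, ?_⟩, ?_, fun j => ?_⟩
  · exact (tsupport_sub _ _).trans (Set.union_subset (hφ n).2.2
      (tsupport_mul_subset_right.trans (hψ n).2.2))
  · exact hlim (fun n => (hφ n).1.continuous) (fun n => (hψ n).1.continuous) hfs.continuousOn
      hgs.continuousOn h0 g0
  · have hl := hlim (fun n => (contDiff_pd (m := ∞) (hφ n).1 (by simp) j).continuous)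
      (fun n => (contDiff_pd (m := ∞) (hψ n).1 (by simp) j).continuous)
      (contDiffOn_pd (m := ∞) hW hfs (by simp) j).continuousOn
      (contDiffOn_pd (m := ∞) hW hgs (by simp) j).continuousOn (h1 j) (g1 j)
    refine hl.congr fun n => eLpNorm_congr_ae ?_
    filter_upwards [ae_restrict_mem hWm] with x hx
    have d1 := (hφ n).1.differentiable (by simp) x
    have d2 := (hψ n).1.differentiable (by simp) x
    have d3 := (hfs.contDiffAt (hW.mem_nhds hx)).differentiableAt (by simp)
    have d4 := (hgs.contDiffAt (hW.mem_nhds hx)).differentiableAt (by simp)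
    rw [pd_sub d1 (d2.const_mul z), pd_sub d3 (d4.const_mul z), pd_const_mul d2, pd_const_mul d4]

lemma LocL2.sub_const_mul {f g : R3 → ℂ} (hf : LocL2 W f) (hg : LocL2 W g) (z : ℂ) :
    LocL2 W (fun x => f x - z * g x) := fun R => (hf R).sub ((hg R).const_mul z)

lemma LocL2.congr (hW : IsOpen W) {f g : R3 → ℂ} (hf : LocL2 W f) (h : ∀ x ∈ W, f x = g x) :
    LocL2 W g := fun R => (hf R).ae_eq (by
  filter_upwards [ae_restrict_mem (hW.inter Metric.isOpen_ball).measurableSet] with x hx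
  exact h x hx.1)

lemma IsDirichletSolution.sub_const_mul (hW : IsOpen W) (hu : IsDirichletSolution c omega W u)
    {v : Fin 3 → R3 → ℂ} (hv : IsDirichletSolution c omega W v) (z : ℂ) :
    IsDirichletSolution c omega W (fun i x => u i x - z * v i x) := by
  have hd : ∀ {f : R3 → ℂ}, ContDiffOn ℝ ∞ f W → ∀ {x}, x ∈ W → DifferentiableAt ℝ f x :=
    fun hf _ hx => (hf.contDiffAt (hW.mem_nhds hx)).differentiableAt (by simp)
  have hpd : ∀ {f g : R3 → ℂ}, ContDiffOn ℝ ∞ f W → ContDiffOn ℝ ∞ g W → ∀ j, ∀ x ∈ W,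
      pd (fun y => f y - z * g y) j x = pd f j x - z * pd g j x := fun hf hg j x hx => by
    rw [pd_sub (hd hf hx) ((hd hg hx).const_mul z), pd_const_mul (hd hg hx)]
  have hc : ∀ {f : R3 → ℂ}, ContDiffOn ℝ ∞ f W → ∀ j, ContDiffOn ℝ ∞ (pd f j) W := fun hf j =>
    contDiffOn_pd hW hf (by simp) j
  refine ⟨fun i => (hu.smooth i).sub (contDiffOn_const.mul (hv.smooth i)), fun k x hx => ?_,
    fun i => (hu.locL2 i).sub_const_mul (hv.locL2 i) z, fun i j => ?_, fun i χ hχ hχc => ?_⟩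
  · have h2 : ∀ i j l, pd (pd (fun y => u i y - z * v i y) j) l x
        = pd (pd (u i) j) l x - z * pd (pd (v i) j) l x := by
      intro i j l
      have : pd (fun y => u i y - z * v i y) j =ᶠ[𝓝 x]
          fun y => pd (u i) j y - z * pd (v i) j y := by
        filter_upwards [hW.mem_nhds hx] with y hy using hpd (hu.smooth i) (hv.smooth i) j y hy
      rw [pd_congr this, hpd (hc (hu.smooth i) j) (hc (hv.smooth i) j) l x hx]
    have e1 := hu.eq k x hx
    have e2 := hv.eq k x hx
    have e3 : ∑ i, ∑ j, ∑ l, (c i j k l : ℂ) * pd (pd (fun y => u i y - z * v i y) j) l x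
        = (∑ i, ∑ j, ∑ l, (c i j k l : ℂ) * pd (pd (u i) j) l x)
          - z * ∑ i, ∑ j, ∑ l, (c i j k l : ℂ) * pd (pd (v i) j) l x := by
      simp only [h2, mul_sub, Finset.sum_sub_distrib, Finset.mul_sum]
      congr 1
      refine Finset.sum_congr rfl fun i _ => Finset.sum_congr rfl fun j _ =>
        Finset.sum_congr rfl fun l _ => ?_
      ring
    rw [e3]
    linear_combination e1 - z * e2
  · exact ((hu.locL2_pd i j).sub_const_mul (hv.locL2_pd i j) z).congr hW
      fun x hx => (hpd (hu.smooth i) (hv.smooth i) j x hx).symm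
  · have hX : ContDiffOn ℝ ∞ (fun x => (χ x : ℂ)) W :=
      (Complex.ofRealCLM.contDiff.comp hχ).contDiffOn
    have h := (hu.dirichlet i χ hχ hχc).sub_const_mul hW (hv.dirichlet i χ hχ hχc)
      (hX.mul (hu.smooth i)) (hX.mul (hv.smooth i)) z
    have e : (fun x => (χ x : ℂ) * (u i x - z * v i x))
        = fun x => (χ x : ℂ) * u i x - z * ((χ x : ℂ) * v i x) := by
      ext x; ring
    rw [e]
    exact h

/-! ### The Lamé system -/

/-- The coefficients `μ δ_{ik} δ_{jl} + (λ+μ) δ_{ij} δ_{kl}` of the Lamé operator. They are chosen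
so that the associated quadratic form controls the whole gradient, without Korn's inequality. -/
def lameCoeff (lam mu : ℝ) (i j k l : Fin 3) : ℝ :=
  (if i = k ∧ j = l then mu else 0) + if i = j ∧ k = l then lam + mu else 0

lemma lameCoeff_symm (lam mu : ℝ) (i j k l : Fin 3) :
    lameCoeff lam mu i j k l = lameCoeff lam mu k l i j := by
  simp only [lameCoeff, eq_comm (a := i) (b := k), eq_comm (a := j) (b := l),
    and_comm (a := i = j) (b := k = l)]

lemma sum_lameCoeff_mul (lam mu : ℝ) (k : Fin 3) (F : Fin 3 → Fin 3 → Fin 3 → ℂ) :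
    ∑ i, ∑ j, ∑ l, (lameCoeff lam mu i j k l : ℂ) * F i j l
      = (mu : ℂ) * ∑ j, F k j j + ((lam + mu : ℝ) : ℂ) * ∑ i, F i i k := by
  fin_cases k <;> simp [lameCoeff, Fin.sum_univ_three] <;> ring

lemma coercive_lameCoeff {lam mu : ℝ} (h : 0 ≤ lam + mu) : Coercive (lameCoeff lam mu) mu := by
  intro P
  simp only [sum_lameCoeff_mul lam mu _ (fun i j l => P i j * conj (P _ l))]
  have h1 : ∑ k, ((mu : ℂ) * ∑ j, P k j * conj (P k j)
      + ((lam + mu : ℝ) : ℂ) * ∑ i, P i i * conj (P k k))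
      = (((mu * ∑ i, ∑ j, ‖P i j‖ ^ 2) + (lam + mu) * ‖∑ i, P i i‖ ^ 2 : ℝ) : ℂ) := by
    rw [Finset.sum_add_distrib]
    push_cast
    congr 1
    · rw [Finset.mul_sum]
      refine Finset.sum_congr rfl fun i _ => ?_
      congr 1
      exact Finset.sum_congr rfl fun j _ => Complex.mul_conj' _
    · rw [← Finset.mul_sum, ← Complex.mul_conj', map_sum, Finset.sum_mul_sum, Finset.sum_comm]
  rw [h1, Complex.ofReal_re]
  have : 0 ≤ (lam + mu) * ‖∑ i, P i i‖ ^ 2 := by positivity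
  linarith

lemma contDiffOn_apply {n : WithTop ℕ∞} {v : R3 → C3} (hv : ContDiffOn ℝ n v W) (i : Fin 3) :
    ContDiffOn ℝ n (fun y => v y i) W :=
  ((EuclideanSpace.proj (𝕜 := ℂ) i).restrictScalars ℝ).contDiff.comp_contDiffOn hv

lemma pd_apply {v : R3 → C3} {x : R3} (hv : DifferentiableAt ℝ v x) (i j : Fin 3) :
    pd (fun y => v y i) j x = (fderiv ℝ v x (basisVec j)) i := by
  have h := ((EuclideanSpace.proj (𝕜 := ℂ) i).restrictScalars ℝ).hasFDerivAt.comp x hv.hasFDerivAt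
  have h2 : HasFDerivAt (fun y => v y i)
    (((EuclideanSpace.proj (𝕜 := ℂ) i).restrictScalars ℝ).comp (fderiv ℝ v x)) x := h
  rw [pd, h2.fderiv]
  rfl

lemma pd_pd_eq {f : R3 → ℂ} {x : R3} (hf : ContDiffAt ℝ 2 f x) (j l : Fin 3) :
    pd (pd f j) l x = fderiv ℝ (fderiv ℝ f) x (basisVec l) (basisVec j) := by
  have hd : DifferentiableAt ℝ (fderiv ℝ f) x :=
    (hf.fderiv_right (m := 1) (by norm_num)).differentiableAt one_ne_zero
  have h := hd.hasFDerivAt.clm_apply (hasFDerivAt_const (basisVec j) x)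
  rw [pd, show pd f j = fun y => fderiv ℝ f y (basisVec j) from rfl, h.fderiv]
  simp

lemma laplacian_apply {v : R3 → C3} {x : R3} (hv : ContDiffAt ℝ 2 v x) (k : Fin 3) :
    (Laplacian.laplacian v x) k = ∑ j, pd (pd (fun y => v y k) j) j x := by
  have h := hv.laplacian_CLM_comp_left (l := (EuclideanSpace.proj (𝕜 := ℂ) k).restrictScalars ℝ)
  have hk : ContDiffAt ℝ 2 (fun y => v y k) x :=
    ((EuclideanSpace.proj (𝕜 := ℂ) k).restrictScalars ℝ).contDiff.contDiffAt.comp x hv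
  have e : Laplacian.laplacian (fun y => v y k) x = (Laplacian.laplacian v x) k := h
  rw [← e, InnerProductSpace.laplacian_eq_iteratedFDeriv_orthonormalBasis _
    (EuclideanSpace.basisFun (Fin 3) ℝ)]
  refine Finset.sum_congr rfl fun j _ => ?_
  rw [pd_pd_eq hk, iteratedFDeriv_two_apply]
  simp [basisVec]

lemma lameOp_apply {v : R3 → C3} (hW : IsOpen W) (hv : ContDiffOn ℝ ∞ v W) {x : R3} (hx : x ∈ W)
    (k : Fin 3) :
    (lameOp lam mu v x) k
      = ∑ i, ∑ j, ∑ l, (lameCoeff lam mu i j k l : ℂ) * pd (pd (fun y => v y i) j) l x := by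
  have hvx := hv.contDiffAt (hW.mem_nhds hx)
  have hcomp : ∀ i, ContDiffOn ℝ ∞ (fun y => v y i) W := fun i =>
    contDiffOn_apply hv i
  have hdiv : div v =ᶠ[𝓝 x] fun y => ∑ j, pd (fun z => v z j) j y := by
    filter_upwards [hW.mem_nhds hx] with y hy
    refine Finset.sum_congr rfl fun j _ => ?_
    rw [pd_apply ((hv.contDiffAt (hW.mem_nhds hy)).differentiableAt (by simp)), partialD]
  have hgrad : (grad (div v) x) k = ∑ j, pd (pd (fun z => v z j) j) k x := by
    change fderiv ℝ (div v) x (basisVec k) = _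
    rw [hdiv.fderiv_eq, fderiv_fun_sum fun j _ => ((contDiffOn_pd (m := ∞) hW (hcomp j) (by simp)
      j).contDiffAt (hW.mem_nhds hx)).differentiableAt (by simp)]
    simp [pd]
  rw [sum_lameCoeff_mul, lameOp, PiLp.add_apply, PiLp.smul_apply, PiLp.smul_apply, hgrad,
    laplacian_apply (hvx.of_le (WithTop.coe_le_coe.2 le_top)), Complex.real_smul, Complex.real_smul]

lemma norm_apply_le (v : C3) (i : Fin 3) : ‖v i‖ ≤ ‖v‖ := PiLp.norm_apply_le v i

/-- The components of a total field solve the Lamé system with Dirichlet data. -/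
lemma IsScatteredField.isDirichletSolution {D : Set R3} {uin usc : R3 → C3}
    (h : IsScatteredField lam mu omega D uin usc) :
    IsDirichletSolution (lameCoeff lam mu) omega (exterior D) (fun i x => (uin + usc) x i) := by
  have hW : IsOpen (exterior D) := isClosed_closure.isOpen_compl
  have hdiff : ∀ {v : R3 → C3}, ContDiffOn ℝ ∞ v (exterior D) → ∀ x ∈ exterior D,
      DifferentiableAt ℝ v x := fun hv x hx =>
    (hv.contDiffAt (hW.mem_nhds hx)).differentiableAt (by simp)
  set v := uin + usc with hv
  have hcomp : ∀ i, ContDiffOn ℝ ∞ (fun y => v y i) (exterior D) := fun i =>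
    contDiffOn_apply h.smooth i
  refine ⟨hcomp, fun k x hx => ?_, fun i R => ?_, fun i j R => ?_, fun i χ hχ hc => ?_⟩
  · rw [← lameOp_apply hW h.smooth hx]
    have := congrArg (fun z : C3 => z k) (h.navier x hx)
    simp only [PiLp.add_apply, PiLp.smul_apply, PiLp.zero_apply, Complex.real_smul] at this
    rw [← this]
    push_cast
    rfl
  · have hm := (hW.inter (Metric.isOpen_ball (x := (0 : R3)) (ε := R))).measurableSet
    exact (h.memH1loc R).1.of_le (((hcomp i).continuousOn.mono
      Set.inter_subset_left).aestronglyMeasurable hm)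
      (Eventually.of_forall fun x => norm_apply_le _ i)
  · have hm := (hW.inter (Metric.isOpen_ball (x := (0 : R3)) (ε := R))).measurableSet
    refine (h.memH1loc R).2.of_le (((contDiffOn_pd (m := ∞) hW (hcomp i) (by simp)
      j).continuousOn.mono Set.inter_subset_left).aestronglyMeasurable hm) ?_
    filter_upwards [ae_restrict_mem hm] with x hx
    rw [pd_apply (hdiff h.smooth x hx.1)]
    refine (norm_apply_le _ i).trans ?_
    simpa [norm_basisVec] using (fderiv ℝ v x).le_opNorm (basisVec j)
  · obtain ⟨φ, hφ, h0, h1⟩ := h.dirichlet χ hχ hc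
    have hsm : ContDiffOn ℝ ∞ (fun x => χ x • v x) (exterior D) := hχ.contDiffOn.smul h.smooth
    refine ⟨fun n x => φ n x i, fun n => ⟨
      contDiffOn_univ.1 (contDiffOn_apply (hφ n).1.contDiffOn i),
      (hφ n).2.1.comp_left (g := fun z : C3 => z i) rfl, ?_⟩, ?_, fun j => ?_⟩
    · refine (closure_mono fun x hx => ?_).trans (hφ n).2.2
      intro h0
      exact hx (by simp [h0])
    · refine tendsto_of_tendsto_of_tendsto_of_le_of_le tendsto_const_nhds h0 (fun _ => zero_le)
        fun n => eLpNorm_mono fun x => ?_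
      have := norm_apply_le (φ n x - χ x • v x) i
      rwa [PiLp.sub_apply, PiLp.smul_apply, Complex.real_smul] at this
    · refine tendsto_of_tendsto_of_tendsto_of_le_of_le tendsto_const_nhds h1 (fun _ => zero_le)
        fun n => eLpNorm_mono_ae ?_
      filter_upwards [ae_restrict_mem hW.measurableSet] with x hx
      have e : (fun y => (χ y : ℂ) * v y i) = fun y => (χ y • v y) i := by
        ext y
        rw [PiLp.smul_apply, Complex.real_smul]
      rw [e, pd_apply (hdiff hsm x hx), pd_apply ((hφ n).1.differentiable (by simp) x),
        ← PiLp.sub_apply, ← sub_apply]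
      refine (norm_apply_le _ i).trans ?_
      have hop := (fderiv ℝ (φ n) x - fderiv ℝ (fun y => χ y • v y) x).le_opNorm (basisVec j)
      rwa [norm_basisVec, mul_one] at hop

/-! ### Far-field patterns -/

/-- The direction `x / |x|` of `x ≠ 0` as a point of the sphere; an arbitrary point for `x = 0`. -/
def direction (x : R3) : S2 :=
  if h : x = 0 then ⟨basisVec 0, by simp [norm_basisVec]⟩
  else ⟨‖x‖⁻¹ • x, by
    have : ‖x‖ ≠ 0 := norm_ne_zero_iff.2 h
    simp [norm_smul, this]⟩

lemma coe_direction {x : R3} (hx : x ≠ 0) : (direction x : R3) = ‖x‖⁻¹ • x := by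
  simp [direction, hx]

lemma direction_coe (θ : S2) : direction (θ : R3) = θ := by
  have hn : ‖(θ : R3)‖ = 1 := mem_sphere_zero_iff_norm.1 θ.2
  have hθ : (θ : R3) ≠ 0 := norm_ne_zero_iff.1 (by rw [hn]; exact one_ne_zero)
  ext1
  rw [coe_direction hθ, hn, inv_one, one_smul]

lemma direction_smul {t : ℝ} (ht : 0 < t) {x : R3} (hx : x ≠ 0) :
    direction (t • x) = direction x := by
  ext1
  rw [coe_direction (smul_ne_zero ht.ne' hx), coe_direction hx, norm_smul,
    Real.norm_of_nonneg ht.le, smul_smul]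
  congr 1
  field_simp

/-- The amplitude of a far-field pattern `U`, extended to all of space as a function of the
direction, and normalized by the constant `s`. -/
def amplitude (s : ℝ) (U : S2 → C3) (i : Fin 3) (x : R3) : ℂ :=
  ((s⁻¹ : ℝ) : ℂ) * U (direction x) i

lemma homog_amplitude (s : ℝ) (U : S2 → C3) (i : Fin 3) : Homog (amplitude s U i) :=
  fun t ht x hx => by rw [amplitude, direction_smul ht hx, amplitude]

lemma HasFarField.outgoing {usc : R3 → C3} {Up Us : S2 → C3}
    (h : HasFarField lam mu omega usc Up Us) (i : Fin 3) :
    Outgoing (kP lam mu omega) (kS mu omega) (fun x => usc x i)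
      (amplitude (4 * Real.pi * (lam + mu)) Up i) (amplitude (4 * Real.pi * mu) Us i) := by
  obtain ⟨C, R, hb⟩ := h
  have hlim : Tendsto (fun x : R3 => C * ‖x‖⁻¹) (Bornology.cobounded R3) (𝓝 0) := by
    simpa using tendsto_inv_norm_cobounded.const_mul C
  refine squeeze_zero_norm' ?_ hlim
  filter_upwards [tendsto_norm_cobounded_atTop.eventually (eventually_gt_atTop 0),
    tendsto_norm_cobounded_atTop.eventually (eventually_ge_atTop R)] with x hx hxR
  have hx0 : x ≠ 0 := norm_pos_iff.1 hx
  have h1 := (norm_apply_le _ i).trans (hb ‖x‖ hx hxR (direction x))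
  rw [coe_direction hx0, smul_smul, mul_inv_cancel₀ hx.ne', one_smul] at h1
  simp only [PiLp.sub_apply, PiLp.add_apply, PiLp.smul_apply, smul_eq_mul] at h1
  have hxc : ((‖x‖ : ℝ) : ℂ) ≠ 0 := by exact_mod_cast hx.ne'
  have e : (‖x‖ : ℂ) * usc x i - twoWave (kP lam mu omega) (kS mu omega)
      (amplitude (4 * Real.pi * (lam + mu)) Up i) (amplitude (4 * Real.pi * mu) Us i) 1 x
      = (‖x‖ : ℂ) * (usc x i -
        (Complex.exp (Complex.I * ((kP lam mu omega * ‖x‖ : ℝ) : ℂ))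
            / ((4 * Real.pi * (lam + mu) * ‖x‖ : ℝ) : ℂ) * Up (direction x) i
        + Complex.exp (Complex.I * ((kS mu omega * ‖x‖ : ℝ) : ℂ))
            / ((4 * Real.pi * mu * ‖x‖ : ℝ) : ℂ) * Us (direction x) i)) := by
    rw [mul_sub]
    congr 1
    simp only [twoWave, amplitude, phase, mul_one, Complex.ofReal_mul, Complex.ofReal_inv,
      div_eq_mul_inv, mul_inv]
    field_simp
  rw [e, norm_mul, Complex.norm_real, norm_norm]
  calc _ ≤ ‖x‖ * (C / ‖x‖ ^ 2) := by gcongr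
    _ = C * ‖x‖⁻¹ := by field_simp

lemma mem_exterior_translate {a x : R3} {D : Set R3} :
    x + a ∈ exterior (translate a D) ↔ x ∈ exterior D := by
  have h : closure (translate a D) = (Homeomorph.addLeft a) '' closure D :=
    ((Homeomorph.addLeft a).image_closure D).symm
  simp only [exterior, Set.mem_compl_iff, h, not_iff_not]
  constructor
  · rintro ⟨y, hy, hyx⟩
    have : y = x := by
      have hyx' : a + y = x + a := hyx
      rw [add_comm x a] at hyx'
      exact add_left_cancel hyx'
    exact this ▸ hy
  · exact fun hx => ⟨x, hx, add_comm a x⟩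

lemma contDiff_incident (d dperp : R3) (alpha beta : ℂ) :
    ContDiff ℝ ∞ (incident lam mu omega d dperp alpha beta) := by
  have h : ∀ (k : ℝ) (z : ℂ) (v : C3), ContDiff ℝ ∞ fun x : R3 =>
      (z * Complex.exp (Complex.I * ((k * inner ℝ x d : ℝ) : ℂ))) • v := by
    intro k z v
    have h1 : ContDiff ℝ ∞ fun x : R3 => phase (k * inner ℝ x d) :=
      contDiff_phase.comp (contDiff_const.mul (contDiff_id.inner ℝ contDiff_const))
    exact (contDiff_const.mul h1).smul contDiff_const
  exact (h _ _ _).add (h _ _ _)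

lemma kP_pos (hmu : 0 < mu) (hl : 0 < lam + mu) (homega : 0 < omega) : 0 < kP lam mu omega :=
  div_pos homega (Real.sqrt_pos.2 (by linarith))

lemma kS_pos (hmu : 0 < mu) (homega : 0 < omega) : 0 < kS mu omega :=
  div_pos homega (Real.sqrt_pos.2 hmu)

lemma kP_lt_kS (hmu : 0 < mu) (hl : 0 < lam + mu) (homega : 0 < omega) :
    kP lam mu omega < kS mu omega :=
  div_lt_div_of_pos_left homega (Real.sqrt_pos.2 hmu)
    (Real.sqrt_lt_sqrt hmu.le (by linarith))

/-- The translation law for an incident field that is multiplied by a constant `z` under the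
translation by `a`. The difference of the translated total field and `z` times the original one is
a radiating solution with vanishing Dirichlet data. -/
theorem farField_translate (hmu : 0 < mu) (hl : 0 < lam + mu) (homega : 0 < omega)
    {D : Set R3} (hD : Bornology.IsBounded D) {a : R3} {uin usc usc' : R3 → C3} {z : ℂ}
    (huin : ContDiff ℝ ∞ uin) (hz : ∀ x, uin (x + a) = z • uin x)
    (h : IsScatteredField lam mu omega D uin usc)
    (h' : IsScatteredField lam mu omega (translate a D) uin usc')
    {Up Us Vp Vs : S2 → C3} (hfar : HasFarField lam mu omega usc Up Us)
    (hfar' : HasFarField lam mu omega usc' Vp Vs) (θ : S2) :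
    phase (kP lam mu omega * inner ℝ (θ : R3) a) • Vp θ = z • Up θ ∧
      phase (kS mu omega * inner ℝ (θ : R3) a) • Vs θ = z • Us θ := by
  have hW : IsOpen (exterior D) := isClosed_closure.isOpen_compl
  have hpre : (fun x : R3 => x + a) ⁻¹' exterior (translate a D) = exterior D := by
    ext x; exact mem_exterior_translate
  have hw := ((hpre ▸ h'.isDirichletSolution.comp_add a : IsDirichletSolution (lameCoeff lam mu)
    omega (exterior D) (fun i x => (uin + usc') (x + a) i))).sub_const_mul hW
    h.isDirichletSolution z
  -- the incident fields cancel
  have hwe : (fun (i : Fin 3) (x : R3) => (uin + usc') (x + a) i - z * (uin + usc) x i)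
      = fun i x => usc' (x + a) i - z * usc x i := by
    ext i x
    simp only [Pi.add_apply, hz, PiLp.add_apply, PiLp.smul_apply, smul_eq_mul]
    ring
  rw [hwe] at hw
  obtain ⟨R, hR⟩ := hD.closure.subset_closedBall (0 : R3)
  have hext : ∀ x : R3, max R 1 < ‖x‖ → x ∈ exterior D := fun x hx hxD => by
    have := mem_closedBall_zero_iff.1 (hR hxD)
    exact absurd ((le_max_left R 1).trans_lt hx) (not_lt.2 this)
  have hext' : ∀ x : R3, max R 1 + ‖a‖ < ‖x‖ → x ∈ exterior (translate a D) := fun x hx => by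
    have hm := hext (x - a) (by
      have := norm_sub_norm_le x a
      linarith)
    rw [← mem_exterior_translate (a := a), sub_add_cancel] at hm
    exact hm
  have hs' : ∀ i, ContDiffOn ℝ 1 (fun x => usc' x i) {x | max R 1 + ‖a‖ < ‖x‖} := fun i => by
    have h1 : ContDiffOn ℝ ∞ usc' (exterior (translate a D)) := by
      have := h'.smooth.sub huin.contDiffOn
      refine this.congr fun x _ => ?_
      simp
    exact ((contDiffOn_apply h1 i).of_le (by simp)).mono hext'
  set Ap := fun i => amplitude (4 * Real.pi * (lam + mu)) Up i with hAp
  set As := fun i => amplitude (4 * Real.pi * mu) Us i with hAs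
  set Bp := fun i => amplitude (4 * Real.pi * (lam + mu)) Vp i with hBp
  set Bs := fun i => amplitude (4 * Real.pi * mu) Vs i with hBs
  have hk := (kP_lt_kS hmu hl homega).ne
  -- a far-field pattern is not assumed continuous; its continuity is used to translate it
  have hBpc : ∀ i, ContinuousOn (Bp i) {0}ᶜ := fun i =>
    (hfar'.outgoing i).continuousOn (homog_amplitude _ _ _) (homog_amplitude _ _ _) hk (hs' i)
  have hBsc : ∀ i, ContinuousOn (Bs i) {0}ᶜ := fun i =>
    (hfar'.outgoing i).swap.continuousOn (homog_amplitude _ _ _) (homog_amplitude _ _ _) hk.symm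
      (hs' i)
  let P : Fin 3 → R3 → ℂ := fun i x =>
    phase (kP lam mu omega * inner ℝ (‖x‖⁻¹ • x) a) * Bp i x - z * Ap i x
  let S : Fin 3 → R3 → ℂ := fun i x =>
    phase (kS mu omega * inner ℝ (‖x‖⁻¹ • x) a) * Bs i x - z * As i x
  have hdir : ∀ {t : ℝ}, 0 < t → ∀ x : R3, x ≠ 0 → ‖t • x‖⁻¹ • (t • x) = ‖x‖⁻¹ • x := by
    intro t ht x hx
    rw [norm_smul, Real.norm_of_nonneg ht.le, smul_smul]
    congr 1
    field_simp
  have hP : ∀ i, Homog (P i) := fun i t ht x hx => by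
    simp only [P, hdir ht x hx, Ap, Bp, homog_amplitude _ _ _ t ht x hx]
  have hS : ∀ i, Homog (S i) := fun i t ht x hx => by
    simp only [S, hdir ht x hx, As, Bs, homog_amplitude _ _ _ t ht x hx]
  have hout : ∀ i, Outgoing (kP lam mu omega) (kS mu omega)
      (fun x => usc' (x + a) i - z * usc x i) (P i) (S i) := by
    intro i
    have h1 := (hfar'.outgoing i).comp_add (homog_amplitude _ _ _) (homog_amplitude _ _ _)
      (hBpc i) (hBsc i) a
    have h2 := h1.sub ((hfar.outgoing i).const_mul z)
    rw [mul_zero, sub_zero] at h2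
    refine h2.congr fun x => ?_
    simp only [twoWave, P, S, Ap, As, Bp, Bs]
    ring
  have hn : ‖(θ : R3)‖ = 1 := mem_sphere_zero_iff_norm.1 θ.2
  have hθ : (θ : R3) ≠ 0 := norm_ne_zero_iff.1 (by rw [hn]; exact one_ne_zero)
  have hzero := fun i => hw.amplitude_eq_zero hW hmu (coercive_lameCoeff hl.le)
    (lameCoeff_symm lam mu) (lt_max_of_lt_right one_pos) hext hP hS hout
    (kP_pos hmu hl homega) (kS_pos hmu homega) hk i (θ : R3) hθ
  have hcancel : ∀ {s : ℝ}, s ≠ 0 → ∀ {p q r : ℂ},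
      p * (((s⁻¹ : ℝ) : ℂ) * q) - z * (((s⁻¹ : ℝ) : ℂ) * r) = 0 → p * q = z * r := by
    intro s hs p q r hpq
    have hsc : ((s⁻¹ : ℝ) : ℂ) ≠ 0 := by exact_mod_cast inv_ne_zero hs
    refine mul_left_cancel₀ hsc ?_
    linear_combination hpq
  have hpi := Real.pi_pos
  constructor
  · ext i
    have := (hzero i).1
    simp only [P, Ap, Bp, amplitude, direction_coe, hn, inv_one, one_smul] at this
    simpa using hcancel (by positivity) this
  · ext i
    have := (hzero i).2
    simp only [S, As, Bs, amplitude, direction_coe, hn, inv_one, one_smul] at this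
    simpa using hcancel (by positivity) this

lemma eq_phase_smul_of_phase_smul_eq {s t : ℝ} {v w : C3} (h : phase s • v = phase t • w) :
    v = phase (t - s) • w := by
  have h1 := congrArg (fun y : C3 => phase (-s) • y) h
  simp only [smul_smul, ← phase_add] at h1
  rw [neg_add_cancel, show phase 0 = 1 by simp [phase], one_smul] at h1
  rw [h1]
  congr 2
  ring

lemma incident_pressure_add (d dperp a x : R3) :
    incident lam mu omega d dperp 1 0 (x + a)
      = phase (kP lam mu omega * inner ℝ d a) • incident lam mu omega d dperp 1 0 x := by
  have h := phase_add (kP lam mu omega * inner ℝ d a) (kP lam mu omega * inner ℝ x d)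
  have e : kP lam mu omega * inner ℝ (x + a) d
      = kP lam mu omega * inner ℝ d a + kP lam mu omega * inner ℝ x d := by
    rw [inner_add_left, real_inner_comm a d]; ring
  simp only [incident, one_mul, zero_mul, zero_smul, add_zero, smul_smul]
  congr 1
  rw [e]
  exact h

lemma incident_shear_add (d dperp a x : R3) :
    incident lam mu omega d dperp 0 1 (x + a)
      = phase (kS mu omega * inner ℝ d a) • incident lam mu omega d dperp 0 1 x := by
  have h := phase_add (kS mu omega * inner ℝ d a) (kS mu omega * inner ℝ x d)
  have e : kS mu omega * inner ℝ (x + a) d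
      = kS mu omega * inner ℝ d a + kS mu omega * inner ℝ x d := by
    rw [inner_add_left, real_inner_comm a d]; ring
  simp only [incident, one_mul, zero_mul, zero_smul, zero_add, smul_smul]
  congr 1
  rw [e]
  exact h

end ElasticScattering

end

theorem mainTheorem4 (lam mu omega : ℝ) (hmu : 0 < mu) (hlam : 0 < 3 * lam + 2 * mu)
    (homega : 0 < omega)
    (d dperp : ElasticScattering.R3) (hd : ‖d‖ = 1) (hdperp : ‖dperp‖ = 1)
    (horth : inner ℝ d dperp = 0)
    (D : Set ElasticScattering.R3) (hD : ElasticScattering.IsScatterer D)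
    (a : ElasticScattering.R3) :
    (∀ Up Us Vp Vs : ElasticScattering.S2 → ElasticScattering.C3,
      ElasticScattering.IsFarFieldPattern lam mu omega d dperp 1 0 D Up Us →
      ElasticScattering.IsFarFieldPattern lam mu omega d dperp 1 0
        (ElasticScattering.translate a D) Vp Vs →
      ∀ θ : ElasticScattering.S2,
        Vp θ = ElasticScattering.phase
          (inner ℝ (ElasticScattering.kP lam mu omega • (d - (θ : ElasticScattering.R3))) a)
            • Up θ ∧
        Vs θ = ElasticScattering.phase
          (inner ℝ (ElasticScattering.kP lam mu omega • d
            - ElasticScattering.kS mu omega • (θ : ElasticScattering.R3)) a) • Us θ) ∧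
    (∀ Up Us Vp Vs : ElasticScattering.S2 → ElasticScattering.C3,
      ElasticScattering.IsFarFieldPattern lam mu omega d dperp 0 1 D Up Us →
      ElasticScattering.IsFarFieldPattern lam mu omega d dperp 0 1
        (ElasticScattering.translate a D) Vp Vs →
      ∀ θ : ElasticScattering.S2,
        Vp θ = ElasticScattering.phase
          (inner ℝ (ElasticScattering.kS mu omega • d
            - ElasticScattering.kP lam mu omega • (θ : ElasticScattering.R3)) a) • Up θ ∧
        Vs θ = ElasticScattering.phase
          (inner ℝ (ElasticScattering.kS mu omega • (d - (θ : ElasticScattering.R3))) a)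
            • Us θ) := by
  have hl : 0 < lam + mu := by linarith
  refine ⟨?_, ?_⟩
  · rintro Up Us Vp Vs ⟨usc, hsc, hfar⟩ ⟨usc', hsc', hfar'⟩ θ
    obtain ⟨hp, hs⟩ := ElasticScattering.farField_translate hmu hl homega hD.isBounded
      (ElasticScattering.contDiff_incident d dperp 1 0)
      (ElasticScattering.incident_pressure_add d dperp a) hsc hsc' hfar hfar' θ
    rw [ElasticScattering.eq_phase_smul_of_phase_smul_eq hp,
      ElasticScattering.eq_phase_smul_of_phase_smul_eq hs]
    simp only [inner_sub_left, real_inner_smul_left, mul_sub, and_self]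
  · rintro Up Us Vp Vs ⟨usc, hsc, hfar⟩ ⟨usc', hsc', hfar'⟩ θ
    obtain ⟨hp, hs⟩ := ElasticScattering.farField_translate hmu hl homega hD.isBounded
      (ElasticScattering.contDiff_incident d dperp 0 1)
      (ElasticScattering.incident_shear_add d dperp a) hsc hsc' hfar hfar' θ
    rw [ElasticScattering.eq_phase_smul_of_phase_smul_eq hp,
      ElasticScattering.eq_phase_smul_of_phase_smul_eq hs]
    simp only [inner_sub_left, real_inner_smul_left, mul_sub, and_self]
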